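/- Let $M$ be a closed, oriented, smooth $n$-dimensional manifold and let $\operatorname{Prob}(M)$ be the set of smooth positive $n$-forms $\mu$ on $M$ with $\int_M\mu=1$; its tangent space at every point is $\{a\in\Omega^n(M):\int_M a=0\}$. Fix $\lambda\in\operatorname{Prob}(M)$, and write $a/\mu$ for the Radon--Nikodym derivative. For $\alpha\in\mathbb R$ the $\alpha$-connection on $\operatorname{Prob}(M)$ is $$\overline\nabla^{(\alpha)}_a b = Db.a-\tfrac{1+\alpha}{2}\Big(\tfrac{a}{\mu}b-\Big(\int_M\tfrac a\mu\tfrac b\mu\,\mu\Big)\mu\Big),$$ and an $\alpha$-geodesic on a nondegenerate interval $J$ is a smooth curve $\mu:J\to\operatorname{Prob}(M)$ with $\overline\nabla^{(\alpha)}_{\dot\mu}\dot\mu=0$. For $\alpha\ne1$ let $$\Phi_\alpha(\mu)=\tfrac{2}{|1-\alpha|}\big(\tfrac\mu\lambda\big)^{\frac{1-\alpha}2},\qquad S_\alpha=\Big\{f\in C^\infty(M): f>0,\ \int_M f^{\frac{2}{1-\alpha}}\lambda=\big(\tfrac{2}{|1-\alpha|}\big)^{\frac2{1-\alpha}}\Big\},$$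 $$T_fS_\alpha=\Big\{\xi\in C^\infty(M):\int_M f^{\frac{1+\alpha}{1-\alpha}}\xi\,\lambda=0\Big\},\qquad \pi^\alpha_f(\xi)=\xi-\big(\tfrac{|1-\alpha|}{2}\big)^{\frac{2}{1-\alpha}}\Big(\int_M f^{\frac{1+\alpha}{1-\alpha}}\xi\,\lambda\Big)f .$$ A geodesic of $\tilde\nabla^\alpha$ is a smooth curve $\gamma$ in $S_\alpha$ with $\pi^\alpha_\gamma(\ddot\gamma)=0$. For $f\in S_\alpha$ and $\xi\in C^\infty(M)$ consider the projected straight line $$\gamma_{f,\xi}(s)=\frac{2}{|1-\alpha|}\,\frac{f+s\xi}{\big(\int_M (f+s\xi)^{\frac2{1-\alpha}}\lambda\big)^{\frac{1-\alpha}2}}$$ and, on an interval $J\ni0$ for functions $\tau$ with $f+\tau(t)\xi>0$ on $M$ for all $t\in J$, the equation $$(\ast)\quad \ddot\tau=2\,\frac{\int_M (f+\tau\xi)^{\frac{1+\alpha}{1-\alpha}}\xi\,\lambda}{\int_M (f+\tau\xi)^{\frac{2}{1-\alpha}}\lambda}\,\dot\tau^2,\qquad \tau(0)=0,\quad \dot\tau(0)=1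 .$$ Then the following hold. (1) Let $\alpha\neq1$. The map $\Phi_\alpha:\operatorname{Prob}(M)\to S_\alpha$ is a bijection with inverse $f\mapsto\big(\tfrac{|1-\alpha|}2f\big)^{\frac2{1-\alpha}}\lambda$, and a curve $\mu$ in $\operatorname{Prob}(M)$ is an $\alpha$-geodesic if and only if $\Phi_\alpha\circ\mu$ is a geodesic of $\tilde\nabla^\alpha$. If $\tau$ solves $(\ast)$ on $J$ for some $f\in S_\alpha$, $\xi\in C^\infty(M)$, then $t\mapsto\Phi_\alpha^{-1}(\gamma_{f,\xi}(\tau(t)))$ is an $\alpha$-geodesic on $J$. Conversely, if $\mu$ is an $\alpha$-geodesic on $J\ni0$, then with $f=\Phi_\alpha(\mu(0))$ and $\xi=\frac{d}{dt}\big|_{0}\Phi_\alpha(\mu(t))\in T_fS_\alpha$ there is a solution $\tau$ of $(\ast)$ on $J$ with $\mu(t)=\Phi_\alpha^{-1}(\gamma_{f,\xi}(\tau(t)))$ for all $t\in J$. For all $\mu_0,\mu_1\in\operatorname{Prob}(M)$, with $f=\Phi_\alpha(\mu_0)$ and $\xi=\Phi_\alpha(\mu_1)-f$, there are $T>0$ and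 a solution $\tau$ of $(\ast)$ on $[0,T]$ with $\tau(T)=1$, and $t\mapsto\Phi_\alpha^{-1}(\gamma_{f,\xi}(\tau(Tt)))$, $t\in[0,1]$, is an $\alpha$-geodesic from $\mu_0$ to $\mu_1$. (2) Let $\alpha=1$. The map $\tilde\Phi_1(\mu)=\log\frac\mu\lambda-\int_M\log\big(\frac\mu\lambda\big)\lambda$ is a bijection of $\operatorname{Prob}(M)$ onto the smooth functions $h$ with $\int_M h\lambda=0$, and a curve $\mu$ in $\operatorname{Prob}(M)$ is a $1$-geodesic if and only if $\tilde\Phi_1(\mu(t))=g+th$ for some such functions $g,h$. (3) For every $\alpha\in\mathbb R$, every $\mu_0\in\operatorname{Prob}(M)$ and every $a\in T_{\mu_0}\operatorname{Prob}(M)$, there is an $\alpha$-geodesic $\mu$ on some interval $(-\varepsilon,\varepsilon)$ with $\mu(0)=\mu_0$, $\dot\mu(0)=a$, and any two $\alpha$-geodesics with these initial data on the same interval $J\ni0$ coincide. (4) For every $\alpha\in\mathbb R$, $\operatorname{Prob}(M)$ is uniquely geodesically convex: for all $\mu_0,\mu_1\in\operatorname{Prob}(M)$ there is exactly one $\alpha$-geodesic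 $\mu:[0,1]\to\operatorname{Prob}(M)$ with $\mu(0)=\mu_0$ and $\mu(1)=\mu_1$. -/

import Mathlib

open Set MeasureTheory
open scoped Manifold ContDiff

noncomputable section

/-- An orientation of the smooth `n`-manifold `M`, given as an oriented atlas: a family of charts of
the smooth structure that covers `M` and whose transition maps have positive Jacobian determinant. -/
structure OrientedAtlas (n : ℕ) (M : Type*) [TopologicalSpace M]
    [ChartedSpace (EuclideanSpace ℝ (Fin n)) M] [IsManifold (𝓡 n) ∞ M] where
  charts : Set (OpenPartialHomeomorph M (EuclideanSpace ℝ (Fin n)))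
  subset_maximalAtlas : charts ⊆ IsManifold.maximalAtlas (𝓡 n) ∞ M
  covers : ∀ x : M, ∃ e ∈ charts, x ∈ e.source
  det_pos : ∀ e ∈ charts, ∀ e' ∈ charts, ∀ y ∈ (e.symm.trans e').source,
    0 < (fderiv ℝ (e' ∘ e.symm) y).det

/-- Fields of `n`-forms on an `n`-manifold `M` (no regularity required). -/
abbrev TopForm (n : ℕ) (M : Type*) [TopologicalSpace M]
    [ChartedSpace (EuclideanSpace ℝ (Fin n)) M] : Type _ :=
  ∀ x : M, (TangentSpace (𝓡 n) x) [⋀^Fin n]→L[ℝ] ℝ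

namespace TopForm

variable {n : ℕ} {M : Type*} [TopologicalSpace M] [ChartedSpace (EuclideanSpace ℝ (Fin n)) M]

/-- The coefficient `c` of `w = c dy₁ ∧ ⋯ ∧ dyₙ` in the chart `e`: the value of `w` on the
coordinate frame of `e`, as a function of the coordinates `y`. -/
def coeff (e : OpenPartialHomeomorph M (EuclideanSpace ℝ (Fin n))) (w : TopForm n M)
    (y : EuclideanSpace ℝ (Fin n)) : ℝ :=
  w (e.symm y) fun i =>
    mfderiv 𝓘(ℝ, EuclideanSpace ℝ (Fin n)) (𝓡 n) e.symm y
      (EuclideanSpace.single i (1 : ℝ) : EuclideanSpace ℝ (Fin n))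

/-- The product `g w` of a function and an `n`-form. -/
def mulFn (g : M → ℝ) (w : TopForm n M) : TopForm n M := fun x => g x • w x

/-- The Radon--Nikodym derivative `a / μ` of two `n`-forms: the ratio of their values on a basis of
the tangent space. Top forms on a tangent space are unique up to a factor, so the choice of the basis
is irrelevant. -/
def rn (a μ : TopForm n M) (x : M) : ℝ :=
  a x (fun i => (EuclideanSpace.single i (1 : ℝ) : EuclideanSpace ℝ (Fin n))) /
    μ x (fun i => (EuclideanSpace.single i (1 : ℝ) : EuclideanSpace ℝ (Fin n)))

/-- The time derivative at `t` of a curve of forms defined on the interval `J`. -/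
def velocity (μ : ℝ → TopForm n M) (J : Set ℝ) (t : ℝ) : TopForm n M :=
  fun x => derivWithin (fun s => μ s x) J t

variable [IsManifold (𝓡 n) ∞ M]

/-- Smoothness of an `n`-form: its coefficients in all charts of the smooth structure are smooth. -/
def IsSmooth (w : TopForm n M) : Prop :=
  ∀ e ∈ IsManifold.maximalAtlas (𝓡 n) ∞ M, ContDiffOn ℝ ∞ (coeff e w) e.target

/-- Smooth curves `J → Ω^n(M)`: the coefficients in all charts are jointly smooth in time and space
(for compact `M` these are the smooth curves in the Fréchet space `Ω^n(M)`). -/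
def IsSmoothCurve (J : Set ℝ) (μ : ℝ → TopForm n M) : Prop :=
  ∀ e ∈ IsManifold.maximalAtlas (𝓡 n) ∞ M,
    ContDiffOn ℝ ∞ (fun q : ℝ × EuclideanSpace ℝ (Fin n) => coeff e (μ q.1) q.2) (J ×ˢ e.target)

end TopForm

/-- Smooth curves `J → C^∞(M)`: functions that are jointly smooth in time and space (for compact `M`
these are the smooth curves in the Fréchet space `C^∞(M)`). -/
def IsSmoothFnCurve {n : ℕ} {M : Type*} [TopologicalSpace M]
    [ChartedSpace (EuclideanSpace ℝ (Fin n)) M] (J : Set ℝ) (γ : ℝ → M → ℝ) : Prop :=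
  ContMDiffOn (𝓘(ℝ, ℝ).prod (𝓡 n)) 𝓘(ℝ, ℝ) ∞ (fun q : ℝ × M => γ q.1 q.2) (J ×ˢ univ)

/-- The time derivative at `t` of a curve of functions defined on the interval `J`. -/
def fnVelocity {M : Type*} (γ : ℝ → M → ℝ) (J : Set ℝ) (t : ℝ) : M → ℝ :=
  fun x => derivWithin (fun s => γ s x) J t

namespace OrientedAtlas

variable {n : ℕ} {M : Type*} [TopologicalSpace M] [ChartedSpace (EuclideanSpace ℝ (Fin n)) M]
  [IsManifold (𝓡 n) ∞ M]

/-- A chart of the oriented atlas around the given point. -/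
def chart (O : OrientedAtlas n M) (x : M) : OpenPartialHomeomorph M (EuclideanSpace ℝ (Fin n)) :=
  (O.covers x).choose

theorem mem_chart_source (O : OrientedAtlas n M) (x : M) : x ∈ (O.chart x).source :=
  (O.covers x).choose_spec.2

theorem exists_partition [T2Space M] [CompactSpace M] (O : OrientedAtlas n M) :
    ∃ ρ : SmoothPartitionOfUnity M (𝓡 n) M univ, ρ.IsSubordinate fun x => (O.chart x).source :=
  SmoothPartitionOfUnity.exists_isSubordinate (𝓡 n) isClosed_univ
    (fun x => (O.chart x).source) (fun x => (O.chart x).open_source)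
    (fun x _ => mem_iUnion_of_mem x (O.mem_chart_source x))

/-- A smooth partition of unity subordinate to charts of the oriented atlas. -/
def partition [T2Space M] [CompactSpace M] (O : OrientedAtlas n M) :
    SmoothPartitionOfUnity M (𝓡 n) M univ :=
  O.exists_partition.choose

/-- The integral `∫_M w` of an `n`-form over the compact oriented manifold `M`, through a partition
of unity subordinate to oriented charts (the value does not depend on its choice). -/
def integral [T2Space M] [CompactSpace M] (O : OrientedAtlas n M) (w : TopForm n M) : ℝ :=
  ∑ᶠ x : M, ∫ y in (O.chart x).target,
    O.partition x ((O.chart x).symm y) * TopForm.coeff (O.chart x) w y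

variable [T2Space M] [CompactSpace M]

/-- `Dens₊(M)`: the smooth positive `n`-forms. -/
def dens (O : OrientedAtlas n M) : Set (TopForm n M) :=
  {μ | TopForm.IsSmooth μ ∧ ∀ e ∈ O.charts, ∀ y ∈ e.target, 0 < TopForm.coeff e μ y}

/-- `Prob(M)`: the smooth positive `n`-forms of total integral one. -/
def prob (O : OrientedAtlas n M) : Set (TopForm n M) :=
  {μ | μ ∈ O.dens ∧ O.integral μ = 1}

/-- The tangent space of `Prob(M)` (at any point): smooth `n`-forms of integral zero. -/
def tangentProb (O : OrientedAtlas n M) : Set (TopForm n M) :=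
  {a | TopForm.IsSmooth a ∧ O.integral a = 0}

/-- The `α`-connection on `Prob(M)`: the value of `∇_a b` at `μ`, where `Dba` is the directional
derivative `Db.a` of `b` at `μ` in the direction `a`:
`∇_a b = Db.a - (1 + α)/2 ((a/μ) b - (∫ (a/μ) (b/μ) μ) μ)`. -/
def alphaConnection (O : OrientedAtlas n M) (α : ℝ) (μ a b Dba : TopForm n M) : TopForm n M :=
  Dba - ((1 + α) / 2) •
    (TopForm.mulFn (TopForm.rn a μ) b
      - O.integral (TopForm.mulFn (fun x => TopForm.rn a μ x * TopForm.rn b μ x) μ) • μ)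

/-- `μ : J → Prob(M)` is a geodesic of the `α`-connection: a smooth curve in `Prob(M)` whose velocity
is parallel along it, `∇_{μ'} μ' = 0`. -/
def IsAlphaGeodesic (O : OrientedAtlas n M) (α : ℝ) (J : Set ℝ) (μ : ℝ → TopForm n M) : Prop :=
  TopForm.IsSmoothCurve J μ ∧ (∀ t ∈ J, μ t ∈ O.prob) ∧
    ∀ t ∈ J, O.alphaConnection α (μ t) (TopForm.velocity μ J t) (TopForm.velocity μ J t)
      (TopForm.velocity (TopForm.velocity μ J) J t) = 0

/-- `μ : [0,1] → Prob(M)` is an `α`-geodesic from `μ₀` to `μ₁`. -/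
def IsAlphaGeodesicFromTo (O : OrientedAtlas n M) (α : ℝ) (μ₀ μ₁ : TopForm n M)
    (μ : ℝ → TopForm n M) : Prop :=
  O.IsAlphaGeodesic α (Icc 0 1) μ ∧ μ 0 = μ₀ ∧ μ 1 = μ₁

/-- `∫_M g λ`, for a function `g` and a fixed form `λ`. -/
def integralFn (O : OrientedAtlas n M) (lam : TopForm n M) (g : M → ℝ) : ℝ :=
  O.integral (TopForm.mulFn g lam)

/-- `Φ_α(μ) = 2/|1-α| (μ/λ)^((1-α)/2)`, for `α ≠ 1`. -/
def Phi (lam : TopForm n M) (α : ℝ) (μ : TopForm n M) : M → ℝ :=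
  fun x => 2 / |1 - α| * (TopForm.rn μ lam x) ^ ((1 - α) / 2)

/-- `f ↦ (|1-α|/2 f)^(2/(1-α)) λ`, for `α ≠ 1`. -/
def PhiInv (lam : TopForm n M) (α : ℝ) (f : M → ℝ) : TopForm n M :=
  TopForm.mulFn (fun x => (|1 - α| / 2 * f x) ^ (2 / (1 - α))) lam

/-- The hypersurface `S_α` of positive smooth functions `f` with
`∫ f^(2/(1-α)) λ = (2/|1-α|)^(2/(1-α))`, for `α ≠ 1`. -/
def sphere (O : OrientedAtlas n M) (lam : TopForm n M) (α : ℝ) : Set (M → ℝ) :=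
  {f | ContMDiff (𝓡 n) 𝓘(ℝ, ℝ) ∞ f ∧ (∀ x, 0 < f x) ∧
    O.integralFn lam (fun x => f x ^ (2 / (1 - α))) = (2 / |1 - α|) ^ (2 / (1 - α))}

/-- The tangent space `T_f S_α`. -/
def sphereTangent (O : OrientedAtlas n M) (lam : TopForm n M) (α : ℝ) (f : M → ℝ) :
    Set (M → ℝ) :=
  {ξ | ContMDiff (𝓡 n) 𝓘(ℝ, ℝ) ∞ ξ ∧
    O.integralFn lam (fun x => f x ^ ((1 + α) / (1 - α)) * ξ x) = 0}

/-- The radial projection `π^α_f : C^∞(M) → T_f S_α` along `span {f}`. -/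
def radialProj (O : OrientedAtlas n M) (lam : TopForm n M) (α : ℝ) (f ξ : M → ℝ) : M → ℝ :=
  ξ - ((|1 - α| / 2) ^ (2 / (1 - α)) *
    O.integralFn lam (fun x => f x ^ ((1 + α) / (1 - α)) * ξ x)) • f

/-- `γ : J → S_α` is a geodesic of the connection `π^α ∘ ∇` on `S_α`, where `∇` is the trivial
connection on `C^∞(M)`: a smooth curve in `S_α` with `π^α_γ (γ'') = 0`. -/
def IsSphereGeodesic (O : OrientedAtlas n M) (lam : TopForm n M) (α : ℝ) (J : Set ℝ)
    (γ : ℝ → M → ℝ) : Prop :=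
  IsSmoothFnCurve (n := n) J γ ∧ (∀ t ∈ J, γ t ∈ O.sphere lam α) ∧
    ∀ t ∈ J, O.radialProj lam α (γ t) (fnVelocity (fnVelocity γ J) J t) = 0

/-- The point `2/|1-α| (f + sξ) / (∫ (f + sξ)^(2/(1-α)) λ)^((1-α)/2)` of `S_α`: the radial projection
to `S_α` of the point with parameter `s` on the straight line through `f` with direction `ξ`. -/
def projLine (O : OrientedAtlas n M) (lam : TopForm n M) (α : ℝ) (f ξ : M → ℝ) (s : ℝ) : M → ℝ :=
  fun x => 2 / |1 - α| * ((f x + s * ξ x) /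
    (O.integralFn lam (fun z => (f z + s * ξ z) ^ (2 / (1 - α)))) ^ ((1 - α) / 2))

/-- `τ : J → ℝ` solves
`τ'' = 2 (∫ (f + τξ)^((1+α)/(1-α)) ξ λ) / (∫ (f + τξ)^(2/(1-α)) λ) (τ')²`, `τ(0) = 0`, `τ'(0) = 1`,
and the line `f + τξ` stays in the domain of the equation, the positive functions. -/
def SolvesTimeChange (O : OrientedAtlas n M) (lam : TopForm n M) (α : ℝ) (f ξ : M → ℝ) (J : Set ℝ)
    (τ : ℝ → ℝ) : Prop :=
  (∀ t ∈ J, ∀ x, 0 < f x + τ t * ξ x) ∧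
  DifferentiableOn ℝ τ J ∧
  (∀ t ∈ J, HasDerivWithinAt (derivWithin τ J)
    (2 * (O.integralFn lam (fun x => (f x + τ t * ξ x) ^ ((1 + α) / (1 - α)) * ξ x) /
      O.integralFn lam (fun x => (f x + τ t * ξ x) ^ (2 / (1 - α)))) * derivWithin τ J t ^ 2) J t) ∧
  τ 0 = 0 ∧ derivWithin τ J 0 = 1

/-- `log (μ/λ) - ∫ log (μ/λ) λ`, the replacement of `Φ_α` for `α = 1`. -/
def PhiOne (O : OrientedAtlas n M) (lam : TopForm n M) (μ : TopForm n M) : M → ℝ :=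
  fun x => Real.log (TopForm.rn μ lam x) - O.integralFn lam (fun z => Real.log (TopForm.rn μ lam z))

/-- The smooth functions of zero average. -/
def zeroMean (O : OrientedAtlas n M) (lam : TopForm n M) : Set (M → ℝ) :=
  {h | ContMDiff (𝓡 n) 𝓘(ℝ, ℝ) ∞ h ∧ O.integralFn lam h = 0}

end OrientedAtlas

end

/-!
Dividing by the fixed form `lam` turns `n`-forms into functions, and integration against `lam` turns
`O.integral` into integration against a Borel probability measure `m` on the compact space `M`
(`exists_probabilityMeasure`). A curve of probability forms with densities `u` is an `α`-geodesic
exactly if `u'' = (1 + α) / 2 * u' ^ 2 / u + φ(t) * u` for some function `φ` of time alone: as the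
mass of `u` is constant, integrating this equation forces the value of `φ` prescribed by the
connection (`isAlphaGeodesic_mulFn_iff`).

For `α ≠ 1` put `p = 2 / (1 - α)`. The substitution `γ = |p| * u ^ (1 / p)` turns the equation into
`γ'' = φ(t) γ`, the equation of curves with central acceleration on the hypersurface
`∫ γ ^ p = |p| ^ p` (`isDensityGeodesic_iff`, `isSphereGeodesic_iff`). Such curves are projected
straight lines. If `f` and `ξ` are the initial position and velocity, the pairing
`ρ(t) = ∫ f ^ (p - 1) γ(t) / |p| ^ p` is positive and satisfies `ρ'' = φ ρ`, `ρ(0) = 1`, `ρ'(0) = 0`.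
Wronskians of solutions are constant, so that `(γ / ρ)' = ξ / ρ ^ 2` and `γ = ρ (f + τ ξ)` with
`τ' = ρ ^ (-2)` (`IsCentralGeodesic.exists_line`). The normalization of `γ` expresses `ρ` through
`N(s) = ∫ (f + s ξ) ^ p`, and `τ` solves the autonomous first order equation
`τ' = |p| ^ (-2) * N(τ) ^ (2 / p)`, a first integral of the second order equation of the time change
(`solvesTimeChange_iff`). Conversely, for each solution of an equation `τ' = C * N(τ) ^ (2 / p)` the
quantity `ρ ^ 2 τ'` is constant, and this is what makes the acceleration of `ρ (f + τ ξ)` central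
(`isCentralGeodesic_line`).

Equations `τ' = H(τ)` with `H > 0` are solved and compared by means of the travel time
`P(s) = ∫ 1 / H` from `0` to `s`, a strictly increasing function with `P(τ(t)) = t`. Its inverse
solves the equation and sweeps out all parameters `s` with `f + s ξ > 0`, so that a segment between
two points is traversed in finite time (`exists_timeChange_segment`); its injectivity gives the
uniqueness statements (`IsCentralGeodesic.eqOn_of_initial`, `IsCentralGeodesic.eqOn_of_boundary`).

For `α = 1` the logarithm of `u` has an acceleration depending on time alone, so that it is affine
in time after subtraction of its mean (`IsDensityGeodesic.exists_affine`), and the density is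
recovered from an affine curve by normalizing its exponential (`expDensity`).
-/

/-! ### Forms and densities -/

namespace TopForm

variable {n : ℕ} {M : Type*} [TopologicalSpace M] [ChartedSpace (EuclideanSpace ℝ (Fin n)) M]

/-- The standard basis of the model space, seen as a basis of the tangent space at `x`. -/
noncomputable def stdBasis (x : M) : Module.Basis (Fin n) ℝ (TangentSpace (𝓡 n) x) :=
  (EuclideanSpace.basisFun (Fin n) ℝ).toBasis

theorem stdBasis_eq (x : M) : (⇑(stdBasis (n := n) x) : Fin n → TangentSpace (𝓡 n) x) =
    fun i => (EuclideanSpace.single i (1 : ℝ) : EuclideanSpace ℝ (Fin n)) := by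
  funext i
  exact (EuclideanSpace.basisFun_apply (Fin n) ℝ i)

theorem rn_eq (a μ : TopForm n M) (x : M) :
    rn a μ x = a x (stdBasis x) / μ x (stdBasis x) := by
  rw [stdBasis_eq]; rfl

theorem coeff_mulFn (e : OpenPartialHomeomorph M (EuclideanSpace ℝ (Fin n))) (g : M → ℝ)
    (w : TopForm n M) (y : EuclideanSpace ℝ (Fin n)) :
    coeff e (mulFn g w) y = g (e.symm y) * coeff e w y := rfl

theorem apply_basis_ne_zero {x : M} {w : (TangentSpace (𝓡 n) x) [⋀^Fin n]→L[ℝ] ℝ} (hw : w ≠ 0)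
    (b : Module.Basis (Fin n) ℝ (TangentSpace (𝓡 n) x)) : w b ≠ 0 := by
  have : w.toAlternatingMap ≠ 0 := fun h => hw (by
    ext v
    exact congrArg (fun f => f v) h)
  exact (AlternatingMap.map_basis_ne_zero_iff b w.toAlternatingMap).2 this

theorem mulFn_rn {lam : TopForm n M} (h : ∀ x, lam x ≠ 0) (w : TopForm n M) :
    mulFn (rn w lam) lam = w := by
  funext x
  have hl := apply_basis_ne_zero (h x) (stdBasis x)
  have e1 := AlternatingMap.eq_smul_basis_det (stdBasis (n := n) x) (w x).toAlternatingMap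
  have e2 := AlternatingMap.eq_smul_basis_det (stdBasis (n := n) x) (lam x).toAlternatingMap
  ext v
  have f1 := congrArg (fun f => f v) e1
  have f2 := congrArg (fun f => f v) e2
  simp only [AlternatingMap.smul_apply, smul_eq_mul,
    ContinuousAlternatingMap.coe_toAlternatingMap] at f1 f2
  change rn w lam x * lam x v = w x v
  rw [f1, f2, rn_eq]
  field_simp

theorem rn_mulFn {lam : TopForm n M} (h : ∀ x, lam x ≠ 0) (g : M → ℝ) :
    rn (mulFn g lam) lam = g := by
  funext x
  have hl := apply_basis_ne_zero (h x) (stdBasis x)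
  rw [rn_eq]
  change g x * (lam x) (stdBasis x) / _ = _
  field_simp

theorem rn_mulFn_mulFn {lam : TopForm n M} (h : ∀ x, lam x ≠ 0) (g k : M → ℝ) (x : M) :
    rn (mulFn g lam) (mulFn k lam) x = g x / k x := by
  have hl := apply_basis_ne_zero (h x) (stdBasis x)
  rw [rn_eq]
  change g x * (lam x) (stdBasis x) / (k x * (lam x) (stdBasis x)) = _
  rw [mul_div_mul_right _ _ hl]

theorem mulFn_injective {lam : TopForm n M} (h : ∀ x, lam x ≠ 0) :
    Function.Injective fun g : M → ℝ => mulFn g lam := fun g k hgk => by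
  rw [← rn_mulFn h g, ← rn_mulFn h k]
  exact congrArg (fun w => rn w lam) hgk

theorem coeff_ne_zero {lam : TopForm n M} (h : ∀ x, lam x ≠ 0)
    {e : OpenPartialHomeomorph M (EuclideanSpace ℝ (Fin n))}
    (he : e ∈ IsManifold.maximalAtlas (𝓡 n) ∞ M) {y : EuclideanSpace ℝ (Fin n)}
    (hy : y ∈ e.target) : coeff e lam y ≠ 0 := by
  have hm : e.MDifferentiable (𝓡 n) (𝓡 n) :=
    ⟨(contMDiffOn_of_mem_maximalAtlas he).mdifferentiableOn (by simp),
     (contMDiffOn_symm_of_mem_maximalAtlas he).mdifferentiableOn (by simp)⟩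
  have hb := hm.symm.mfderiv_bijective (x := y) hy
  let L := LinearEquiv.ofBijective
    (mfderiv 𝓘(ℝ, EuclideanSpace ℝ (Fin n)) (𝓡 n) e.symm y).toLinearMap hb
  have hne := apply_basis_ne_zero (h (e.symm y))
    ((EuclideanSpace.basisFun (Fin n) ℝ).toBasis.map L)
  convert hne using 1
  refine congrArg (lam (e.symm y)) ?_
  funext i
  change _ = L _
  erw [EuclideanSpace.basisFun_apply (Fin n) ℝ i]
  rfl

end TopForm

section Curves

variable {n : ℕ} {M : Type*} [TopologicalSpace M] [ChartedSpace (EuclideanSpace ℝ (Fin n)) M]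

/-- Joint smoothness of a curve of functions, expressed in the charts of the smooth structure. -/
theorem isSmoothFnCurve_iff_charts [IsManifold (𝓡 n) ∞ M] {J : Set ℝ} {γ : ℝ → M → ℝ} :
    IsSmoothFnCurve (n := n) J γ ↔ ∀ e ∈ IsManifold.maximalAtlas (𝓡 n) ∞ M,
      ContDiffOn ℝ ∞ (fun q : ℝ × EuclideanSpace ℝ (Fin n) => γ q.1 (e.symm q.2))
        (J ×ˢ e.target) := by
  constructor
  · intro h e he
    rw [← contMDiffOn_iff_contDiffOn, modelWithCornersSelf_prod, ← chartedSpaceSelf_prod]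
    have h2 : ContMDiffOn (𝓘(ℝ, ℝ).prod (𝓡 n)) (𝓘(ℝ, ℝ).prod (𝓡 n)) ∞
        (fun q : ℝ × EuclideanSpace ℝ (Fin n) => ((q.1, e.symm q.2) : ℝ × M))
        (J ×ˢ e.target) :=
      contMDiffOn_fst.prodMk ((contMDiffOn_symm_of_mem_maximalAtlas he).comp contMDiffOn_snd
        (fun q hq => hq.2))
    exact ContMDiffOn.comp h h2 (fun q hq => ⟨hq.1, mem_univ _⟩)
  · rintro h ⟨t, x⟩ ⟨ht, -⟩
    have he : chartAt (EuclideanSpace ℝ (Fin n)) x ∈ IsManifold.maximalAtlas (𝓡 n) ∞ M :=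
      IsManifold.chart_mem_maximalAtlas x
    set e := chartAt (EuclideanSpace ℝ (Fin n)) x with hedef
    have hx : x ∈ e.source := mem_chart_source _ x
    have h1 : ContMDiffOn (𝓘(ℝ, ℝ).prod (𝓡 n)) 𝓘(ℝ, ℝ) ∞
        (fun q : ℝ × EuclideanSpace ℝ (Fin n) => γ q.1 (e.symm q.2)) (J ×ˢ e.target) := by
      have h0 := h e he
      rw [← contMDiffOn_iff_contDiffOn, modelWithCornersSelf_prod, ← chartedSpaceSelf_prod] at h0
      exact h0
    have h2 : ContMDiffOn (𝓘(ℝ, ℝ).prod (𝓡 n)) (𝓘(ℝ, ℝ).prod (𝓡 n)) ∞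
        (fun q : ℝ × M => ((q.1, e q.2) : ℝ × EuclideanSpace ℝ (Fin n)))
        (J ×ˢ e.source) :=
      contMDiffOn_fst.prodMk ((contMDiffOn_of_mem_maximalAtlas he).comp contMDiffOn_snd
        (fun q hq => hq.2))
    have h3 := ContMDiffOn.comp h1 h2 (fun q hq => ⟨hq.1, e.map_source hq.2⟩)
    have h4 : ContMDiffOn (𝓘(ℝ, ℝ).prod (𝓡 n)) 𝓘(ℝ, ℝ) ∞ (fun q : ℝ × M => γ q.1 q.2)
        (J ×ˢ e.source) := h3.congr fun q hq => by
      simp [e.left_inv hq.2]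
    refine (h4 (t, x) ⟨ht, hx⟩).mono_of_mem_nhdsWithin ?_
    rw [nhdsWithin_prod_eq]
    exact Filter.prod_mem_prod self_mem_nhdsWithin
      (mem_nhdsWithin_of_mem_nhds (e.open_source.mem_nhds hx))

theorem isSmoothFnCurve_const {J : Set ℝ} {g : M → ℝ} (hg : ContMDiff (𝓡 n) 𝓘(ℝ, ℝ) ∞ g) :
    IsSmoothFnCurve (n := n) J (fun _ => g) :=
  (hg.comp contMDiff_snd).contMDiffOn

theorem IsSmoothFnCurve.contMDiff {J : Set ℝ} {γ : ℝ → M → ℝ} (h : IsSmoothFnCurve (n := n) J γ)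
    {t : ℝ} (ht : t ∈ J) : ContMDiff (𝓡 n) 𝓘(ℝ, ℝ) ∞ (γ t) :=
  ContMDiffOn.comp_contMDiff (f := fun x : M => (t, x)) h (contMDiff_const.prodMk contMDiff_id)
    (fun _ => ⟨ht, mem_univ _⟩)

theorem IsSmoothFnCurve.congr {J : Set ℝ} {γ η : ℝ → M → ℝ} (h : IsSmoothFnCurve (n := n) J γ)
    (h' : ∀ t ∈ J, ∀ x, η t x = γ t x) : IsSmoothFnCurve (n := n) J η :=
  ContMDiffOn.congr h fun q hq => h' q.1 hq.1 q.2

namespace TopForm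

theorem isSmoothCurve_mulFn_iff [IsManifold (𝓡 n) ∞ M] {lam : TopForm n M} (h : ∀ x, lam x ≠ 0) (hs : IsSmooth lam)
    {J : Set ℝ} {u : ℝ → M → ℝ} :
    IsSmoothCurve J (fun t => mulFn (u t) lam) ↔ IsSmoothFnCurve (n := n) J u := by
  rw [isSmoothFnCurve_iff_charts]
  refine forall₂_congr fun e he => ?_
  have hl : ContDiffOn ℝ ∞ (fun q : ℝ × EuclideanSpace ℝ (Fin n) => coeff e lam q.2)
      (J ×ˢ e.target) := (hs e he).comp contDiffOn_snd (fun q hq => hq.2)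
  simp only [coeff_mulFn]
  constructor
  · intro h1
    refine (h1.div hl fun q hq => coeff_ne_zero h he hq.2).congr fun q hq => ?_
    exact (mul_div_cancel_right₀ _ (coeff_ne_zero h he hq.2)).symm
  · intro h1
    exact h1.mul hl

theorem isSmoothCurve_const_iff {w : TopForm n M} :
    IsSmoothCurve univ (fun _ => w) ↔ IsSmooth w := by
  refine forall₂_congr fun e he => ?_
  constructor
  · intro h1
    exact h1.comp (f := fun y => ((0 : ℝ), y)) (contDiffOn_const.prodMk contDiffOn_id)
      (fun y hy => ⟨mem_univ _, hy⟩)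
  · intro h1
    exact h1.comp contDiffOn_snd (fun q hq => hq.2)

theorem isSmooth_mulFn_iff [IsManifold (𝓡 n) ∞ M] {lam : TopForm n M} (h : ∀ x, lam x ≠ 0) (hs : IsSmooth lam)
    {g : M → ℝ} : IsSmooth (mulFn g lam) ↔ ContMDiff (𝓡 n) 𝓘(ℝ, ℝ) ∞ g := by
  rw [← isSmoothCurve_const_iff, isSmoothCurve_mulFn_iff h hs (u := fun _ => g)]
  exact ⟨fun h1 => h1.contMDiff (mem_univ 0), fun h1 => isSmoothFnCurve_const h1⟩

end TopForm

end Curves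

/-! ### The measure of a positive form -/

namespace OrientedAtlas

variable {n : ℕ} {M : Type*} [TopologicalSpace M] [ChartedSpace (EuclideanSpace ℝ (Fin n)) M]
  [IsManifold (𝓡 n) ∞ M]

theorem chart_mem (O : OrientedAtlas n M) (x : M) : O.chart x ∈ O.charts :=
  (O.covers x).choose_spec.1

theorem ne_zero_of_mem_dens {O : OrientedAtlas n M} {lam : TopForm n M} (h : lam ∈ O.dens)
    (x : M) : lam x ≠ 0 := fun h0 => by
  have h1 := h.2 _ (O.chart_mem x) _ ((O.chart x).map_source (O.mem_chart_source x))
  rw [TopForm.coeff, (O.chart x).left_inv (O.mem_chart_source x), h0] at h1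
  simp at h1

theorem mulFn_mem_dens_iff {O : OrientedAtlas n M} {lam : TopForm n M} (h : lam ∈ O.dens)
    {g : M → ℝ} : TopForm.mulFn g lam ∈ O.dens ↔
      ContMDiff (𝓡 n) 𝓘(ℝ, ℝ) ∞ g ∧ ∀ x, 0 < g x := by
  refine and_congr (TopForm.isSmooth_mulFn_iff (ne_zero_of_mem_dens h) h.1) ?_
  simp only [TopForm.coeff_mulFn]
  constructor
  · intro h1 x
    have h2 := h1 _ (O.chart_mem x) _ ((O.chart x).map_source (O.mem_chart_source x))
    rw [(O.chart x).left_inv (O.mem_chart_source x)] at h2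
    exact (pos_iff_pos_of_mul_pos h2).2
      (h.2 _ (O.chart_mem x) _ ((O.chart x).map_source (O.mem_chart_source x)))
  · intro h1 e he y hy
    exact mul_pos (h1 _) (h.2 e he y hy)

variable [T2Space M] [CompactSpace M]

/-- Integration against a positive smooth form is integration against a finite Borel measure. -/
theorem exists_measure [MeasurableSpace M] [BorelSpace M] (O : OrientedAtlas n M)
    {lam : TopForm n M} (hl : lam ∈ O.dens) :
    ∃ m : Measure M, IsFiniteMeasure m ∧
      ∀ g : M → ℝ, Continuous g → O.integralFn lam g = ∫ x, g x ∂m := by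
  classical
  -- the density of `lam`, weighted by the partition of unity, in the chart at `x`
  let d : M → EuclideanSpace ℝ (Fin n) → ℝ := fun x y =>
    O.partition x ((O.chart x).symm y) * TopForm.coeff (O.chart x) lam y
  have hd0 : ∀ x, ∀ y ∈ (O.chart x).target, 0 ≤ d x y := fun x y hy =>
    mul_nonneg (O.partition.nonneg x _) (hl.2 _ (O.chart_mem x) _ hy).le
  have hdc : ∀ x, ContinuousOn (d x) (O.chart x).target := fun x =>
    ((O.partition x).contMDiff.continuous.comp_continuousOn
      (O.chart x).continuousOn_symm).mul
      (hl.1 _ (O.subset_maximalAtlas (O.chart_mem x))).continuousOn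
  have hdi : ∀ x, IntegrableOn (d x) (O.chart x).target := by
    intro x
    have hsub : tsupport (O.partition x) ⊆ (O.chart x).source := O.exists_partition.choose_spec x
    have hK : IsCompact ((O.chart x) '' tsupport (O.partition x)) :=
      (isClosed_tsupport _).isCompact.image_of_continuousOn
        ((O.chart x).continuousOn.mono hsub)
    have hKt : (O.chart x) '' tsupport (O.partition x) ⊆ (O.chart x).target := by
      rintro _ ⟨z, hz, rfl⟩
      exact (O.chart x).map_source (hsub hz)
    refine IntegrableOn.of_forall_sdiff_eq_zero
      (((hdc x).mono hKt).integrableOn_compact hK) (O.chart x).open_target.measurableSet ?_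
    rintro y ⟨hy, hyK⟩
    have : O.partition x ((O.chart x).symm y) = 0 := by
      by_contra hne
      exact hyK ⟨(O.chart x).symm y, subset_tsupport _ hne, (O.chart x).right_inv hy⟩
    simp [d, this]
  let ν : M → Measure (EuclideanSpace ℝ (Fin n)) := fun x =>
    (volume.restrict (O.chart x).target).withDensity fun y => ENNReal.ofReal (d x y)
  have hν : ∀ x, IsFiniteMeasure (ν x) := fun x =>
    isFiniteMeasure_withDensity_ofReal (hdi x).2
  have hsm : ∀ x, AEMeasurable (O.chart x).symm (ν x) := fun x =>
    ((O.chart x).continuousOn_symm.aemeasurable (O.chart x).open_target.measurableSet).mono_ac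
      (withDensity_absolutelyContinuous _ _)
  have hfin : {x | (O.partition x : M → ℝ) ≠ 0}.Finite := by
    refine O.partition.locallyFinite.finite_nonempty_of_compact.subset fun x hx => ?_
    exact Function.support_nonempty_iff.2 hx
  refine ⟨∑ x ∈ hfin.toFinset, (ν x).map (O.chart x).symm, ?_, ?_⟩
  · infer_instance
  · intro g hg
    have hgi : ∀ m : Measure M, IsFiniteMeasure m → Integrable g m := fun m hm => by
      exact hg.integrable_of_hasCompactSupport (HasCompactSupport.of_compactSpace g)
    rw [integral_finsetSum_measure (fun x _ => hgi _ inferInstance)]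
    rw [integralFn, integral, finsum_eq_sum_of_support_subset (s := hfin.toFinset)]
    · refine Finset.sum_congr rfl fun x _ => ?_
      rw [integral_map (hsm x) hg.aestronglyMeasurable,
        integral_withDensity_eq_integral_toReal_smul₀
          ((hdi x).1.aemeasurable.ennreal_ofReal) (by simp)]
      refine setIntegral_congr_fun (O.chart x).open_target.measurableSet fun y hy => ?_
      simp only [TopForm.coeff_mulFn, ENNReal.toReal_ofReal (hd0 x y hy), smul_eq_mul, d]
      ring
    · intro x hx
      simp only [Finite.coe_toFinset, mem_ofPred_eq]
      intro h0
      apply hx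
      simp [h0]

end OrientedAtlas

/-! ### Smooth curves of functions -/

theorem Set.OrdConnected.uniqueDiffOn {J : Set ℝ} (hJ : J.OrdConnected) (hn : J.Nontrivial) :
    UniqueDiffOn ℝ J := by
  obtain ⟨a, ha, b, hb, hab⟩ := hn.exists_lt
  refine uniqueDiffOn_convex hJ.convex ⟨(a + b) / 2, ?_⟩
  refine mem_interior_iff_mem_nhds.2 (Filter.mem_of_superset
    (Ioo_mem_nhds (a := a) (b := b) (by linarith) (by linarith))
    (Ioo_subset_Icc_self.trans (hJ.out ha hb)))

theorem ContDiffOn.derivWithin_fst {E : Type*} [NormedAddCommGroup E] [NormedSpace ℝ E]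
    {F : ℝ × E → ℝ} {J : Set ℝ} {s : Set E} (hJ : UniqueDiffOn ℝ J) (hs : IsOpen s)
    (hF : ContDiffOn ℝ ∞ F (J ×ˢ s)) :
    ContDiffOn ℝ ∞ (fun q : ℝ × E => derivWithin (fun t => F (t, q.2)) J q.1) (J ×ˢ s) := by
  have hu : UniqueDiffOn ℝ (J ×ˢ s) := hJ.prod hs.uniqueDiffOn
  have h1 : ContDiffOn ℝ ∞ (fun q => fderivWithin ℝ F (J ×ˢ s) q (1, 0)) (J ×ˢ s) :=
    (hF.fderivWithin hu (by simp)).clm_apply contDiffOn_const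
  refine h1.congr fun q hq => ?_
  have h2 := ((hF.differentiableOn (by simp)) q hq).hasFDerivWithinAt
  have h3 : HasDerivWithinAt (fun t : ℝ => (t, q.2)) ((1 : ℝ), (0 : E)) J q.1 :=
    (hasDerivWithinAt_id q.1 J).prodMk (hasDerivWithinAt_const q.1 J q.2)
  have h4 := h2.comp_hasDerivWithinAt (t := J ×ˢ s) (f := fun t : ℝ => (t, q.2)) q.1 h3
    (fun t ht => ⟨ht, hq.2⟩)
  exact h4.derivWithin (hJ q.1 hq.1)

section Curves

variable {n : ℕ} {M : Type*} [TopologicalSpace M] [ChartedSpace (EuclideanSpace ℝ (Fin n)) M]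
  {J : Set ℝ}

theorem IsSmoothFnCurve.contDiffOn_apply {γ : ℝ → M → ℝ} (h : IsSmoothFnCurve (n := n) J γ)
    (x : M) : ContDiffOn ℝ ∞ (fun t => γ t x) J := by
  rw [← contMDiffOn_iff_contDiffOn]
  exact ContMDiffOn.comp (g := fun q : ℝ × M => γ q.1 q.2) (f := fun t : ℝ => (t, x)) h
    (contMDiff_id.prodMk contMDiff_const).contMDiffOn (fun t ht => ⟨ht, mem_univ _⟩)

theorem IsSmoothFnCurve.hasDerivWithinAt {γ : ℝ → M → ℝ} (h : IsSmoothFnCurve (n := n) J γ)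
    {t : ℝ} (ht : t ∈ J) (x : M) :
    HasDerivWithinAt (fun s => γ s x) (fnVelocity γ J t x) J t :=
  ((h.contDiffOn_apply x).differentiableOn (by simp) t ht).hasDerivWithinAt

theorem IsSmoothFnCurve.fnVelocity [IsManifold (𝓡 n) ∞ M] (hJ : UniqueDiffOn ℝ J)
    {γ : ℝ → M → ℝ} (h : IsSmoothFnCurve (n := n) J γ) :
    IsSmoothFnCurve (n := n) J (fnVelocity γ J) := by
  rw [isSmoothFnCurve_iff_charts] at h ⊢
  intro e he
  exact (h e he).derivWithin_fst hJ e.open_target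

theorem IsSmoothFnCurve.continuousOn {γ : ℝ → M → ℝ} (h : IsSmoothFnCurve (n := n) J γ) :
    ContinuousOn (fun q : ℝ × M => γ q.1 q.2) (J ×ˢ univ) :=
  ContMDiffOn.continuousOn h

theorem IsSmoothFnCurve.continuous {γ : ℝ → M → ℝ} (h : IsSmoothFnCurve (n := n) J γ)
    {t : ℝ} (ht : t ∈ J) : Continuous (γ t) :=
  (h.contMDiff ht).continuous

theorem IsSmoothFnCurve.add {γ η : ℝ → M → ℝ} (h : IsSmoothFnCurve (n := n) J γ)
    (h' : IsSmoothFnCurve (n := n) J η) : IsSmoothFnCurve (n := n) J (fun t x => γ t x + η t x) :=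
  ContMDiffOn.add h h'

theorem IsSmoothFnCurve.mul {γ η : ℝ → M → ℝ} (h : IsSmoothFnCurve (n := n) J γ)
    (h' : IsSmoothFnCurve (n := n) J η) : IsSmoothFnCurve (n := n) J (fun t x => γ t x * η t x) :=
  ContMDiffOn.mul h h'

/-- A smooth function of time, as a curve of constant functions. -/
theorem isSmoothFnCurve_time {r : ℝ → ℝ} (hr : ContDiffOn ℝ ∞ r J) :
    IsSmoothFnCurve (n := n) J (fun t (_ : M) => r t) :=
  ContMDiffOn.comp (g := r) (t := J) (contMDiffOn_iff_contDiffOn.2 hr) contMDiffOn_fst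
    (fun _ hq => hq.1)

theorem IsSmoothFnCurve.comp {γ : ℝ → M → ℝ} (h : IsSmoothFnCurve (n := n) J γ) {φ : ℝ → ℝ}
    (hφ : ∀ t ∈ J, ∀ x, ContDiffAt ℝ ∞ φ (γ t x)) :
    IsSmoothFnCurve (n := n) J (fun t x => φ (γ t x)) :=
  fun q hq => ContDiffAt.comp_contMDiffWithinAt (f := fun q : ℝ × M => γ q.1 q.2) (x := q)
    (hφ q.1 hq.1 q.2) (h q hq)

theorem IsSmoothFnCurve.rpow_const {γ : ℝ → M → ℝ} (h : IsSmoothFnCurve (n := n) J γ)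
    (hpos : ∀ t ∈ J, ∀ x, 0 < γ t x) (p : ℝ) :
    IsSmoothFnCurve (n := n) J (fun t x => γ t x ^ p) :=
  h.comp (φ := fun r => r ^ p) fun t ht x => Real.contDiffAt_rpow_const_of_ne (hpos t ht x).ne'

theorem ContMDiff.rpow_const_of_pos {g : M → ℝ} (hg : ContMDiff (𝓡 n) 𝓘(ℝ, ℝ) ∞ g)
    (hpos : ∀ x, 0 < g x) (p : ℝ) : ContMDiff (𝓡 n) 𝓘(ℝ, ℝ) ∞ (fun x => g x ^ p) := fun x =>
  (Real.contDiffAt_rpow_const_of_ne (p := p) (hpos x).ne').comp_contMDiffAt (hg x)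

theorem fnVelocity_eq {M : Type*} {J : Set ℝ} (hJ : UniqueDiffOn ℝ J) {γ γ₁ : ℝ → M → ℝ}
    (h : ∀ t ∈ J, ∀ x, HasDerivWithinAt (fun s => γ s x) (γ₁ t x) J t) {t : ℝ} (ht : t ∈ J) :
    fnVelocity γ J t = γ₁ t := by
  funext x
  exact (h t ht x).derivWithin (hJ t ht)

theorem fnVelocity_fnVelocity_eq {M : Type*} {J : Set ℝ} (hJ : UniqueDiffOn ℝ J) {γ γ₁ γ₂ : ℝ → M → ℝ}
    (h : ∀ t ∈ J, ∀ x, HasDerivWithinAt (fun s => γ s x) (γ₁ t x) J t)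
    (h' : ∀ t ∈ J, ∀ x, HasDerivWithinAt (fun s => γ₁ s x) (γ₂ t x) J t) {t : ℝ} (ht : t ∈ J) :
    fnVelocity (fnVelocity γ J) J t = γ₂ t :=
  fnVelocity_eq hJ (fun s hs x => (h' s hs x).congr_of_mem
    (fun _ hr => congrFun (fnVelocity_eq hJ h hr) x) hs) ht

variable [CompactSpace M] [MeasurableSpace M] [BorelSpace M]

theorem Continuous.integrable_of_compactSpace {g : M → ℝ} (hg : Continuous g) (m : Measure M)
    [IsFiniteMeasure m] : Integrable g m :=
  hg.integrable_of_hasCompactSupport (HasCompactSupport.of_compactSpace g)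

/-- Differentiation under the integral sign, also at the endpoints of `J`. -/
theorem IsSmoothFnCurve.hasDerivWithinAt_integral [IsManifold (𝓡 n) ∞ M] (m : Measure M)
    [IsFiniteMeasure m]
    (hJ : J.OrdConnected) (hn : J.Nontrivial) {γ : ℝ → M → ℝ} (h : IsSmoothFnCurve (n := n) J γ)
    {t : ℝ} (ht : t ∈ J) :
    HasDerivWithinAt (fun s => ∫ x, γ s x ∂m) (∫ x, _root_.fnVelocity γ J t x ∂m) J t := by
  have hv := h.fnVelocity (hJ.uniqueDiffOn hn)
  obtain ⟨C, hC⟩ : ∃ C, ∀ x, |_root_.fnVelocity γ J t x| < C := by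
    obtain ⟨C, hC⟩ := isCompact_univ.exists_bound_of_continuousOn (hv.continuous ht).continuousOn
    exact ⟨C + 1, fun x => (hC x (mem_univ x)).trans_lt (lt_add_one C)⟩
  -- near `t` the velocity is bounded by `C`, uniformly on the compact space `M`
  have hev : ∀ᶠ s in nhds t, ∀ x ∈ (univ : Set M), s ∈ J → |_root_.fnVelocity γ J s x| < C := by
    refine isCompact_univ.eventually_forall_of_forall_eventually
      (P := fun s x => s ∈ J → |_root_.fnVelocity γ J s x| < C) fun x _ => ?_
    have h1 : ContinuousWithinAt (fun q : ℝ × M => |_root_.fnVelocity γ J q.1 q.2|)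
        (J ×ˢ univ) (t, x) := (hv.continuousOn (t, x) ⟨ht, mem_univ x⟩).abs
    have h2 := eventually_nhdsWithin_iff.1 (h1.eventually_lt_const (hC x))
    filter_upwards [h2] with q hq hqJ using hq ⟨hqJ, mem_univ _⟩
  obtain ⟨δ, hδ, hball⟩ := Metric.eventually_nhds_iff_ball.1 hev
  rw [hasDerivWithinAt_iff_tendsto_slope]
  have hint : ∀ s ∈ J, Integrable (γ s) m := fun s hs =>
    (h.continuous hs).integrable_of_compactSpace m
  have hconv : Convex ℝ (J ∩ Metric.ball t δ) := hJ.convex.inter (convex_ball t δ)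
  have key : Filter.Tendsto (fun s => ∫ x, slope (fun r => γ r x) t s ∂m)
      (nhdsWithin t (J \ {t})) (nhds (∫ x, _root_.fnVelocity γ J t x ∂m)) := by
    refine tendsto_integral_filter_of_dominated_convergence (fun _ => C) ?_ ?_
      (integrable_const C) ?_
    · filter_upwards [self_mem_nhdsWithin] with s hs
      simp only [slope_def_field]
      exact (((h.continuous hs.1).sub (h.continuous ht)).div_const _).aestronglyMeasurable
    · filter_upwards [self_mem_nhdsWithin,
        mem_nhdsWithin_of_mem_nhds (Metric.ball_mem_nhds t hδ)] with s hs hsb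
      refine Filter.Eventually.of_forall fun x => ?_
      have h1 := hconv.norm_image_sub_le_of_norm_hasDerivWithin_le
        (f := fun r => γ r x) (f' := fun r => _root_.fnVelocity γ J r x) (C := C)
        (fun r hr => (h.hasDerivWithinAt hr.1 x).mono inter_subset_left)
        (fun r hr => (hball r hr.2 x (mem_univ x) hr.1).le)
        ⟨ht, Metric.mem_ball_self hδ⟩ ⟨hs.1, hsb⟩
      rw [slope_def_field, norm_div]
      exact (div_le_iff₀ (norm_pos_iff.2 (sub_ne_zero.2 hs.2))).2 h1
    · refine Filter.Eventually.of_forall fun x => ?_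
      exact hasDerivWithinAt_iff_tendsto_slope.1 (h.hasDerivWithinAt ht x)
  refine key.congr' ?_
  filter_upwards [self_mem_nhdsWithin] with s hs
  simp only [slope_def_field]
  rw [integral_div, integral_sub (hint s hs.1) (hint t ht)]

theorem IsSmoothFnCurve.contDiffOn_integral [IsManifold (𝓡 n) ∞ M] (m : Measure M)
    [IsFiniteMeasure m] (hJ : J.OrdConnected) (hn : J.Nontrivial) {γ : ℝ → M → ℝ}
    (h : IsSmoothFnCurve (n := n) J γ) : ContDiffOn ℝ ∞ (fun s => ∫ x, γ s x ∂m) J := by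
  rw [contDiffOn_infty]
  intro k
  induction k generalizing γ with
  | zero =>
    exact contDiffOn_zero.2 fun t ht =>
      (h.hasDerivWithinAt_integral m hJ hn ht).continuousWithinAt
  | succ k ih =>
    have hu := hJ.uniqueDiffOn hn
    push_cast
    refine (contDiffOn_succ_iff_derivWithin hu).2 ⟨fun t ht =>
      (h.hasDerivWithinAt_integral m hJ hn ht).differentiableWithinAt,
        by simp, ?_⟩
    exact (ih (h.fnVelocity hu)).congr fun t ht =>
      (h.hasDerivWithinAt_integral m hJ hn ht).derivWithin (hu t ht)

end Curves

/-! ### Autonomous equations on intervals -/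

theorem Set.OrdConnected.eqOn_of_hasDerivWithinAt_eq {J : Set ℝ} (hJ : J.OrdConnected)
    {f g f' : ℝ → ℝ} (hf : ∀ t ∈ J, HasDerivWithinAt f (f' t) J t)
    (hg : ∀ t ∈ J, HasDerivWithinAt g (f' t) J t) {t₀ : ℝ} (h₀ : t₀ ∈ J) (h : f t₀ = g t₀) :
    EqOn f g J := by
  intro t ht
  have h1 := hJ.convex.norm_image_sub_le_of_norm_hasDerivWithin_le (f := fun s => f s - g s)
    (f' := fun _ => 0) (C := 0) (fun s hs => ((hf s hs).sub (hg s hs)).congr_deriv (sub_self _)) (by simp)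
    h₀ ht
  have h2 : f t - g t - (f t₀ - g t₀) = 0 := by simpa using h1
  linarith

/-- The time needed to reach the point `s` when moving with speed `H`: a strictly increasing
primitive of `1 / H`. -/
theorem exists_travelTime {I : Set ℝ} (hI : I.OrdConnected) (hIo : IsOpen I) (h0 : (0 : ℝ) ∈ I)
    {H : ℝ → ℝ} (hH : ContinuousOn H I) (hpos : ∀ s ∈ I, 0 < H s) :
    ∃ P : ℝ → ℝ, P 0 = 0 ∧ StrictMonoOn P I ∧ ∀ s ∈ I, HasDerivAt P (H s)⁻¹ s := by
  have hc : ContinuousOn (fun s => (H s)⁻¹) I := hH.inv₀ fun s hs => (hpos s hs).ne'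
  have hd : ∀ s ∈ I, HasDerivAt (fun s => ∫ r in (0 : ℝ)..s, (H r)⁻¹) (H s)⁻¹ s := fun s hs =>
    intervalIntegral.integral_hasDerivAt_right
      ((hc.mono (hI.uIcc_subset h0 hs)).intervalIntegrable)
      (hc.stronglyMeasurableAtFilter hIo s hs) (hc.continuousAt (hIo.mem_nhds hs))
  refine ⟨fun s => ∫ r in (0 : ℝ)..s, (H r)⁻¹, by simp, ?_, hd⟩
  refine strictMonoOn_of_deriv_pos hI.convex
    (fun s hs => (hd s hs).continuousAt.continuousWithinAt) fun s hs => ?_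
  rw [(hd s (interior_subset hs)).deriv]
  exact inv_pos.2 (hpos s (interior_subset hs))

/-- Along a solution of `τ' = a H(τ)` the travel time grows linearly. -/
theorem travelTime_comp {I J : Set ℝ} (hJ : J.OrdConnected) (h0 : (0 : ℝ) ∈ J) {H P τ : ℝ → ℝ}
    {a : ℝ} (hpos : ∀ s ∈ I, 0 < H s) (hP0 : P 0 = 0) (hP : ∀ s ∈ I, HasDerivAt P (H s)⁻¹ s)
    (hτ0 : τ 0 = 0) (hτI : ∀ t ∈ J, τ t ∈ I)
    (hτ : ∀ t ∈ J, HasDerivWithinAt τ (a * H (τ t)) J t) : ∀ t ∈ J, P (τ t) = a * t := by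
  refine hJ.eqOn_of_hasDerivWithinAt_eq (f' := fun _ => a) (fun t ht => ?_) (fun t _ => ?_) h0
    (by simp [hτ0, hP0])
  · refine ((hP _ (hτI t ht)).comp_hasDerivWithinAt t (hτ t ht)).congr_deriv ?_
    have := (hpos _ (hτI t ht)).ne'
    field_simp
  · simpa using (hasDerivWithinAt_id t J).const_mul a

/-- The maximal solution of `τ' = H(τ)`, `τ(0) = 0` for a positive continuous `H` on an open
interval runs through the whole interval. It is the inverse of the travel time. -/
theorem exists_maximal_solution {I : Set ℝ} (hI : I.OrdConnected) (hIo : IsOpen I)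
    (h0 : (0 : ℝ) ∈ I) {H : ℝ → ℝ} (hH : ContinuousOn H I) (hpos : ∀ s ∈ I, 0 < H s) :
    ∃ (J : Set ℝ) (τ : ℝ → ℝ), IsOpen J ∧ J.OrdConnected ∧ 0 ∈ J ∧ τ 0 = 0 ∧
      (∀ t ∈ J, τ t ∈ I ∧ HasDerivAt τ (H (τ t)) t) ∧
      ∀ s ∈ I, ∃ t ∈ J, τ t = s ∧ (0 < s → 0 < t) := by
  obtain ⟨P, hP0, hmono, hP⟩ := exists_travelTime hI hIo h0 hH hpos
  have hcont : ContinuousOn P I := fun s hs => (hP s hs).continuousAt.continuousWithinAt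
  have hleft : ∀ s ∈ I, Function.invFunOn P I (P s) = s := fun s hs =>
    hmono.injOn.leftInvOn_invFunOn hs
  have hopen : IsOpen (P '' I) := by
    rw [isOpen_iff_mem_nhds]
    rintro _ ⟨s, hs, rfl⟩
    obtain ⟨δ, hδ, hb⟩ := Metric.isOpen_iff.1 hIo s hs
    have hsub : Icc (s - δ / 2) (s + δ / 2) ⊆ I := fun r hr => hb (by
      rw [Metric.mem_ball, Real.dist_eq, abs_lt]
      constructor <;> linarith [hr.1, hr.2])
    have hl := hsub (left_mem_Icc.2 (by linarith))
    have hr := hsub (right_mem_Icc.2 (by linarith))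
    refine Filter.mem_of_superset (Icc_mem_nhds (hmono hl hs (by linarith))
      (hmono hs hr (by linarith))) ?_
    exact (intermediate_value_Icc (by linarith) (hcont.mono hsub)).trans (image_mono hsub)
  refine ⟨P '' I, Function.invFunOn P I, hopen, ?_, ⟨0, h0, hP0⟩, ?_, ?_, ?_⟩
  · exact (hI.isPreconnected.image P hcont).ordConnected
  · conv_lhs => rw [← hP0]
    exact hleft 0 h0
  · rintro _ ⟨s, hs, rfl⟩
    rw [hleft s hs]
    refine ⟨hs, ?_⟩
    have hmono' : StrictMonoOn (Function.invFunOn P I) (P '' I) := by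
      rintro _ ⟨a, ha, rfl⟩ _ ⟨b, hb, rfl⟩ hab
      rw [hleft a ha, hleft b hb]
      exact (hmono.lt_iff_lt ha hb).1 hab
    have himg : Function.invFunOn P I '' (P '' I) = I := by
      rw [image_image]
      exact (image_congr hleft).trans (image_id' I)
    have hc : ContinuousAt (Function.invFunOn P I) (P s) :=
      hmono'.continuousAt_of_image_mem_nhds (hopen.mem_nhds ⟨s, hs, rfl⟩) (by
        rw [himg, hleft s hs]
        exact hIo.mem_nhds hs)
    have hd : HasDerivAt P (H s)⁻¹ (Function.invFunOn P I (P s)) := by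
      rw [hleft s hs]
      exact hP s hs
    have h1 := hd.of_local_left_inverse hc (inv_ne_zero (hpos s hs).ne') (by
      filter_upwards [hopen.mem_nhds ⟨s, hs, rfl⟩] with t ht
      exact Function.invFunOn_eq ht)
    rwa [inv_inv] at h1
  · intro s hs
    refine ⟨P s, ⟨s, hs, rfl⟩, hleft s hs, fun h => ?_⟩
    rw [← hP0]
    exact hmono h0 hs h

theorem contDiffOn_of_autonomous {I J : Set ℝ} (hJ : UniqueDiffOn ℝ J) {H τ : ℝ → ℝ}
    (hH : ContDiffOn ℝ ∞ H I) (hτI : MapsTo τ J I)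
    (hτ : ∀ t ∈ J, HasDerivWithinAt τ (H (τ t)) J t) : ContDiffOn ℝ ∞ τ J := by
  rw [contDiffOn_infty]
  intro k
  induction k with
  | zero => exact contDiffOn_zero.2 fun t ht => (hτ t ht).continuousWithinAt
  | succ k ih =>
    push_cast
    refine (contDiffOn_succ_iff_derivWithin hJ).2
      ⟨fun t ht => (hτ t ht).differentiableWithinAt, by simp, ?_⟩
    exact ((contDiffOn_infty.1 hH k).comp ih hτI).congr fun t ht => (hτ t ht).derivWithin (hJ t ht)

/-! ### Powers of straight lines -/

section Lines

variable {M : Type*}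

/-- The parameters `s` for which `f + s ξ` is positive. -/
def lineDomain (f ξ : M → ℝ) : Set ℝ := {s | ∀ x, 0 < f x + s * ξ x}

/-- The integral of `(f + s ξ) ^ p`, as a function of `s`. -/
noncomputable def linePow [MeasurableSpace M] (m : Measure M) (p : ℝ) (f ξ : M → ℝ) (s : ℝ) : ℝ :=
  ∫ x, (f x + s * ξ x) ^ p ∂m

theorem ordConnected_lineDomain (f ξ : M → ℝ) : (lineDomain f ξ).OrdConnected := by
  refine ⟨fun a ha b hb s hs x => ?_⟩
  have h1 := ha x
  have h2 := hb x
  rcases le_total 0 (ξ x) with h | h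
  · nlinarith [mul_le_mul_of_nonneg_right hs.1 h]
  · nlinarith [mul_le_mul_of_nonpos_right hs.2 h]

theorem zero_mem_lineDomain {f ξ : M → ℝ} (hf : ∀ x, 0 < f x) : 0 ∈ lineDomain f ξ := fun x => by
  simpa using hf x

theorem integral_pos_of_pos [TopologicalSpace M] [CompactSpace M] [MeasurableSpace M]
    [BorelSpace M] (m : Measure M)
    [IsProbabilityMeasure m] {g : M → ℝ} (hg : Continuous g) (hpos : ∀ x, 0 < g x) :
    0 < ∫ x, g x ∂m := by
  rw [integral_pos_iff_support_of_nonneg (fun x => (hpos x).le) (hg.integrable_of_compactSpace m)]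
  rw [show Function.support g = univ from eq_univ_of_forall fun x => (hpos x).ne']
  simp

variable {n : ℕ} [TopologicalSpace M] [CompactSpace M]

theorem isOpen_lineDomain {f ξ : M → ℝ} (hf : Continuous f) (hξ : Continuous ξ) :
    IsOpen (lineDomain f ξ) := by
  rw [isOpen_iff_mem_nhds]
  intro s hs
  have h := isCompact_univ.eventually_forall_of_forall_eventually (x₀ := s)
    (P := fun s (x : M) => 0 < f x + s * ξ x) fun x _ => by
      have hc : Continuous fun q : ℝ × M => f q.2 + q.1 * ξ q.2 := by fun_prop
      exact hc.continuousAt.eventually (lt_mem_nhds (hs x))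
  filter_upwards [h] with r hr x using hr x (mem_univ x)

theorem nontrivial_lineDomain {f ξ : M → ℝ} (hf : Continuous f) (hξ : Continuous ξ) {s : ℝ}
    (hs : s ∈ lineDomain f ξ) : (lineDomain f ξ).Nontrivial :=
  (infinite_of_mem_nhds s ((isOpen_lineDomain hf hξ).mem_nhds hs)).nontrivial

variable [ChartedSpace (EuclideanSpace ℝ (Fin n)) M]

omit [CompactSpace M] in
theorem isSmoothFnCurve_line {f ξ : M → ℝ} (hf : ContMDiff (𝓡 n) 𝓘(ℝ, ℝ) ∞ f)
    (hξ : ContMDiff (𝓡 n) 𝓘(ℝ, ℝ) ∞ ξ) {J : Set ℝ} {τ : ℝ → ℝ} (hτ : ContDiffOn ℝ ∞ τ J) :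
    IsSmoothFnCurve (n := n) J (fun t x => f x + τ t * ξ x) :=
  (isSmoothFnCurve_const hf).add ((isSmoothFnCurve_time hτ).mul (isSmoothFnCurve_const hξ))

variable [IsManifold (𝓡 n) ∞ M] [MeasurableSpace M] [BorelSpace M] (m : Measure M)
  [IsProbabilityMeasure m]

section

variable {f ξ : M → ℝ} (hf : ContMDiff (𝓡 n) 𝓘(ℝ, ℝ) ∞ f) (hξ : ContMDiff (𝓡 n) 𝓘(ℝ, ℝ) ∞ ξ)
  {s : ℝ} (hs : s ∈ lineDomain f ξ) (p : ℝ)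

include hf hξ

theorem contDiffOn_linePow : ContDiffOn ℝ ∞ (linePow m p f ξ) (lineDomain f ξ) := by
  rcases (lineDomain f ξ).eq_empty_or_nonempty with h | ⟨s, hs⟩
  · rw [h]
    exact fun x hx => absurd hx (notMem_empty x)
  · exact ((isSmoothFnCurve_line hf hξ contDiffOn_id).rpow_const
      (J := lineDomain f ξ) (fun _ ht x => ht x) p
      ).contDiffOn_integral m (ordConnected_lineDomain f ξ)
      (nontrivial_lineDomain hf.continuous hξ.continuous hs)

include hs

omit [IsManifold (𝓡 n) ∞ M] in
theorem linePow_pos : 0 < linePow m p f ξ s :=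
  integral_pos_of_pos m (((isSmoothFnCurve_line hf hξ contDiffOn_id).rpow_const
    (J := lineDomain f ξ) (fun _ ht x => ht x) p).continuous hs)
    fun x => Real.rpow_pos_of_pos (hs x) p

theorem hasDerivAt_linePow : HasDerivAt (linePow m p f ξ)
    (p * ∫ x, (f x + s * ξ x) ^ (p - 1) * ξ x ∂m) s := by
  have hn := nontrivial_lineDomain hf.continuous hξ.continuous hs
  have hJ := ordConnected_lineDomain f ξ
  have h1 := ((isSmoothFnCurve_line hf hξ contDiffOn_id).rpow_const
    (J := lineDomain f ξ) (fun _ ht x => ht x) p).hasDerivWithinAt_integral m hJ hn hs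
  rw [fnVelocity_eq (hJ.uniqueDiffOn hn)
    (γ₁ := fun t x => p * ((f x + t * ξ x) ^ (p - 1) * ξ x)) _ hs, integral_const_mul] at h1
  · exact h1.hasDerivAt ((isOpen_lineDomain hf.continuous hξ.continuous).mem_nhds hs)
  · intro t ht x
    have h2 : HasDerivWithinAt (fun s => f x + s * ξ x) (ξ x) (lineDomain f ξ) t := by
      simpa using ((hasDerivWithinAt_id t (lineDomain f ξ)).mul_const (ξ x)).const_add (f x)
    refine (h2.rpow_const (p := p) (Or.inl (ht x).ne')).congr_deriv ?_
    ring

end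

end Lines

/-! ### Geodesics in terms of densities -/

section Geodesics

variable {n : ℕ} {M : Type*} [TopologicalSpace M]
  [ChartedSpace (EuclideanSpace ℝ (Fin n)) M]

/-- Smooth curves of positive functions with `∫ γ ^ p = |p| ^ p` whose acceleration is at each time
a multiple of the position. They are the geodesics of the hypersurface `S_α` with
`p = 2 / (1 - α)`. -/
def IsCentralGeodesic [MeasurableSpace M] (n : ℕ) [ChartedSpace (EuclideanSpace ℝ (Fin n)) M]
    (m : Measure M) (p : ℝ) (J : Set ℝ) (γ : ℝ → M → ℝ) : Prop :=
  IsSmoothFnCurve (n := n) J γ ∧ (∀ t ∈ J, (∀ x, 0 < γ t x) ∧ ∫ x, γ t x ^ p ∂m = |p| ^ p) ∧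
    ∀ t ∈ J, ∃ φ : ℝ, ∀ x, fnVelocity (fnVelocity γ J) J t x = φ * γ t x

/-- The equation of `α`-geodesics for the density `u` of a curve of probability forms. The
multiplier `φ` is forced by the normalization, so that it need not be specified. -/
def IsDensityGeodesic [MeasurableSpace M] (n : ℕ) [ChartedSpace (EuclideanSpace ℝ (Fin n)) M]
    (m : Measure M) (α : ℝ) (J : Set ℝ) (u : ℝ → M → ℝ) : Prop :=
  IsSmoothFnCurve (n := n) J u ∧ (∀ t ∈ J, (∀ x, 0 < u t x) ∧ ∫ x, u t x ∂m = 1) ∧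
    ∀ t ∈ J, ∃ φ : ℝ, ∀ x, fnVelocity (fnVelocity u J) J t x =
      (1 + α) / 2 * (fnVelocity u J t x ^ 2 / u t x) + φ * u t x

/-- The second derivative of a multiple of a power of a positive curve. -/
theorem fnVelocity_fnVelocity_rpow [IsManifold (𝓡 n) ∞ M] {J : Set ℝ} (hJ : UniqueDiffOn ℝ J)
    {u : ℝ → M → ℝ} (h : IsSmoothFnCurve (n := n) J u) (hpos : ∀ t ∈ J, ∀ x, 0 < u t x)
    (k q : ℝ) {t : ℝ} (ht : t ∈ J) (x : M) :
    fnVelocity (fnVelocity (fun t x => k * u t x ^ q) J) J t x =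
      k * q * u t x ^ (q - 1) * (fnVelocity (fnVelocity u J) J t x +
        (q - 1) * (fnVelocity u J t x ^ 2 / u t x)) := by
  have h1 : ∀ t ∈ J, ∀ x, HasDerivWithinAt (fun s => k * u s x ^ q)
      (k * (fnVelocity u J t x * q * u t x ^ (q - 1))) J t := fun t ht x =>
    ((h.hasDerivWithinAt ht x).rpow_const (Or.inl (hpos t ht x).ne')).const_mul k
  have h2 : ∀ t ∈ J, ∀ x, HasDerivWithinAt
      (fun s => k * (fnVelocity u J s x * q * u s x ^ (q - 1)))
      (k * (fnVelocity (fnVelocity u J) J t x * q * u t x ^ (q - 1) +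
        fnVelocity u J t x * q * (fnVelocity u J t x * (q - 1) * u t x ^ (q - 1 - 1)))) J t :=
    fun t ht x => ((((h.fnVelocity hJ).hasDerivWithinAt ht x).mul_const q).mul
      ((h.hasDerivWithinAt ht x).rpow_const (Or.inl (hpos t ht x).ne'))).const_mul k
  rw [fnVelocity_fnVelocity_eq hJ h1 h2 ht]
  beta_reduce
  rw [Real.rpow_sub_one (hpos t ht x).ne' (q - 1)]
  have := (hpos t ht x).ne'
  field_simp

theorem fnVelocity_rpow {J : Set ℝ} (hJ : UniqueDiffOn ℝ J)
    {u : ℝ → M → ℝ} (h : IsSmoothFnCurve (n := n) J u) (hpos : ∀ t ∈ J, ∀ x, 0 < u t x)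
    (k q : ℝ) {t : ℝ} (ht : t ∈ J) (x : M) :
    fnVelocity (fun t x => k * u t x ^ q) J t x = k * q * u t x ^ (q - 1) * fnVelocity u J t x := by
  rw [fnVelocity_eq hJ (γ₁ := fun t x => k * (fnVelocity u J t x * q * u t x ^ (q - 1)))
    (fun t ht x => ((h.hasDerivWithinAt ht x).rpow_const (Or.inl (hpos t ht x).ne')).const_mul k)
    ht]
  ring

theorem abs_mul_rpow_inv_rpow {p a : ℝ} (hp : p ≠ 0) (ha : 0 < a) :
    (|p| * a ^ p⁻¹) ^ p = |p| ^ p * a := by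
  rw [Real.mul_rpow (abs_nonneg p) (Real.rpow_nonneg ha.le _), Real.rpow_inv_rpow ha.le hp]

/-- The power map `u ↦ |p| u ^ (1 / p)` interchanges the two kinds of geodesics. -/
theorem isDensityGeodesic_iff [IsManifold (𝓡 n) ∞ M] [MeasurableSpace M] (m : Measure M)
    {α p : ℝ} (hp : p ≠ 0) (hα : α = 1 - 2 / p) {J : Set ℝ} (hJ : UniqueDiffOn ℝ J)
    {u : ℝ → M → ℝ} (hpos : ∀ t ∈ J, ∀ x, 0 < u t x) :
    IsDensityGeodesic n m α J u ↔
      IsCentralGeodesic n m p J (fun t x => |p| * u t x ^ p⁻¹) := by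
  have hp' : 0 < |p| := abs_pos.2 hp
  have hsm : IsSmoothFnCurve (n := n) J u ↔
      IsSmoothFnCurve (n := n) J (fun t x => |p| * u t x ^ p⁻¹) := by
    constructor
    · intro h
      exact (isSmoothFnCurve_const contMDiff_const).mul (h.rpow_const hpos _)
    · intro h
      have h1 := (isSmoothFnCurve_const (g := fun _ : M => (|p| ^ p)⁻¹) contMDiff_const).mul
        (h.rpow_const (fun t ht x => mul_pos hp' (Real.rpow_pos_of_pos (hpos t ht x) _)) p)
      refine h1.congr fun t ht x => ?_
      have := (Real.rpow_pos_of_pos hp' p).ne'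
      rw [abs_mul_rpow_inv_rpow hp (hpos t ht x)]
      field_simp
  rw [IsDensityGeodesic, IsCentralGeodesic, ← hsm]
  refine and_congr_right fun h => and_congr (forall₂_congr fun t ht => ?_)
    (forall₂_congr fun t ht => ?_)
  · have hk := (Real.rpow_pos_of_pos hp' p).ne'
    refine and_congr (forall_congr' fun x => ?_) ?_
    · exact ⟨fun h => mul_pos hp' (Real.rpow_pos_of_pos h _), fun _ => hpos t ht x⟩
    · simp only [abs_mul_rpow_inv_rpow hp (hpos t ht _), integral_const_mul]
      rw [mul_eq_left₀ hk]
  · have hα' : (1 + α) / 2 = 1 - p⁻¹ := by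
      rw [hα]
      field_simp
      ring
    simp only [fnVelocity_fnVelocity_rpow hJ h hpos |p| p⁻¹ ht, hα']
    have hpow : ∀ x, u t x ^ p⁻¹ = u t x ^ (p⁻¹ - 1) * u t x := fun x => by
      rw [Real.rpow_sub_one (hpos t ht x).ne', div_mul_cancel₀ _ (hpos t ht x).ne']
    constructor
    · rintro ⟨φ, hφ⟩
      refine ⟨p⁻¹ * φ, fun x => ?_⟩
      rw [hφ, hpow]
      ring
    · rintro ⟨φ, hφ⟩
      refine ⟨p * φ, fun x => ?_⟩
      have h1 := hφ x
      have h2 := (Real.rpow_pos_of_pos (hpos t ht x) (p⁻¹ - 1)).ne'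
      rw [hpow] at h1
      have h3 : p⁻¹ * (fnVelocity (fnVelocity u J) J t x +
          (p⁻¹ - 1) * (fnVelocity u J t x ^ 2 / u t x)) = φ * u t x :=
        mul_left_cancel₀ (mul_ne_zero hp'.ne' h2) (by linear_combination h1)
      have h4 : fnVelocity (fnVelocity u J) J t x +
          (p⁻¹ - 1) * (fnVelocity u J t x ^ 2 / u t x) = p * (φ * u t x) := by
        rw [← h3, mul_inv_cancel_left₀ hp]
      linear_combination h4

end Geodesics

/-! ### Central geodesics are projected straight lines -/

/-- If `ρ² τ'` is constant, the acceleration of `ρ (f + τ ξ)` is a multiple of `f + τ ξ`. -/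
theorem fnVelocity_fnVelocity_mul_line {M : Type*} {J : Set ℝ} (hJ : UniqueDiffOn ℝ J) {ρ τ : ℝ → ℝ} {D : ℝ}
    (hρ : ContDiffOn ℝ ∞ ρ J) (hρ0 : ∀ t ∈ J, ρ t ≠ 0)
    (hτ : ∀ t ∈ J, HasDerivWithinAt τ (D / ρ t ^ 2) J t) (f ξ : M → ℝ) {t : ℝ} (ht : t ∈ J)
    (x : M) : fnVelocity (fnVelocity (fun t x => ρ t * (f x + τ t * ξ x)) J) J t x =
      derivWithin (derivWithin ρ J) J t * (f x + τ t * ξ x) := by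
  have hρ1 : ∀ t ∈ J, HasDerivWithinAt ρ (derivWithin ρ J t) J t := fun t ht =>
    (hρ.differentiableOn (by simp) t ht).hasDerivWithinAt
  have hρ2 : ∀ t ∈ J, HasDerivWithinAt (derivWithin ρ J) (derivWithin (derivWithin ρ J) J t) J t :=
    fun t ht => (((contDiffOn_infty_iff_derivWithin hJ).1 hρ).2.differentiableOn (by simp) t
      ht).hasDerivWithinAt
  have hl : ∀ t ∈ J, ∀ x, HasDerivWithinAt (fun t => f x + τ t * ξ x) (D / ρ t ^ 2 * ξ x) J t :=
    fun t ht x => ((hτ t ht).mul_const (ξ x)).const_add (f x)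
  have h1 : ∀ t ∈ J, ∀ x, HasDerivWithinAt (fun t => ρ t * (f x + τ t * ξ x))
      (derivWithin ρ J t * (f x + τ t * ξ x) + D * ξ x * (ρ t)⁻¹) J t := fun t ht x => by
    refine ((hρ1 t ht).mul (hl t ht x)).congr_deriv ?_
    have := hρ0 t ht
    field_simp
  have h2 : ∀ t ∈ J, ∀ x, HasDerivWithinAt
      (fun t => derivWithin ρ J t * (f x + τ t * ξ x) + D * ξ x * (ρ t)⁻¹)
      (derivWithin (derivWithin ρ J) J t * (f x + τ t * ξ x)) J t := fun t ht x => by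
    refine (((hρ2 t ht).mul (hl t ht x)).add
      (((hρ1 t ht).inv (hρ0 t ht)).const_mul (D * ξ x))).congr_deriv ?_
    have := hρ0 t ht
    field_simp
    ring
  rw [fnVelocity_fnVelocity_eq hJ h1 h2 ht]

section Projected

variable {n : ℕ} {M : Type*} [TopologicalSpace M] [CompactSpace M]
  [ChartedSpace (EuclideanSpace ℝ (Fin n)) M] [IsManifold (𝓡 n) ∞ M]
  [MeasurableSpace M] [BorelSpace M] {m : Measure M} [IsProbabilityMeasure m] {p : ℝ} {J : Set ℝ}

theorem contDiffOn_linePow_rpow {f ξ : M → ℝ} (hf : ContMDiff (𝓡 n) 𝓘(ℝ, ℝ) ∞ f)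
    (hξ : ContMDiff (𝓡 n) 𝓘(ℝ, ℝ) ∞ ξ) (C q : ℝ) :
    ContDiffOn ℝ ∞ (fun s => C * linePow m p f ξ s ^ q) (lineDomain f ξ) :=
  contDiffOn_const.mul ((contDiffOn_linePow m hf hξ p).rpow_const_of_ne
    fun _ hs => (linePow_pos m hf hξ hs p).ne')

/-- Running through a straight line with speed proportional to the power `2 / p` of `linePow`,
and projecting, gives a geodesic. -/
theorem isCentralGeodesic_line (hp : p ≠ 0) (hJ : J.OrdConnected) (hn : J.Nontrivial)
    {f ξ : M → ℝ} (hf : ContMDiff (𝓡 n) 𝓘(ℝ, ℝ) ∞ f) (hξ : ContMDiff (𝓡 n) 𝓘(ℝ, ℝ) ∞ ξ)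
    {τ : ℝ → ℝ} {C : ℝ} (hI : MapsTo τ J (lineDomain f ξ))
    (hτ : ∀ t ∈ J, HasDerivWithinAt τ (C * linePow m p f ξ (τ t) ^ (2 / p)) J t) :
    IsCentralGeodesic n m p J
      (fun t x => |p| * ((f x + τ t * ξ x) / linePow m p f ξ (τ t) ^ p⁻¹)) := by
  have hu := hJ.uniqueDiffOn hn
  have hp' : 0 < |p| := abs_pos.2 hp
  have hN : ∀ t ∈ J, 0 < linePow m p f ξ (τ t) := fun t ht => linePow_pos m hf hξ (hI ht) p
  have hτs : ContDiffOn ℝ ∞ τ J :=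
    contDiffOn_of_autonomous hu (contDiffOn_linePow_rpow hf hξ C (2 / p)) hI hτ
  set ρ : ℝ → ℝ := fun t => |p| * linePow m p f ξ (τ t) ^ (-p⁻¹) with hρdef
  have hρs : ContDiffOn ℝ ∞ ρ J := (contDiffOn_linePow_rpow hf hξ |p| (-p⁻¹)).comp hτs hI
  have hρ0 : ∀ t ∈ J, 0 < ρ t := fun t ht => mul_pos hp' (Real.rpow_pos_of_pos (hN t ht) _)
  have heq : ∀ t ∈ J, ∀ x, |p| * ((f x + τ t * ξ x) / linePow m p f ξ (τ t) ^ p⁻¹) =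
      ρ t * (f x + τ t * ξ x) := fun t ht x => by
    rw [hρdef]
    beta_reduce
    rw [Real.rpow_neg (hN t ht).le]
    ring
  have hsm : IsSmoothFnCurve (n := n) J (fun t x => ρ t * (f x + τ t * ξ x)) :=
    (isSmoothFnCurve_time hρs).mul (isSmoothFnCurve_line hf hξ hτs)
  have hvel : ∀ t ∈ J, ∀ x, fnVelocity (fnVelocity (fun t x =>
      |p| * ((f x + τ t * ξ x) / linePow m p f ξ (τ t) ^ p⁻¹)) J) J t x =
      fnVelocity (fnVelocity (fun t x => ρ t * (f x + τ t * ξ x)) J) J t x := by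
    have h1 : ∀ t ∈ J, ∀ x, fnVelocity (fun t x =>
        |p| * ((f x + τ t * ξ x) / linePow m p f ξ (τ t) ^ p⁻¹)) J t x =
        fnVelocity (fun t x => ρ t * (f x + τ t * ξ x)) J t x := fun t ht x =>
      derivWithin_congr (fun s hs => heq s hs x) (heq t ht x)
    exact fun t ht x => derivWithin_congr (fun s hs => h1 s hs x) (h1 t ht x)
  refine ⟨hsm.congr heq, fun t ht => ⟨fun x => ?_, ?_⟩, fun t ht => ?_⟩
  · beta_reduce
    rw [heq t ht]
    exact mul_pos (hρ0 t ht) (hI ht x)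
  · have h1 : ∀ x, (|p| * ((f x + τ t * ξ x) / linePow m p f ξ (τ t) ^ p⁻¹)) ^ p =
        |p| ^ p * (f x + τ t * ξ x) ^ p / linePow m p f ξ (τ t) := fun x => by
      have h2 := Real.rpow_pos_of_pos (hN t ht) p⁻¹
      rw [Real.mul_rpow hp'.le (div_pos (hI ht x) h2).le, Real.div_rpow (hI ht x).le h2.le,
        Real.rpow_inv_rpow (hN t ht).le hp, mul_div_assoc]
    simp only [h1]
    rw [integral_div, integral_const_mul]
    exact mul_div_cancel_right₀ _ (hN t ht).ne'
  · refine ⟨derivWithin (derivWithin ρ J) J t / ρ t, fun x => ?_⟩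
    beta_reduce
    rw [hvel t ht, heq t ht, fnVelocity_fnVelocity_mul_line hu hρs (fun t ht => (hρ0 t ht).ne')
      (D := C * |p| ^ 2) _ f ξ ht]
    · have := (hρ0 t ht).ne'
      field_simp
    · intro t ht
      refine (hτ t ht).congr_deriv ?_
      have h2 := Real.rpow_pos_of_pos (hN t ht) p⁻¹
      rw [hρdef]
      beta_reduce
      rw [Real.rpow_neg (hN t ht).le, show 2 / p = p⁻¹ * (2 : ℕ) by push_cast; ring,
        Real.rpow_mul_natCast (hN t ht).le]
      have := hp'.ne'
      field_simp

/-- A geodesic is a projected straight line. The factor `ρ` of the line is the pairing of the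
geodesic with `f ^ (p - 1)`, which satisfies the same second order equation. As Wronskians are
constant, the quotient of the geodesic and `ρ` moves along the line. -/
theorem IsCentralGeodesic.exists_line {γ : ℝ → M → ℝ} (h : IsCentralGeodesic n m p J γ)
    (hp : p ≠ 0) (hJ : J.OrdConnected) (hn : J.Nontrivial) (h0 : (0 : ℝ) ∈ J) {f ξ : M → ℝ}
    (hf : f = γ 0) (hξ : ξ = fnVelocity γ J 0) :
    ∫ x, f x ^ (p - 1) * ξ x ∂m = 0 ∧ ∃ τ : ℝ → ℝ, τ 0 = 0 ∧ MapsTo τ J (lineDomain f ξ) ∧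
      (∀ t ∈ J, HasDerivWithinAt τ ((|p| ^ 2)⁻¹ * linePow m p f ξ (τ t) ^ (2 / p)) J t) ∧
      ∀ t ∈ J, ∀ x, γ t x = |p| * ((f x + τ t * ξ x) / linePow m p f ξ (τ t) ^ p⁻¹) := by
  have hu := hJ.uniqueDiffOn hn
  have hp' : 0 < |p| := abs_pos.2 hp
  obtain ⟨hs, hS, hφ⟩ := h
  have hv := hs.fnVelocity hu
  have hf0 : ∀ x, 0 < f x := fun x => hf ▸ (hS 0 h0).1 x
  have hfp : ∫ x, f x ^ p ∂m = |p| ^ p := hf ▸ (hS 0 h0).2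
  have hfs : ContMDiff (𝓡 n) 𝓘(ℝ, ℝ) ∞ f := hf ▸ hs.contMDiff h0
  have hξs : ContMDiff (𝓡 n) 𝓘(ℝ, ℝ) ∞ ξ := hξ ▸ hv.contMDiff h0
  have hkpos : 0 < |p| ^ p := Real.rpow_pos_of_pos hp' p
  have horth : ∫ x, f x ^ (p - 1) * ξ x ∂m = 0 := by
    have h1 := (hs.rpow_const (fun t ht x => (hS t ht).1 x) p).hasDerivWithinAt_integral m hJ hn h0
    have h2 : HasDerivWithinAt (fun t => ∫ x, γ t x ^ p ∂m) 0 J 0 :=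
      (hasDerivWithinAt_const (0 : ℝ) J (|p| ^ p)).congr (fun t ht => (hS t ht).2) (hS 0 h0).2
    have h3 := (hu 0 h0).eq_deriv J h1 h2
    rw [fnVelocity_eq hu (γ₁ := fun t x => p * (γ t x ^ (p - 1) * fnVelocity γ J t x)) _ h0,
      integral_const_mul] at h3
    · rw [hf, hξ]
      exact (mul_eq_zero.1 h3).resolve_left hp
    · intro t ht x
      refine ((hs.hasDerivWithinAt ht x).rpow_const (p := p)
        (Or.inl ((hS t ht).1 x).ne')).congr_deriv ?_
      ring
  refine ⟨horth, ?_⟩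
  choose! φ hφ using hφ
  -- the pairing of a curve with `f ^ (p - 1)`
  have hw : ContMDiff (𝓡 n) 𝓘(ℝ, ℝ) ∞ fun x => f x ^ (p - 1) := hfs.rpow_const_of_pos hf0 _
  have hpair : ∀ {η : ℝ → M → ℝ}, IsSmoothFnCurve (n := n) J η → ∀ t ∈ J,
      HasDerivWithinAt (fun t => ∫ x, f x ^ (p - 1) * η t x ∂m)
        (∫ x, f x ^ (p - 1) * fnVelocity η J t x ∂m) J t := fun {η} hη t ht => by
    have h1 := ((isSmoothFnCurve_const hw).mul hη).hasDerivWithinAt_integral m hJ hn ht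
    rwa [fnVelocity_eq hu (γ₁ := fun t x => f x ^ (p - 1) * fnVelocity η J t x)
      (fun t ht x => (hη.hasDerivWithinAt ht x).const_mul _) ht] at h1
  have hff : ∀ x, f x ^ (p - 1) * f x = f x ^ p := fun x => by
    rw [Real.rpow_sub_one (hf0 x).ne', div_mul_cancel₀ _ (hf0 x).ne']
  set ρ : ℝ → ℝ := fun t => (∫ x, f x ^ (p - 1) * γ t x ∂m) / |p| ^ p with hρdef
  set ρ₁ : ℝ → ℝ := fun t => (∫ x, f x ^ (p - 1) * fnVelocity γ J t x ∂m) / |p| ^ p with hρ1def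
  have hρ : ∀ t ∈ J, HasDerivWithinAt ρ (ρ₁ t) J t := fun t ht => (hpair hs t ht).div_const _
  have hρ1 : ∀ t ∈ J, HasDerivWithinAt ρ₁ (φ t * ρ t) J t := fun t ht => by
    refine ((hpair hv t ht).div_const (|p| ^ p)).congr_deriv ?_
    simp only [hφ t ht, hρdef, mul_left_comm _ (φ t), integral_const_mul, mul_div_assoc]
  have hρpos : ∀ t ∈ J, 0 < ρ t := fun t ht => div_pos
    (integral_pos_of_pos m (hw.continuous.mul (hs.continuous ht))
      fun x => mul_pos (Real.rpow_pos_of_pos (hf0 x) _) ((hS t ht).1 x)) hkpos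
  have hρ0 : ρ 0 = 1 := by
    simp only [hρdef, ← hf, hff, hfp, div_self hkpos.ne']
  have hρ10 : ρ₁ 0 = 0 := by
    simp only [hρ1def, ← hξ, horth, zero_div]
  have hf00 : ∀ x, γ 0 x = f x := fun x => by rw [hf]
  have hξ00 : ∀ x, fnVelocity γ J 0 x = ξ x := fun x => by rw [hξ]
  have hwr : ∀ x, ∀ t ∈ J, fnVelocity γ J t x * ρ t - γ t x * ρ₁ t = ξ x := fun x => by
    refine hJ.eqOn_of_hasDerivWithinAt_eq (f' := fun _ => 0) (fun t ht => ?_)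
      (fun t _ => hasDerivWithinAt_const t J (ξ x)) h0 (by simp [hρ0, hρ10, hξ00])
    refine (((hv.hasDerivWithinAt ht x).mul (hρ t ht)).sub
      ((hs.hasDerivWithinAt ht x).mul (hρ1 t ht))).congr_deriv ?_
    rw [hφ t ht]
    ring
  have hquot : ∀ x, ∀ t ∈ J,
      HasDerivWithinAt (fun t => γ t x / ρ t) (ξ x / ρ t ^ 2) J t := fun x t ht => by
    refine ((hs.hasDerivWithinAt ht x).div (hρ t ht) (hρpos t ht).ne').congr_deriv ?_
    rw [hwr x t ht]
  obtain ⟨τ, hτ0, hτ⟩ : ∃ τ : ℝ → ℝ, τ 0 = 0 ∧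
      ∀ t ∈ J, HasDerivWithinAt τ (ρ t ^ 2)⁻¹ J t := by
    by_cases hξ0 : ∃ x, ξ x ≠ 0
    · obtain ⟨x, hx⟩ := hξ0
      refine ⟨fun t => (γ t x / ρ t - f x) / ξ x, by simp [hf00, hρ0], fun t ht => ?_⟩
      refine (((hquot x t ht).sub_const (f x)).div_const (ξ x)).congr_deriv ?_
      field_simp
    · -- a geodesic without initial velocity is constant
      push Not at hξ0
      refine ⟨id, rfl, fun t ht => ?_⟩
      have h1 : ∀ t ∈ J, ∀ x, γ t x = ρ t * f x := fun t ht x => by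
        have h2 : γ t x / ρ t = f x := hJ.eqOn_of_hasDerivWithinAt_eq (f' := fun _ => 0)
          (fun t ht => (hquot x t ht).congr_deriv (by rw [hξ0, zero_div]))
          (fun t _ => hasDerivWithinAt_const t J (f x)) h0 (by simp [hf00, hρ0]) ht
        have := (hρpos t ht).ne'
        rw [← h2]
        field_simp
      have h2 : ρ t ^ p = 1 := by
        have h3 := (hS t ht).2
        simp only [h1 t ht, Real.mul_rpow (hρpos t ht).le (hf0 _).le, integral_const_mul,
          hfp] at h3
        exact (mul_eq_right₀ hkpos.ne').1 h3
      have h3 : ρ t = 1 := by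
        rw [← Real.rpow_rpow_inv (hρpos t ht).le hp, h2, Real.one_rpow]
      rw [h3]
      simpa using hasDerivWithinAt_id t J
  have hline : ∀ t ∈ J, ∀ x, γ t x / ρ t = f x + τ t * ξ x := fun t ht x => by
    refine hJ.eqOn_of_hasDerivWithinAt_eq (g := fun t => f x + τ t * ξ x)
      (f' := fun t => ξ x / ρ t ^ 2) (hquot x) (fun t ht => ?_) h0 (by simp [hf00, hρ0, hτ0]) ht
    refine (((hτ t ht).mul_const (ξ x)).const_add (f x)).congr_deriv ?_
    ring
  have hI : MapsTo τ J (lineDomain f ξ) := fun t ht x => by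
    rw [← hline t ht]
    exact div_pos ((hS t ht).1 x) (hρpos t ht)
  have hN : ∀ t ∈ J, linePow m p f ξ (τ t) = |p| ^ p / ρ t ^ p := fun t ht => by
    simp only [linePow, ← hline t ht]
    simp only [Real.div_rpow ((hS t ht).1 _).le (hρpos t ht).le, integral_div, (hS t ht).2]
  have hN' : ∀ t ∈ J, linePow m p f ξ (τ t) ^ p⁻¹ = |p| / ρ t := fun t ht => by
    rw [hN t ht, ← Real.div_rpow hp'.le (hρpos t ht).le,
      Real.rpow_rpow_inv (div_pos hp' (hρpos t ht)).le hp]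
  refine ⟨τ, hτ0, hI, fun t ht => (hτ t ht).congr_deriv ?_, fun t ht x => ?_⟩
  · rw [show 2 / p = p⁻¹ * (2 : ℕ) by push_cast; ring,
      Real.rpow_mul_natCast (linePow_pos m hfs hξs (hI ht) p).le, hN' t ht]
    have := (hρpos t ht).ne'
    field_simp
  · rw [hN' t ht, ← hline t ht]
    have := (hρpos t ht).ne'
    field_simp

end Projected

/-! ### Existence, uniqueness and the time change -/

section Uniqueness

variable {n : ℕ} {M : Type*} [TopologicalSpace M] [CompactSpace M]
  [ChartedSpace (EuclideanSpace ℝ (Fin n)) M] [IsManifold (𝓡 n) ∞ M]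
  [MeasurableSpace M] [BorelSpace M] {m : Measure M} [IsProbabilityMeasure m] {p : ℝ} {J : Set ℝ}
  {f ξ : M → ℝ}

omit [IsManifold (𝓡 n) ∞ M] in
theorem lineSpeed_pos (hp : p ≠ 0) (hf : ContMDiff (𝓡 n) 𝓘(ℝ, ℝ) ∞ f)
    (hξ : ContMDiff (𝓡 n) 𝓘(ℝ, ℝ) ∞ ξ) {s : ℝ} (hs : s ∈ lineDomain f ξ) :
    0 < (|p| ^ 2)⁻¹ * linePow m p f ξ s ^ (2 / p) :=
  mul_pos (inv_pos.2 (pow_pos (abs_pos.2 hp) 2)) (Real.rpow_pos_of_pos (linePow_pos m hf hξ hs p) _)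

/-- The maximal time change reaches all points of the line that are positive functions. -/
theorem exists_timeChange (hp : p ≠ 0) (hf : ContMDiff (𝓡 n) 𝓘(ℝ, ℝ) ∞ f)
    (hξ : ContMDiff (𝓡 n) 𝓘(ℝ, ℝ) ∞ ξ) (hf0 : ∀ x, 0 < f x) :
    ∃ (J : Set ℝ) (τ : ℝ → ℝ), IsOpen J ∧ J.OrdConnected ∧ 0 ∈ J ∧ τ 0 = 0 ∧
      (∀ t ∈ J, τ t ∈ lineDomain f ξ ∧
        HasDerivAt τ ((|p| ^ 2)⁻¹ * linePow m p f ξ (τ t) ^ (2 / p)) t) ∧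
      ∀ s ∈ lineDomain f ξ, ∃ t ∈ J, τ t = s ∧ (0 < s → 0 < t) :=
  exists_maximal_solution (ordConnected_lineDomain f ξ)
    (isOpen_lineDomain hf.continuous hξ.continuous) (zero_mem_lineDomain hf0)
    (contDiffOn_linePow_rpow hf hξ _ _).continuousOn fun _ hs => lineSpeed_pos hp hf hξ hs

theorem exists_line_travelTime (hp : p ≠ 0) (hf : ContMDiff (𝓡 n) 𝓘(ℝ, ℝ) ∞ f)
    (hξ : ContMDiff (𝓡 n) 𝓘(ℝ, ℝ) ∞ ξ) (hf0 : ∀ x, 0 < f x) :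
    ∃ P : ℝ → ℝ, P 0 = 0 ∧ StrictMonoOn P (lineDomain f ξ) ∧
      ∀ (J : Set ℝ) (a : ℝ) (τ : ℝ → ℝ), J.OrdConnected → 0 ∈ J → τ 0 = 0 →
        MapsTo τ J (lineDomain f ξ) →
        (∀ t ∈ J, HasDerivWithinAt τ
          (a * ((|p| ^ 2)⁻¹ * linePow m p f ξ (τ t) ^ (2 / p))) J t) →
        ∀ t ∈ J, P (τ t) = a * t := by
  obtain ⟨P, hP0, hmono, hP⟩ := exists_travelTime (ordConnected_lineDomain f ξ)
    (isOpen_lineDomain hf.continuous hξ.continuous) (zero_mem_lineDomain hf0)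
    (contDiffOn_linePow_rpow (m := m) hf hξ (|p| ^ 2)⁻¹ (2 / p)).continuousOn
    fun _ hs => lineSpeed_pos hp hf hξ hs
  refine ⟨P, hP0, hmono, fun J a τ hJ h0 hτ0 hI hτ => ?_⟩
  exact travelTime_comp hJ h0 (fun _ hs => lineSpeed_pos (m := m) hp hf hξ hs) hP0 hP hτ0 hI hτ

theorem IsCentralGeodesic.eqOn_of_initial {γ η : ℝ → M → ℝ} (hγ : IsCentralGeodesic n m p J γ)
    (hη : IsCentralGeodesic n m p J η) (hp : p ≠ 0) (hJ : J.OrdConnected) (hn : J.Nontrivial)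
    (h0 : (0 : ℝ) ∈ J) (h : γ 0 = η 0) (h' : fnVelocity γ J 0 = fnVelocity η J 0) :
    EqOn γ η J := by
  obtain ⟨-, τ, hτ0, hτI, hτ, hτγ⟩ := hγ.exists_line hp hJ hn h0 rfl rfl
  obtain ⟨-, σ, hσ0, hσI, hσ, hση⟩ := hη.exists_line hp hJ hn h0 h h'
  obtain ⟨P, hP0, hmono, hP⟩ := exists_line_travelTime (m := m) hp (hγ.1.contMDiff h0)
    ((hγ.1.fnVelocity (hJ.uniqueDiffOn hn)).contMDiff h0) (hγ.2.1 0 h0).1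
  intro t ht
  have h1 : τ t = σ t := hmono.injOn (hτI ht) (hσI ht)
    ((hP J 1 τ hJ h0 hτ0 hτI (by simpa using hτ) t ht).trans
      (hP J 1 σ hJ h0 hσ0 hσI (by simpa using hσ) t ht).symm)
  funext x
  rw [hτγ t ht, hση t ht, h1]

omit [IsManifold (𝓡 n) ∞ M] in
theorem integral_rpow_mul_line (hf : ContMDiff (𝓡 n) 𝓘(ℝ, ℝ) ∞ f)
    (hξ : ContMDiff (𝓡 n) 𝓘(ℝ, ℝ) ∞ ξ) (hf0 : ∀ x, 0 < f x)
    (h : ∫ x, f x ^ (p - 1) * ξ x ∂m = 0) (r s : ℝ) :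
    ∫ x, f x ^ (p - 1) * (r * (f x + s * ξ x)) ∂m = r * ∫ x, f x ^ p ∂m := by
  have hw := (hf.rpow_const_of_pos hf0 (p - 1)).continuous
  have h1 : ∀ x, f x ^ (p - 1) * (r * (f x + s * ξ x)) =
      r * f x ^ p + r * s * (f x ^ (p - 1) * ξ x) := fun x => by
    rw [Real.rpow_sub_one (hf0 x).ne']
    have := (hf0 x).ne'
    field_simp
  simp only [h1]
  rw [integral_add, integral_const_mul, integral_const_mul, h, mul_zero, add_zero]
  · exact ((hf.rpow_const_of_pos hf0 p).continuous.const_mul r).integrable_of_compactSpace m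
  · exact ((hw.mul hξ.continuous).const_mul (r * s)).integrable_of_compactSpace m

/-- Geodesics with the same end points have proportional initial velocities, since the pairing with
`f ^ (p - 1)` determines the projection factor at time one. The two time changes then run through
the same distance in unit time, so that the factor of proportionality is one. -/
theorem IsCentralGeodesic.eqOn_of_boundary {γ η : ℝ → M → ℝ}
    (hγ : IsCentralGeodesic n m p (Icc 0 1) γ) (hη : IsCentralGeodesic n m p (Icc 0 1) η)
    (hp : p ≠ 0) (h : γ 0 = η 0) (h' : γ 1 = η 1) : EqOn γ η (Icc 0 1) := by
  have hJ : (Icc (0 : ℝ) 1).OrdConnected := ordConnected_Icc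
  have h0 : (0 : ℝ) ∈ Icc (0 : ℝ) 1 := by simp
  have h1 : (1 : ℝ) ∈ Icc (0 : ℝ) 1 := by simp
  have hn : (Icc (0 : ℝ) 1).Nontrivial := ⟨0, h0, 1, h1, zero_ne_one⟩
  have hu := hJ.uniqueDiffOn hn
  obtain ⟨horth, τ, hτ0, hτI, hτ, hτγ⟩ := hγ.exists_line hp hJ hn h0 rfl rfl
  obtain ⟨horth', σ, hσ0, hσI, hσ, hση⟩ := hη.exists_line hp hJ hn h0 h rfl
  have hfs := hγ.1.contMDiff h0
  have hf0 := (hγ.2.1 0 h0).1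
  have hξs := (hγ.1.fnVelocity hu).contMDiff h0
  have hξs' := (hη.1.fnVelocity hu).contMDiff h0
  set f := γ 0 with hf
  set ξ := fnVelocity γ (Icc 0 1) 0 with hξ
  set ζ := fnVelocity η (Icc 0 1) 0 with hζ
  have hfp : 0 < ∫ x, f x ^ p ∂m :=
    integral_pos_of_pos m (hfs.rpow_const_of_pos hf0 p).continuous
      fun x => Real.rpow_pos_of_pos (hf0 x) p
  obtain ⟨P, hP0, hmono, hP⟩ := exists_line_travelTime (m := m) hp hfs hξs hf0
  obtain ⟨Q, hQ0, hmonoQ, hQ⟩ := exists_line_travelTime (m := m) hp hfs hξs' hf0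
  have hPτ : P (τ 1) = 1 := by
    simpa using hP _ 1 τ hJ h0 hτ0 hτI (by simpa using hτ) 1 h1
  have hQσ : Q (σ 1) = 1 := by
    simpa using hQ _ 1 σ hJ h0 hσ0 hσI (by simpa using hσ) 1 h1
  have hτpos : 0 < τ 1 := (hmono.lt_iff_lt (zero_mem_lineDomain hf0) (hτI h1)).1 (by
    rw [hP0, hPτ]; exact one_pos)
  have hσpos : 0 < σ 1 := (hmonoQ.lt_iff_lt (zero_mem_lineDomain hf0) (hσI h1)).1 (by
    rw [hQ0, hQσ]; exact one_pos)
  set r := |p| / linePow m p f ξ (τ 1) ^ p⁻¹ with hr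
  set r' := |p| / linePow m p f ζ (σ 1) ^ p⁻¹ with hr'
  have hrpos : 0 < r := div_pos (abs_pos.2 hp)
    (Real.rpow_pos_of_pos (linePow_pos m hfs hξs (hτI h1) p) _)
  have e1 : ∀ x, γ 1 x = r * (f x + τ 1 * ξ x) := fun x => by
    rw [hτγ 1 h1, hr]; ring
  have e2 : ∀ x, γ 1 x = r' * (f x + σ 1 * ζ x) := fun x => by
    rw [h', hση 1 h1, hr']; ring
  have hrr : r = r' := by
    have i1 := integral_rpow_mul_line hfs hξs hf0 horth r (τ 1)
    have i2 := integral_rpow_mul_line hfs hξs' hf0 horth' r' (σ 1)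
    simp only [← e1] at i1
    simp only [← e2] at i2
    exact mul_right_cancel₀ hfp.ne' (i1.symm.trans i2)
  have hprop : ∀ x, τ 1 * ξ x = σ 1 * ζ x := fun x => by
    have := (e1 x).symm.trans (e2 x)
    rw [← hrr] at this
    linarith [mul_left_cancel₀ hrpos.ne' this]
  set c := τ 1 / σ 1 with hc
  have hζξ : ∀ x, ζ x = c * ξ x := fun x => by
    rw [hc, div_mul_eq_mul_div, hprop, mul_div_cancel_left₀ _ hσpos.ne']
  -- the second geodesic, parametrized by the line of the first one
  have hline : ∀ t x, f x + c * σ t * ξ x = f x + σ t * ζ x := fun t x => by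
    rw [hζξ]; ring
  have hpow : ∀ t, linePow m p f ξ (c * σ t) = linePow m p f ζ (σ t) := fun t => by
    simp only [linePow, hline]
  have hcσ := hP (Icc 0 1) c (fun t => c * σ t) hJ h0 (by simp [hσ0])
    (fun t ht x => by rw [hline]; exact hσI ht x)
    (fun t ht => by rw [hpow]; exact (hσ t ht).const_mul c) 1 h1
  have hc1 : c = 1 := by
    beta_reduce at hcσ
    rw [hc, div_mul_cancel₀ _ hσpos.ne', hPτ, ← hc] at hcσ
    linarith
  exact hγ.eqOn_of_initial hη hp hJ hn h0 h (by
    funext x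
    have := hζξ x
    rw [hc1, one_mul] at this
    exact this.symm)

/-- The second order equation of the time change, normalized by `τ(0) = 0` and `τ'(0) = 1`, has the
first integral `τ' = |p|⁻² N(τ) ^ (2 / p)`, where `N` is the function `linePow`. -/
theorem hasDerivWithinAt_of_timeChange (hp : p ≠ 0) (hJ : J.OrdConnected) (h0 : (0 : ℝ) ∈ J)
    (hf : ContMDiff (𝓡 n) 𝓘(ℝ, ℝ) ∞ f)
    (hξ : ContMDiff (𝓡 n) 𝓘(ℝ, ℝ) ∞ ξ) (hfp : ∫ x, f x ^ p ∂m = |p| ^ p) {τ : ℝ → ℝ}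
    (hI : MapsTo τ J (lineDomain f ξ)) (hd : DifferentiableOn ℝ τ J)
    (hode : ∀ t ∈ J, HasDerivWithinAt (derivWithin τ J)
      (2 * ((∫ x, (f x + τ t * ξ x) ^ (p - 1) * ξ x ∂m) / linePow m p f ξ (τ t)) *
        derivWithin τ J t ^ 2) J t)
    (hτ0 : τ 0 = 0) (hτ1 : derivWithin τ J 0 = 1) :
    ∀ t ∈ J, HasDerivWithinAt τ ((|p| ^ 2)⁻¹ * linePow m p f ξ (τ t) ^ (2 / p)) J t := by
  have hp' : 0 < |p| := abs_pos.2 hp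
  have hτ : ∀ t ∈ J, HasDerivWithinAt τ (derivWithin τ J t) J t := fun t ht =>
    (hd t ht).hasDerivWithinAt
  have hN : ∀ t ∈ J, 0 < linePow m p f ξ (τ t) := fun t ht => linePow_pos m hf hξ (hI ht) p
  have hconst : ∀ t ∈ J, derivWithin τ J t * linePow m p f ξ (τ t) ^ (-(2 / p)) =
      (|p| ^ 2)⁻¹ := by
    refine hJ.eqOn_of_hasDerivWithinAt_eq (f' := fun _ => 0) (fun t ht => ?_)
      (fun t _ => hasDerivWithinAt_const t J _) h0 ?_
    · have h1 := (hasDerivAt_linePow m hf hξ (hI ht) p).comp_hasDerivWithinAt t (hτ t ht)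
      refine ((hode t ht).mul (h1.rpow_const (p := -(2 / p)) (Or.inl (hN t ht).ne'))).congr_deriv ?_
      simp only [Function.comp_apply]
      rw [Real.rpow_sub_one (hN t ht).ne']
      have := (hN t ht).ne'
      field_simp
      ring
    · have h1 : linePow m p f ξ 0 = |p| ^ p := by simp [linePow, hfp]
      rw [hτ0, hτ1, h1, ← Real.rpow_mul hp'.le, one_mul,
        show p * -(2 / p) = -(2 : ℕ) by push_cast; field_simp, Real.rpow_neg hp'.le,
        Real.rpow_natCast]
  intro t ht
  refine (hτ t ht).congr_deriv ?_
  have h1 := hconst t ht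
  have h2 := (Real.rpow_pos_of_pos (hN t ht) (2 / p)).ne'
  rw [Real.rpow_neg (hN t ht).le] at h1
  rw [← h1]
  field_simp

theorem lineSpeed_zero {M : Type*} [MeasurableSpace M] {m : Measure M} {f ξ : M → ℝ} (hp : p ≠ 0) (hfp : ∫ x, f x ^ p ∂m = |p| ^ p) :
    (|p| ^ 2)⁻¹ * linePow m p f ξ 0 ^ (2 / p) = 1 := by
  have hp' : 0 < |p| := abs_pos.2 hp
  have h1 : linePow m p f ξ 0 = |p| ^ p := by simp [linePow, hfp]
  rw [h1, ← Real.rpow_mul hp'.le, mul_div_cancel₀ _ hp, Real.rpow_two,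
    inv_mul_cancel₀ (pow_pos hp' 2).ne']

theorem timeChange_of_hasDerivWithinAt (hp : p ≠ 0) (hJ : UniqueDiffOn ℝ J)
    (h0 : (0 : ℝ) ∈ J) (hf : ContMDiff (𝓡 n) 𝓘(ℝ, ℝ) ∞ f)
    (hξ : ContMDiff (𝓡 n) 𝓘(ℝ, ℝ) ∞ ξ) (hfp : ∫ x, f x ^ p ∂m = |p| ^ p) {τ : ℝ → ℝ}
    (hI : MapsTo τ J (lineDomain f ξ)) (hτ0 : τ 0 = 0)
    (hτ : ∀ t ∈ J, HasDerivWithinAt τ ((|p| ^ 2)⁻¹ * linePow m p f ξ (τ t) ^ (2 / p)) J t) :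
    (∀ t ∈ J, HasDerivWithinAt (derivWithin τ J)
      (2 * ((∫ x, (f x + τ t * ξ x) ^ (p - 1) * ξ x ∂m) / linePow m p f ξ (τ t)) *
        derivWithin τ J t ^ 2) J t) ∧ derivWithin τ J 0 = 1 := by
  have hτ' : ∀ t ∈ J, derivWithin τ J t = (|p| ^ 2)⁻¹ * linePow m p f ξ (τ t) ^ (2 / p) :=
    fun t ht => (hτ t ht).derivWithin (hJ t ht)
  have hN : ∀ t ∈ J, 0 < linePow m p f ξ (τ t) := fun t ht => linePow_pos m hf hξ (hI ht) p
  refine ⟨fun t ht => ?_, ?_⟩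
  · have h1 := (hasDerivAt_linePow m hf hξ (hI ht) p).comp_hasDerivWithinAt t (hτ t ht)
    have h2 := (h1.rpow_const (p := 2 / p) (Or.inl (hN t ht).ne')).const_mul (|p| ^ 2)⁻¹
    refine (h2.congr_of_mem hτ' ht).congr_deriv ?_
    simp only [Function.comp_apply]
    rw [hτ' t ht, Real.rpow_sub_one (hN t ht).ne']
    have := (hN t ht).ne'
    field_simp
  · rw [hτ' 0 h0, hτ0, lineSpeed_zero hp hfp]

/-- The geodesic along the line `f + τ ξ` starts with velocity `ξ` if `ξ` is tangent. -/
theorem fnVelocity_line_zero (hp : p ≠ 0) (hJ : UniqueDiffOn ℝ J)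
    (h0 : (0 : ℝ) ∈ J) (hf : ContMDiff (𝓡 n) 𝓘(ℝ, ℝ) ∞ f)
    (hξ : ContMDiff (𝓡 n) 𝓘(ℝ, ℝ) ∞ ξ) (hf0 : ∀ x, 0 < f x) (hfp : ∫ x, f x ^ p ∂m = |p| ^ p)
    (horth : ∫ x, f x ^ (p - 1) * ξ x ∂m = 0) {τ : ℝ → ℝ} (hτ0 : τ 0 = 0)
    (hτ : HasDerivWithinAt τ ((|p| ^ 2)⁻¹ * linePow m p f ξ (τ 0) ^ (2 / p)) J 0) :
    fnVelocity (fun t x => |p| * ((f x + τ t * ξ x) / linePow m p f ξ (τ t) ^ p⁻¹)) J 0 = ξ := by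
  have hp' : 0 < |p| := abs_pos.2 hp
  have h00 := zero_mem_lineDomain (ξ := ξ) hf0
  have hN0 : linePow m p f ξ 0 = |p| ^ p := by simp [linePow, hfp]
  have hN0' : linePow m p f ξ 0 ^ p⁻¹ = |p| := by
    rw [hN0, Real.rpow_rpow_inv hp'.le hp]
  rw [hτ0, lineSpeed_zero hp hfp] at hτ
  funext x
  have h1 := hasDerivAt_linePow m hf hξ h00 p
  rw [show (∫ x, (f x + 0 * ξ x) ^ (p - 1) * ξ x ∂m) = 0 by simpa using horth, mul_zero, ← hτ0] at h1
  have h2 := h1.comp_hasDerivWithinAt (0 : ℝ) hτ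
  have h3 := h2.rpow_const (p := p⁻¹) (Or.inl (by
    simp only [Function.comp_apply, hτ0]
    exact (linePow_pos m hf hξ h00 p).ne'))
  have h4 := ((((hτ.mul_const (ξ x)).const_add (f x)).div h3 (by
    simp only [Function.comp_apply]
    rw [hτ0, hN0']
    exact hp'.ne')).const_mul |p|)
  refine (h4.derivWithin (hJ 0 h0)).trans ?_
  simp only [Function.comp_apply, hτ0, hN0']
  have := hp'.ne'
  field_simp
  ring

end Uniqueness

/-! ### Exponential geodesics -/

section Exponential

variable {n : ℕ} {M : Type*} [TopologicalSpace M] [CompactSpace M]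
  [ChartedSpace (EuclideanSpace ℝ (Fin n)) M] [IsManifold (𝓡 n) ∞ M]
  [MeasurableSpace M] [BorelSpace M] {m : Measure M} [IsProbabilityMeasure m] {J : Set ℝ}

/-- The logarithm of the density of a `1`-geodesic has constant acceleration on `M`, so that it is
affine in time up to constants. -/
theorem IsDensityGeodesic.exists_affine {u : ℝ → M → ℝ} (h : IsDensityGeodesic n m 1 J u)
    (hJ : J.OrdConnected) (hn : J.Nontrivial) :
    ∃ g h : M → ℝ, (ContMDiff (𝓡 n) 𝓘(ℝ, ℝ) ∞ g ∧ ∫ x, g x ∂m = 0) ∧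
      (ContMDiff (𝓡 n) 𝓘(ℝ, ℝ) ∞ h ∧ ∫ x, h x ∂m = 0) ∧
      ∀ t ∈ J, ∀ x, Real.log (u t x) - ∫ z, Real.log (u t z) ∂m = g x + t * h x := by
  obtain ⟨hs, hS, hφ⟩ := h
  have hu := hJ.uniqueDiffOn hn
  have hv := hs.fnVelocity hu
  have hl : IsSmoothFnCurve (n := n) J (fun t x => Real.log (u t x)) :=
    hs.comp fun t ht x => Real.contDiffAt_log.2 ((hS t ht).1 x).ne'
  have hl1 : ∀ t ∈ J, ∀ x, HasDerivWithinAt (fun t => Real.log (u t x))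
      (fnVelocity u J t x / u t x) J t := fun t ht x =>
    (hs.hasDerivWithinAt ht x).log ((hS t ht).1 x).ne'
  choose! φ hφ using hφ
  have hl2 : ∀ t ∈ J, ∀ x, HasDerivWithinAt (fun t => fnVelocity u J t x / u t x) (φ t) J t :=
    fun t ht x => by
      refine ((hv.hasDerivWithinAt ht x).div (hs.hasDerivWithinAt ht x)
        ((hS t ht).1 x).ne').congr_deriv ?_
      rw [hφ t ht]
      have := ((hS t ht).1 x).ne'
      field_simp
      ring
  have hlv : ∀ t ∈ J, fnVelocity (fun t x => Real.log (u t x)) J t =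
      fun x => fnVelocity u J t x / u t x := fun t ht => fnVelocity_eq hu hl1 ht
  have hlv2 : ∀ t ∈ J, fnVelocity (fnVelocity (fun t x => Real.log (u t x)) J) J t =
      fun _ => φ t := fun t ht => fnVelocity_fnVelocity_eq hu hl1 hl2 ht
  have hi1 : ∀ t ∈ J, HasDerivWithinAt (fun t => ∫ z, Real.log (u t z) ∂m)
      (∫ z, fnVelocity (fun t x => Real.log (u t x)) J t z ∂m) J t := fun t ht =>
    hl.hasDerivWithinAt_integral m hJ hn ht
  have hi2 : ∀ t ∈ J, HasDerivWithinAt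
      (fun t => ∫ z, fnVelocity (fun t x => Real.log (u t x)) J t z ∂m) (φ t) J t := fun t ht => by
    have h1 := (hl.fnVelocity hu).hasDerivWithinAt_integral m hJ hn ht
    rw [hlv2 t ht] at h1
    simpa using h1
  obtain ⟨t₀, h₀⟩ := hn.nonempty
  set l := fun t x => Real.log (u t x) with hldef
  have hcl := hl.contMDiff h₀
  have hcv := (hl.fnVelocity hu).contMDiff h₀
  have hint : ∀ {k : M → ℝ}, Continuous k → Integrable k m := fun hk =>
    hk.integrable_of_compactSpace m
  have zero_mean : ∀ {k : M → ℝ}, Continuous k → ∫ x, (k x - ∫ z, k z ∂m) ∂m = 0 := fun hk => by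
    rw [integral_sub (hint hk) (integrable_const _)]
    simp
  set h := fun x => fnVelocity l J t₀ x - ∫ z, fnVelocity l J t₀ z ∂m with hh
  have hhs : ContMDiff (𝓡 n) 𝓘(ℝ, ℝ) ∞ h := hcv.sub contMDiff_const
  have hhm : ∫ x, h x ∂m = 0 := zero_mean hcv.continuous
  have hws : ContMDiff (𝓡 n) 𝓘(ℝ, ℝ) ∞ fun x => l t₀ x - ∫ z, l t₀ z ∂m :=
    hcl.sub contMDiff_const
  refine ⟨fun x => (l t₀ x - ∫ z, l t₀ z ∂m) - t₀ * h x, h, ⟨hws.sub (contMDiff_const.mul hhs), ?_⟩,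
    ⟨hhs, hhm⟩, fun t ht x => ?_⟩
  · rw [integral_sub (hint hws.continuous) (hint (hhs.continuous.const_mul t₀)),
      integral_const_mul, hhm, zero_mean hcl.continuous]
    simp
  · have hvel : ∀ t ∈ J, fnVelocity l J t x - ∫ z, fnVelocity l J t z ∂m = h x := by
      refine hJ.eqOn_of_hasDerivWithinAt_eq (f' := fun _ => 0) (fun t ht => ?_)
        (fun t _ => hasDerivWithinAt_const t J (h x)) h₀ rfl
      refine (((hl.fnVelocity hu).hasDerivWithinAt ht x).sub (hi2 t ht)).congr_deriv ?_
      rw [hlv2 t ht, sub_self]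
    have h1 : l t x - ∫ z, l t z ∂m = (l t₀ x - ∫ z, l t₀ z ∂m) - t₀ * h x + t * h x := by
      refine hJ.eqOn_of_hasDerivWithinAt_eq (f := fun t => l t x - ∫ z, l t z ∂m)
        (g := fun t => (l t₀ x - ∫ z, l t₀ z ∂m) - t₀ * h x + t * h x)
        (f' := fun _ => h x) (fun t ht => ?_) (fun t _ => ?_) h₀ (by ring) ht
      · exact ((hl.hasDerivWithinAt ht x).sub (hi1 t ht)).congr_deriv (hvel t ht)
      · simpa using ((hasDerivWithinAt_id t J).mul_const (h x)).const_add
          ((l t₀ x - ∫ z, l t₀ z ∂m) - t₀ * h x)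
    exact h1

/-- The probability density proportional to `exp k`. -/
noncomputable def expDensity (m : Measure M) (k : M → ℝ) (x : M) : ℝ :=
  Real.exp (k x - Real.log (∫ z, Real.exp (k z) ∂m))

section

omit [ChartedSpace (EuclideanSpace ℝ (Fin n)) M] [IsManifold (𝓡 n) ∞ M]

theorem integral_exp_pos {k : M → ℝ} (hk : Continuous k) : 0 < ∫ z, Real.exp (k z) ∂m :=
  integral_pos_of_pos m (Real.continuous_exp.comp hk) fun _ => Real.exp_pos _

theorem eq_expDensity {u k : M → ℝ} (hpos : ∀ x, 0 < u x) (hk : Continuous k)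
    (hu : ∫ x, u x ∂m = 1) {c : ℝ} (h : ∀ x, Real.log (u x) - c = k x) : u = expDensity m k := by
  have hZ := integral_exp_pos (m := m) hk
  have h1 : ∀ z, u z = Real.exp c * Real.exp (k z) := fun z => by
    rw [← Real.exp_add, ← h z, add_sub_cancel, Real.exp_log (hpos z)]
  have h2 : Real.exp c * ∫ z, Real.exp (k z) ∂m = 1 := by
    rw [← integral_const_mul, ← hu]
    simp only [h1]
  funext x
  rw [h1, expDensity, Real.exp_sub, Real.exp_log hZ, eq_div_iff hZ.ne']
  linear_combination Real.exp (k x) * h2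

theorem integral_expDensity {k : M → ℝ} (hk : Continuous k) : ∫ x, expDensity m k x ∂m = 1 := by
  have hZ := integral_exp_pos (m := m) hk
  simp only [expDensity, Real.exp_sub, Real.exp_log hZ, integral_div]
  exact div_self hZ.ne'

theorem log_expDensity {k : M → ℝ} (hk : Continuous k) (h0 : ∫ x, k x ∂m = 0) (x : M) :
    Real.log (expDensity m k x) - ∫ z, Real.log (expDensity m k z) ∂m = k x := by
  simp only [expDensity, Real.log_exp]
  rw [integral_sub (hk.integrable_of_compactSpace m) (integrable_const _), h0]
  simp

end

omit [CompactSpace M] [IsManifold (𝓡 n) ∞ M] [BorelSpace M] [IsProbabilityMeasure m] in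
theorem contMDiff_expDensity {k : M → ℝ} (hk : ContMDiff (𝓡 n) 𝓘(ℝ, ℝ) ∞ k) :
    ContMDiff (𝓡 n) 𝓘(ℝ, ℝ) ∞ (expDensity m k) :=
  Real.contDiff_exp.comp_contMDiff (hk.sub contMDiff_const)

/-- Up to its mean, the logarithmic velocity of an exponential curve is the direction of the line
of logarithms. -/
theorem velocity_div_sub_integral {u : ℝ → M → ℝ} (hJ : J.OrdConnected) (hn : J.Nontrivial)
    (hs : IsSmoothFnCurve (n := n) J u) (hpos : ∀ t ∈ J, ∀ x, 0 < u t x) {g h : M → ℝ}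
    (hgh : ∀ t ∈ J, ∀ x, Real.log (u t x) - ∫ z, Real.log (u t z) ∂m = g x + t * h x)
    {t : ℝ} (ht : t ∈ J) (x : M) :
    fnVelocity u J t x / u t x - ∫ z, fnVelocity u J t z / u t z ∂m = h x := by
  have hu := hJ.uniqueDiffOn hn
  have hl : IsSmoothFnCurve (n := n) J (fun t x => Real.log (u t x)) :=
    hs.comp fun t ht x => Real.contDiffAt_log.2 (hpos t ht x).ne'
  have hl1 : ∀ t ∈ J, ∀ x, HasDerivWithinAt (fun t => Real.log (u t x))
      (fnVelocity u J t x / u t x) J t := fun t ht x =>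
    (hs.hasDerivWithinAt ht x).log (hpos t ht x).ne'
  have h1 := hl.hasDerivWithinAt_integral m hJ hn ht
  rw [fnVelocity_eq hu (γ₁ := fun t x => fnVelocity u J t x / u t x) hl1 ht] at h1
  have h2 : HasDerivWithinAt (fun t => g x + t * h x) (h x) J t := by
    simpa using ((hasDerivWithinAt_id t J).mul_const (h x)).const_add (g x)
  exact (hu t ht).eq_deriv J ((hl1 t ht x).sub h1)
    (h2.congr_of_mem (fun t ht => hgh t ht x) ht)

theorem isDensityGeodesic_one_of_affine {u : ℝ → M → ℝ} (hJ : J.OrdConnected) (hn : J.Nontrivial)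
    (hS : ∀ t ∈ J, (∀ x, 0 < u t x) ∧ ∫ x, u t x ∂m = 1) {g h : M → ℝ}
    (hg : ContMDiff (𝓡 n) 𝓘(ℝ, ℝ) ∞ g) (hh : ContMDiff (𝓡 n) 𝓘(ℝ, ℝ) ∞ h)
    (hgh : ∀ t ∈ J, ∀ x, Real.log (u t x) - ∫ z, Real.log (u t z) ∂m = g x + t * h x) :
    IsDensityGeodesic n m 1 J u := by
  have hu := hJ.uniqueDiffOn hn
  have hk : IsSmoothFnCurve (n := n) J (fun t x => g x + t * h x) :=
    isSmoothFnCurve_line hg hh contDiffOn_id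
  have hek : IsSmoothFnCurve (n := n) J (fun t x => Real.exp (g x + t * h x)) :=
    hk.comp fun t ht x => Real.contDiff_exp.contDiffAt
  set ζ : ℝ → ℝ := fun t => Real.log (∫ z, Real.exp (g z + t * h z) ∂m) with hζdef
  have hζ : ContDiffOn ℝ ∞ ζ J := (hek.contDiffOn_integral m hJ hn).log fun t ht =>
    (integral_pos_of_pos m (hek.continuous ht) fun z => Real.exp_pos _).ne'
  have hexp : ∀ t ∈ J, ∀ x, u t x = Real.exp (g x + t * h x - ζ t) := fun t ht =>
    congrFun (eq_expDensity (hS t ht).1 (hk.continuous ht) (hS t ht).2 (hgh t ht))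
  have hus : IsSmoothFnCurve (n := n) J u :=
    (hek.mul (isSmoothFnCurve_time (r := fun t => Real.exp (-ζ t)) hζ.neg.exp)).congr
      fun t ht x => by rw [hexp t ht, ← Real.exp_add, ← sub_eq_add_neg]
  have hζ1 : ∀ t ∈ J, HasDerivWithinAt ζ (derivWithin ζ J t) J t := fun t ht =>
    (hζ.differentiableOn (by simp) t ht).hasDerivWithinAt
  have hζ2 : ∀ t ∈ J, HasDerivWithinAt (derivWithin ζ J) (derivWithin (derivWithin ζ J) J t) J t :=
    fun t ht => (((contDiffOn_infty_iff_derivWithin hu).1 hζ).2.differentiableOn (by simp) t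
      ht).hasDerivWithinAt
  have h1 : ∀ t ∈ J, ∀ x, HasDerivWithinAt (fun t => u t x)
      (u t x * (h x - derivWithin ζ J t)) J t := fun t ht x => by
    have h0 := (((((hasDerivWithinAt_id t J).mul_const (h x)).const_add (g x)).sub
      (hζ1 t ht)).exp).congr_of_mem (fun t ht => hexp t ht x) ht
    refine h0.congr_deriv ?_
    rw [hexp t ht]
    simp
  have h2 : ∀ t ∈ J, ∀ x, HasDerivWithinAt (fun t => u t x * (h x - derivWithin ζ J t))
      (u t x * (h x - derivWithin ζ J t) * (h x - derivWithin ζ J t) +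
        u t x * (-derivWithin (derivWithin ζ J) J t)) J t := fun t ht x =>
    (h1 t ht x).mul ((hζ2 t ht).const_sub (h x))
  refine ⟨hus, hS, fun t ht => ⟨-derivWithin (derivWithin ζ J) J t, fun x => ?_⟩⟩
  rw [fnVelocity_fnVelocity_eq hu h1 h2 ht, fnVelocity_eq hu h1 ht]
  have := ((hS t ht).1 x).ne'
  field_simp
  ring

end Exponential

/-! ### From forms to densities -/

theorem IsCentralGeodesic.congr {n : ℕ} {M : Type*} [TopologicalSpace M]
    [ChartedSpace (EuclideanSpace ℝ (Fin n)) M] [MeasurableSpace M] {m : Measure M} {p : ℝ}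
    {J : Set ℝ} {γ η : ℝ → M → ℝ} (h : IsCentralGeodesic n m p J γ) (he : EqOn η γ J) :
    IsCentralGeodesic n m p J η := by
  have h1 : EqOn (fnVelocity η J) (fnVelocity γ J) J := fun t ht => funext fun x =>
    derivWithin_congr (fun s hs => congrFun (he hs) x) (congrFun (he ht) x)
  have h2 : EqOn (fnVelocity (fnVelocity η J) J) (fnVelocity (fnVelocity γ J) J) J :=
    fun t ht => funext fun x =>
      derivWithin_congr (fun s hs => congrFun (h1 hs) x) (congrFun (h1 ht) x)
  refine ⟨h.1.congr fun t ht x => congrFun (he ht) x, fun t ht => ?_, fun t ht => ?_⟩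
  · rw [he ht]
    exact h.2.1 t ht
  · rw [h2 ht, he ht]
    exact h.2.2 t ht

namespace OrientedAtlas

variable {n : ℕ} {M : Type*} [TopologicalSpace M] [T2Space M] [CompactSpace M]
  [ChartedSpace (EuclideanSpace ℝ (Fin n)) M] [IsManifold (𝓡 n) ∞ M]

theorem exists_probabilityMeasure [MeasurableSpace M] [BorelSpace M] (O : OrientedAtlas n M)
    {lam : TopForm n M} (hl : lam ∈ O.prob) :
    ∃ m : Measure M, IsProbabilityMeasure m ∧
      ∀ g : M → ℝ, Continuous g → O.integralFn lam g = ∫ x, g x ∂m := by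
  obtain ⟨m, hm, h⟩ := O.exists_measure hl.1
  refine ⟨m, ⟨?_⟩, h⟩
  have h1 := h (fun _ => 1) continuous_const
  have h2 : TopForm.mulFn (fun _ : M => (1 : ℝ)) lam = lam := funext fun x => one_smul ℝ (lam x)
  rw [integralFn, h2, hl.2, integral_const, smul_eq_mul, mul_one] at h1
  exact (ENNReal.toReal_eq_one_iff _).1 h1.symm

variable [MeasurableSpace M] [BorelSpace M] {O : OrientedAtlas n M} {lam : TopForm n M}
  {m : Measure M} {J : Set ℝ} {α p : ℝ}

section

variable (hl : lam ∈ O.prob) (hm : ∀ g : M → ℝ, Continuous g → O.integralFn lam g = ∫ x, g x ∂m)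

include hl hm

omit [BorelSpace M] in
theorem mulFn_mem_prob_iff {u : M → ℝ} : TopForm.mulFn u lam ∈ O.prob ↔
    ContMDiff (𝓡 n) 𝓘(ℝ, ℝ) ∞ u ∧ (∀ x, 0 < u x) ∧ ∫ x, u x ∂m = 1 := by
  rw [prob, mem_ofPred_eq, mulFn_mem_dens_iff hl.1, and_assoc]
  refine and_congr_right fun h => and_congr_right fun _ => ?_
  rw [← hm u h.continuous, integralFn]

omit [BorelSpace M] in
theorem mem_prob_iff {μ : TopForm n M} : μ ∈ O.prob ↔
    ContMDiff (𝓡 n) 𝓘(ℝ, ℝ) ∞ (TopForm.rn μ lam) ∧ (∀ x, 0 < TopForm.rn μ lam x) ∧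
      ∫ x, TopForm.rn μ lam x ∂m = 1 := by
  rw [← mulFn_mem_prob_iff hl hm, TopForm.mulFn_rn (ne_zero_of_mem_dens hl.1)]

omit [BorelSpace M] in
theorem mem_tangentProb_iff {a : TopForm n M} : a ∈ O.tangentProb ↔
    ContMDiff (𝓡 n) 𝓘(ℝ, ℝ) ∞ (TopForm.rn a lam) ∧ ∫ x, TopForm.rn a lam x ∂m = 0 := by
  have h0 := ne_zero_of_mem_dens hl.1
  conv_lhs => rw [← TopForm.mulFn_rn h0 a]
  rw [tangentProb, mem_ofPred_eq, TopForm.isSmooth_mulFn_iff h0 hl.1.1]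
  refine and_congr_right fun h => ?_
  rw [← hm _ h.continuous, integralFn]

end

/-- The derivative of a curve in the line spanned by a form. -/
theorem derivWithin_eq_smul {J : Set ℝ} (hJ : UniqueDiffOn ℝ J)
    {F : ℝ → EuclideanSpace ℝ (Fin n) [⋀^Fin n]→L[ℝ] ℝ}
    {w : EuclideanSpace ℝ (Fin n) [⋀^Fin n]→L[ℝ] ℝ} {g : ℝ → ℝ} {g' t : ℝ}
    (hF : ∀ s ∈ J, F s = g s • w) (hg : HasDerivWithinAt g g' J t) (ht : t ∈ J) :
    derivWithin F J t = g' • w :=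
  ((hg.smul_const w).congr_of_mem hF ht).derivWithin (hJ t ht)

omit [T2Space M] [CompactSpace M] [IsManifold (𝓡 n) ∞ M] [MeasurableSpace M] [BorelSpace M] in
theorem velocity_mulFn {u : ℝ → M → ℝ} (hJ : UniqueDiffOn ℝ J)
    (hu : IsSmoothFnCurve (n := n) J u) {t : ℝ} (ht : t ∈ J) :
    TopForm.velocity (fun t => TopForm.mulFn (u t) lam) J t =
      TopForm.mulFn (fnVelocity u J t) lam := by
  funext x
  exact derivWithin_eq_smul hJ (fun s _ => rfl) (hu.hasDerivWithinAt ht x) ht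

omit [T2Space M] [CompactSpace M] [MeasurableSpace M] [BorelSpace M] in
theorem velocity_velocity_mulFn {u : ℝ → M → ℝ} (hJ : UniqueDiffOn ℝ J)
    (hu : IsSmoothFnCurve (n := n) J u) {t : ℝ} (ht : t ∈ J) :
    TopForm.velocity (TopForm.velocity (fun t => TopForm.mulFn (u t) lam) J) J t =
      TopForm.mulFn (fnVelocity (fnVelocity u J) J t) lam := by
  funext x
  exact derivWithin_eq_smul hJ (fun s hs => congrFun (velocity_mulFn hJ hu hs) x)
    ((hu.fnVelocity hJ).hasDerivWithinAt ht x) ht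

/-- Integrating the equation with an unspecified multiplier shows that the multiplier is the one of
the `α`-connection, because the total mass is constant. -/
theorem isAlphaGeodesic_mulFn_iff [IsProbabilityMeasure m] (hl : lam ∈ O.prob)
    (hm : ∀ g : M → ℝ, Continuous g → O.integralFn lam g = ∫ x, g x ∂m)
    (hJ : J.OrdConnected) (hn : J.Nontrivial) {u : ℝ → M → ℝ} :
    O.IsAlphaGeodesic α J (fun t => TopForm.mulFn (u t) lam) ↔ IsDensityGeodesic n m α J u := by
  have hu := hJ.uniqueDiffOn hn
  have h0 := ne_zero_of_mem_dens hl.1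
  rw [IsAlphaGeodesic, IsDensityGeodesic, TopForm.isSmoothCurve_mulFn_iff h0 hl.1.1]
  refine and_congr_right fun hs => ?_
  have hv := hs.fnVelocity hu
  have hprob : (∀ t ∈ J, TopForm.mulFn (u t) lam ∈ O.prob) ↔
      ∀ t ∈ J, (∀ x, 0 < u t x) ∧ ∫ x, u t x ∂m = 1 :=
    forall₂_congr fun t ht => by
      rw [mulFn_mem_prob_iff hl hm]
      exact and_iff_right (hs.contMDiff ht)
  rw [hprob]
  refine and_congr_right fun hS => forall₂_congr fun t ht => ?_
  have hpos := (hS t ht).1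
  have hcu := hs.continuous ht
  have hcv := hv.continuous ht
  have hcq : Continuous fun x => fnVelocity u J t x ^ 2 / u t x :=
    (hcv.pow 2).div hcu fun x => (hpos x).ne'
  set G := ∫ x, fnVelocity u J t x ^ 2 / u t x ∂m with hG
  have hconn : O.alphaConnection α (TopForm.mulFn (u t) lam)
      (TopForm.velocity (fun t => TopForm.mulFn (u t) lam) J t)
      (TopForm.velocity (fun t => TopForm.mulFn (u t) lam) J t)
      (TopForm.velocity (TopForm.velocity (fun t => TopForm.mulFn (u t) lam) J) J t) =
      TopForm.mulFn (fun x => fnVelocity (fnVelocity u J) J t x -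
        (1 + α) / 2 * (fnVelocity u J t x ^ 2 / u t x - G * u t x)) lam := by
    rw [velocity_mulFn hu hs ht, velocity_velocity_mulFn hu hs ht, alphaConnection]
    have hint : O.integral (TopForm.mulFn (fun x =>
        TopForm.rn (TopForm.mulFn (fnVelocity u J t) lam) (TopForm.mulFn (u t) lam) x *
        TopForm.rn (TopForm.mulFn (fnVelocity u J t) lam) (TopForm.mulFn (u t) lam) x)
        (TopForm.mulFn (u t) lam)) = G := by
      rw [hG, ← hm _ hcq, integralFn]
      congr 1
      funext x
      simp only [TopForm.mulFn, smul_smul]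
      congr 1
      have h1 := TopForm.rn_mulFn_mulFn h0 (fnVelocity u J t) (u t) x
      have h2 := (hpos x).ne'
      rw [h1]
      field_simp
    rw [hint]
    funext x
    have h1 := TopForm.rn_mulFn_mulFn h0 (fnVelocity u J t) (u t) x
    ext v
    change fnVelocity (fnVelocity u J) J t x * lam x v - ((1 + α) / 2) *
      (TopForm.rn (TopForm.mulFn (fnVelocity u J t) lam) (TopForm.mulFn (u t) lam) x *
        (fnVelocity u J t x * lam x v) - G * (u t x * lam x v)) =
      (fnVelocity (fnVelocity u J) J t x -
        (1 + α) / 2 * (fnVelocity u J t x ^ 2 / u t x - G * u t x)) * lam x v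
    rw [h1]
    ring
  have hzero : (0 : TopForm n M) = TopForm.mulFn (fun _ => 0) lam :=
    funext fun x => (zero_smul ℝ (lam x)).symm
  rw [hconn, hzero, (TopForm.mulFn_injective h0).eq_iff, funext_iff]
  constructor
  · intro h
    refine ⟨-((1 + α) / 2 * G), fun x => ?_⟩
    linear_combination h x
  · rintro ⟨φ, hφ⟩
    have i0 : ∀ t ∈ J, ∫ x, fnVelocity u J t x ∂m = 0 := fun t ht =>
      (hu t ht).eq_deriv J (hs.hasDerivWithinAt_integral m hJ hn ht)
        ((hasDerivWithinAt_const t J (1 : ℝ)).congr_of_mem (fun t ht => (hS t ht).2) ht)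
    have i1 : ∫ x, fnVelocity (fnVelocity u J) J t x ∂m = 0 :=
      (hu t ht).eq_deriv J (hv.hasDerivWithinAt_integral m hJ hn ht)
        ((hasDerivWithinAt_const t J (0 : ℝ)).congr_of_mem i0 ht)
    simp only [hφ] at i1
    rw [integral_add ((hcq.const_mul _).integrable_of_compactSpace m)
      ((hcu.const_mul φ).integrable_of_compactSpace m), integral_const_mul, integral_const_mul,
      (hS t ht).2, ← hG] at i1
    intro x
    linear_combination hφ x + u t x * i1

theorem isAlphaGeodesic_iff [IsProbabilityMeasure m] (hl : lam ∈ O.prob)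
    (hm : ∀ g : M → ℝ, Continuous g → O.integralFn lam g = ∫ x, g x ∂m)
    (hJ : J.OrdConnected) (hn : J.Nontrivial) {μ : ℝ → TopForm n M} :
    O.IsAlphaGeodesic α J μ ↔ IsDensityGeodesic n m α J (fun t => TopForm.rn (μ t) lam) := by
  rw [← isAlphaGeodesic_mulFn_iff hl hm hJ hn]
  simp only [TopForm.mulFn_rn (ne_zero_of_mem_dens hl.1)]

/-! ### The power maps -/

section Power

omit [T2Space M] [CompactSpace M] [IsManifold (𝓡 n) ∞ M] [MeasurableSpace M] [BorelSpace M]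

theorem param_ne_zero (hα : α ≠ 1) (hp : p = 2 / (1 - α)) : p ≠ 0 := by
  rw [hp]
  exact div_ne_zero two_ne_zero (sub_ne_zero.2 hα.symm)

theorem abs_param (hp : p = 2 / (1 - α)) : 2 / |1 - α| = |p| := by
  rw [hp, abs_div, abs_two]

theorem abs_param_inv (hp : p = 2 / (1 - α)) : |1 - α| / 2 = |p|⁻¹ := by
  rw [← abs_param hp, inv_div]

theorem param_inv (hp : p = 2 / (1 - α)) : (1 - α) / 2 = p⁻¹ := by
  rw [hp, inv_div]

theorem param_sub_one (hα : α ≠ 1) (hp : p = 2 / (1 - α)) : (1 + α) / (1 - α) = p - 1 := by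
  have : 1 - α ≠ 0 := sub_ne_zero.2 hα.symm
  rw [hp]
  field_simp
  ring

theorem eq_one_sub (hα : α ≠ 1) (hp : p = 2 / (1 - α)) : α = 1 - 2 / p := by
  have : 1 - α ≠ 0 := sub_ne_zero.2 hα.symm
  rw [hp]
  field_simp
  ring

theorem Phi_eq (hp : p = 2 / (1 - α)) (μ : TopForm n M) :
    Phi lam α μ = fun x => |p| * TopForm.rn μ lam x ^ p⁻¹ := by
  rw [← abs_param hp, ← param_inv hp]
  rfl

theorem PhiInv_eq (hp : p = 2 / (1 - α)) (f : M → ℝ) :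
    PhiInv lam α f = TopForm.mulFn (fun x => (|p|⁻¹ * f x) ^ p) lam := by
  rw [← abs_param_inv hp, hp]
  rfl

end Power

section

variable [IsProbabilityMeasure m] (hl : lam ∈ O.prob)
  (hm : ∀ g : M → ℝ, Continuous g → O.integralFn lam g = ∫ x, g x ∂m)
  (hα : α ≠ 1) (hp : p = 2 / (1 - α))

include hm hp in
omit [IsProbabilityMeasure m] [BorelSpace M] in
theorem mem_sphere_iff {f : M → ℝ} : f ∈ O.sphere lam α ↔
    ContMDiff (𝓡 n) 𝓘(ℝ, ℝ) ∞ f ∧ (∀ x, 0 < f x) ∧ ∫ x, f x ^ p ∂m = |p| ^ p := by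
  rw [sphere, mem_ofPred_eq]
  refine and_congr_right fun h => and_congr_right fun hpos => ?_
  rw [abs_param hp, ← hp, hm _ (h.rpow_const_of_pos hpos p).continuous]

include hl hα hp in
omit [MeasurableSpace M] [BorelSpace M] in
theorem Phi_PhiInv {f : M → ℝ} (hf : ∀ x, 0 < f x) : Phi lam α (PhiInv lam α f) = f := by
  have hp0 := param_ne_zero hα hp
  have hp' := abs_pos.2 hp0
  rw [Phi_eq hp, PhiInv_eq hp, TopForm.rn_mulFn (ne_zero_of_mem_dens hl.1)]
  funext x
  rw [Real.rpow_rpow_inv (mul_pos (inv_pos.2 hp') (hf x)).le hp0, mul_inv_cancel_left₀ hp'.ne']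

include hl hα hp in
omit [MeasurableSpace M] [BorelSpace M] in
theorem PhiInv_Phi {μ : TopForm n M} (hμ : ∀ x, 0 < TopForm.rn μ lam x) :
    PhiInv lam α (Phi lam α μ) = μ := by
  have hp0 := param_ne_zero hα hp
  have hp' := abs_pos.2 hp0
  rw [PhiInv_eq hp, Phi_eq hp]
  conv_rhs => rw [← TopForm.mulFn_rn (ne_zero_of_mem_dens hl.1) μ]
  congr 1
  funext x
  rw [inv_mul_cancel_left₀ hp'.ne', Real.rpow_inv_rpow (hμ x).le hp0]

include hl hm hα hp

omit [IsProbabilityMeasure m] [BorelSpace M] in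
theorem Phi_mem_sphere {μ : TopForm n M} (hμ : μ ∈ O.prob) : Phi lam α μ ∈ O.sphere lam α := by
  have hp0 := param_ne_zero hα hp
  obtain ⟨h1, h2, h3⟩ := (mem_prob_iff hl hm).1 hμ
  rw [mem_sphere_iff hm hp, Phi_eq hp]
  refine ⟨contMDiff_const.mul (h1.rpow_const_of_pos h2 _),
    fun x => mul_pos (abs_pos.2 hp0) (Real.rpow_pos_of_pos (h2 x) _), ?_⟩
  simp only [abs_mul_rpow_inv_rpow hp0 (h2 _), integral_const_mul, h3, mul_one]

omit [IsProbabilityMeasure m] [BorelSpace M] in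
theorem PhiInv_mem_prob {f : M → ℝ} (hf : f ∈ O.sphere lam α) : PhiInv lam α f ∈ O.prob := by
  have hp' := abs_pos.2 (param_ne_zero hα hp)
  obtain ⟨h1, h2, h3⟩ := (mem_sphere_iff hm hp).1 hf
  have h4 : ∀ x, 0 < |p|⁻¹ * f x := fun x => mul_pos (inv_pos.2 hp') (h2 x)
  rw [PhiInv_eq hp, mulFn_mem_prob_iff hl hm]
  refine ⟨(contMDiff_const.mul h1).rpow_const_of_pos h4 p,
    fun x => Real.rpow_pos_of_pos (h4 x) p, ?_⟩
  simp only [Real.mul_rpow (inv_pos.2 hp').le (h2 _).le, integral_const_mul, h3,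
    Real.inv_rpow hp'.le]
  exact inv_mul_cancel₀ (Real.rpow_pos_of_pos hp' p).ne'

omit [IsProbabilityMeasure m] [BorelSpace M] in
theorem invOn_PhiInv : InvOn (PhiInv lam α) (Phi lam α) O.prob (O.sphere lam α) :=
  ⟨fun _ hμ => PhiInv_Phi hl hα hp ((mem_prob_iff hl hm).1 hμ).2.1,
    fun _ hf => Phi_PhiInv hl hα hp ((mem_sphere_iff hm hp).1 hf).2.1⟩

theorem isAlphaGeodesic_iff_central (hJ : J.OrdConnected) (hn : J.Nontrivial)
    {μ : ℝ → TopForm n M} : O.IsAlphaGeodesic α J μ ↔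
      (∀ t ∈ J, μ t ∈ O.prob) ∧ IsCentralGeodesic n m p J (fun t => Phi lam α (μ t)) := by
  have key : (∀ t ∈ J, μ t ∈ O.prob) → (O.IsAlphaGeodesic α J μ ↔
      IsCentralGeodesic n m p J (fun t => Phi lam α (μ t))) := fun h => by
    rw [isAlphaGeodesic_iff hl hm hJ hn, isDensityGeodesic_iff m (param_ne_zero hα hp)
      (eq_one_sub hα hp) (hJ.uniqueDiffOn hn)
      fun t ht x => ((mem_prob_iff hl hm).1 (h t ht)).2.1 x]
    simp only [Phi_eq hp]
  exact ⟨fun h => ⟨h.2.1, (key h.2.1).1 h⟩, fun h => (key h.1).2 h.2⟩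

theorem isAlphaGeodesic_of_central (hJ : J.OrdConnected) (hn : J.Nontrivial)
    {γ : ℝ → M → ℝ} (h : IsCentralGeodesic n m p J γ) {ν : ℝ → TopForm n M}
    (hν : ∀ t ∈ J, ν t = PhiInv lam α (γ t)) : O.IsAlphaGeodesic α J ν := by
  refine (isAlphaGeodesic_iff_central hl hm hα hp hJ hn).2 ⟨fun t ht => ?_, h.congr fun t ht => ?_⟩
  · rw [hν t ht]
    exact PhiInv_mem_prob hl hm hα hp
      ((mem_sphere_iff hm hp).2 ⟨h.1.contMDiff ht, h.2.1 t ht⟩)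
  · rw [hν t ht]
    exact Phi_PhiInv hl hα hp (h.2.1 t ht).1

omit hl [IsProbabilityMeasure m] [BorelSpace M] in
theorem isSphereGeodesic_iff (hJ : J.OrdConnected) (hn : J.Nontrivial)
    {γ : ℝ → M → ℝ} : O.IsSphereGeodesic lam α J γ ↔ IsCentralGeodesic n m p J γ := by
  have hu := hJ.uniqueDiffOn hn
  have hp' := abs_pos.2 (param_ne_zero hα hp)
  refine and_congr_right fun hs => ?_
  have hS : (∀ t ∈ J, γ t ∈ O.sphere lam α) ↔
      ∀ t ∈ J, (∀ x, 0 < γ t x) ∧ ∫ x, γ t x ^ p ∂m = |p| ^ p := forall₂_congr fun t ht => by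
    rw [mem_sphere_iff hm hp]
    exact and_iff_right (hs.contMDiff ht)
  rw [hS]
  refine and_congr_right fun hS => forall₂_congr fun t ht => ?_
  have hpos := (hS t ht).1
  have hc : Continuous fun x => γ t x ^ (p - 1) * fnVelocity (fnVelocity γ J) J t x :=
    ((hs.contMDiff ht).rpow_const_of_pos hpos _).continuous.mul
      (((hs.fnVelocity hu).fnVelocity hu).continuous ht)
  rw [radialProj, param_sub_one hα hp, hm _ hc, abs_param_inv hp, ← hp, sub_eq_zero]
  constructor
  · intro h
    exact ⟨_, fun x => congrFun h x⟩
  · rintro ⟨φ, hφ⟩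
    have h1 : ∀ x, γ t x ^ (p - 1) * (φ * γ t x) = φ * γ t x ^ p := fun x => by
      rw [Real.rpow_sub_one (hpos x).ne']
      have := (hpos x).ne'
      field_simp
    funext x
    simp only [hφ, h1, integral_const_mul, (hS t ht).2, Pi.smul_apply, smul_eq_mul,
      Real.inv_rpow hp'.le]
    have := (Real.rpow_pos_of_pos hp' p).ne'
    field_simp

omit hl in
theorem solvesTimeChange_iff (hJ : J.OrdConnected) (hn : J.Nontrivial) (h0 : (0 : ℝ) ∈ J)
    {f ξ : M → ℝ} (hf : f ∈ O.sphere lam α) (hξ : ContMDiff (𝓡 n) 𝓘(ℝ, ℝ) ∞ ξ) {τ : ℝ → ℝ} :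
    O.SolvesTimeChange lam α f ξ J τ ↔ MapsTo τ J (lineDomain f ξ) ∧ τ 0 = 0 ∧
      ∀ t ∈ J, HasDerivWithinAt τ ((|p| ^ 2)⁻¹ * linePow m p f ξ (τ t) ^ (2 / p)) J t := by
  have hu := hJ.uniqueDiffOn hn
  have hp0 := param_ne_zero hα hp
  obtain ⟨hfs, hf0, hfp⟩ := (mem_sphere_iff hm hp).1 hf
  have hode : MapsTo τ J (lineDomain f ξ) → ∀ t ∈ J,
      2 * (O.integralFn lam (fun x => (f x + τ t * ξ x) ^ ((1 + α) / (1 - α)) * ξ x) /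
        O.integralFn lam (fun x => (f x + τ t * ξ x) ^ (2 / (1 - α)))) * derivWithin τ J t ^ 2 =
      2 * ((∫ x, (f x + τ t * ξ x) ^ (p - 1) * ξ x ∂m) / linePow m p f ξ (τ t)) *
        derivWithin τ J t ^ 2 := fun hI t ht => by
    have hls : ContMDiff (𝓡 n) 𝓘(ℝ, ℝ) ∞ fun x => f x + τ t * ξ x :=
      hfs.add (contMDiff_const.mul hξ)
    rw [param_sub_one hα hp, ← hp, hm _ (hls.rpow_const_of_pos (hI ht) p).continuous,
      hm (fun x => (f x + τ t * ξ x) ^ (p - 1) * ξ x)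
        ((hls.rpow_const_of_pos (hI ht) (p - 1)).continuous.mul hξ.continuous)]
    rfl
  constructor
  · rintro ⟨hI, hd, h2, hτ0, hτ1⟩
    exact ⟨hI, hτ0, hasDerivWithinAt_of_timeChange hp0 hJ h0 hfs hξ hfp hI hd
      (fun t ht => (h2 t ht).congr_deriv (hode hI t ht)) hτ0 hτ1⟩
  · rintro ⟨hI, hτ0, h1⟩
    obtain ⟨h2, hτ1⟩ := timeChange_of_hasDerivWithinAt hp0 hu h0 hfs hξ hfp hI hτ0 h1
    exact ⟨hI, fun t ht => (h1 t ht).differentiableWithinAt,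
      fun t ht => (h2 t ht).congr_deriv (hode hI t ht).symm, hτ0, hτ1⟩

omit hl hα [IsProbabilityMeasure m] [BorelSpace M] in
theorem projLine_eq {f ξ : M → ℝ} (hf : ContMDiff (𝓡 n) 𝓘(ℝ, ℝ) ∞ f)
    (hξ : ContMDiff (𝓡 n) 𝓘(ℝ, ℝ) ∞ ξ) {s : ℝ} (hs : s ∈ lineDomain f ξ) :
    O.projLine lam α f ξ s =
      fun x => |p| * ((f x + s * ξ x) / linePow m p f ξ s ^ p⁻¹) := by
  have hls : ContMDiff (𝓡 n) 𝓘(ℝ, ℝ) ∞ fun x => f x + s * ξ x := hf.add (contMDiff_const.mul hξ)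
  funext x
  rw [projLine, abs_param hp, param_inv hp, ← hp, hm _ (hls.rpow_const_of_pos hs p).continuous]
  rfl

theorem isAlphaGeodesic_projLine (hJ : J.OrdConnected) (hn : J.Nontrivial)
    {f ξ : M → ℝ} (hf : ContMDiff (𝓡 n) 𝓘(ℝ, ℝ) ∞ f) (hξ : ContMDiff (𝓡 n) 𝓘(ℝ, ℝ) ∞ ξ)
    {τ : ℝ → ℝ} {C : ℝ} (hI : MapsTo τ J (lineDomain f ξ))
    (hτ : ∀ t ∈ J, HasDerivWithinAt τ (C * linePow m p f ξ (τ t) ^ (2 / p)) J t) :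
    O.IsAlphaGeodesic α J (fun t => PhiInv lam α (O.projLine lam α f ξ (τ t))) :=
  isAlphaGeodesic_of_central hl hm hα hp hJ hn
    (isCentralGeodesic_line (param_ne_zero hα hp) hJ hn hf hξ hI hτ)
    fun t ht => by rw [projLine_eq hm hp hf hξ (hI ht)]

omit hl hα [IsProbabilityMeasure m] [BorelSpace M] in
/-- The projection fixes the points of the hypersurface. -/
theorem projLine_of_mem_sphere (hp0 : p ≠ 0) {f ξ : M → ℝ} (hf : ContMDiff (𝓡 n) 𝓘(ℝ, ℝ) ∞ f)
    (hξ : ContMDiff (𝓡 n) 𝓘(ℝ, ℝ) ∞ ξ) {s : ℝ} {k : M → ℝ} (hk : k ∈ O.sphere lam α)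
    (hks : ∀ x, f x + s * ξ x = k x) : O.projLine lam α f ξ s = k := by
  obtain ⟨-, hk0, hkp⟩ := (mem_sphere_iff hm hp).1 hk
  have hp' := abs_pos.2 hp0
  rw [projLine_eq hm hp hf hξ fun x => by rw [hks]; exact hk0 x]
  funext x
  simp only [linePow, hks, hkp, Real.rpow_rpow_inv hp'.le hp0]
  exact mul_div_cancel₀ _ hp'.ne'

end

end OrientedAtlas

/-! ### Initial and boundary value problems -/

namespace OrientedAtlas

variable {n : ℕ} {M : Type*} [TopologicalSpace M] [T2Space M] [CompactSpace M]
  [ChartedSpace (EuclideanSpace ℝ (Fin n)) M] [IsManifold (𝓡 n) ∞ M]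
  [MeasurableSpace M] [BorelSpace M] {O : OrientedAtlas n M} {lam : TopForm n M}
  {m : Measure M} [IsProbabilityMeasure m] {J : Set ℝ} {α p : ℝ}

section

variable (hl : lam ∈ O.prob) (hm : ∀ g : M → ℝ, Continuous g → O.integralFn lam g = ∫ x, g x ∂m)

include hl hm

theorem velocity_eq_mulFn (hJ : J.OrdConnected) (hn : J.Nontrivial) {μ : ℝ → TopForm n M}
    (h : O.IsAlphaGeodesic α J μ) {t : ℝ} (ht : t ∈ J) : TopForm.velocity μ J t =
      TopForm.mulFn (fnVelocity (fun t => TopForm.rn (μ t) lam) J t) lam := by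
  rw [← velocity_mulFn (hJ.uniqueDiffOn hn) ((isAlphaGeodesic_iff hl hm hJ hn).1 h).1 ht]
  simp only [TopForm.mulFn_rn (ne_zero_of_mem_dens hl.1)]

theorem integral_fnVelocity_rn (hJ : J.OrdConnected) (hn : J.Nontrivial) {μ : ℝ → TopForm n M}
    (h : O.IsAlphaGeodesic α J μ) {t : ℝ} (ht : t ∈ J) :
    ∫ x, fnVelocity (fun t => TopForm.rn (μ t) lam) J t x ∂m = 0 := by
  obtain ⟨h1, h2, -⟩ := (isAlphaGeodesic_iff (m := m) hl hm hJ hn).1 h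
  exact (hJ.uniqueDiffOn hn t ht).eq_deriv J (h1.hasDerivWithinAt_integral m hJ hn ht)
    ((hasDerivWithinAt_const t J (1 : ℝ)).congr_of_mem (fun t ht => (h2 t ht).2) ht)

end

section Power

variable (hl : lam ∈ O.prob) (hm : ∀ g : M → ℝ, Continuous g → O.integralFn lam g = ∫ x, g x ∂m)
  (hα : α ≠ 1) (hp : p = 2 / (1 - α))

include hl hm hα hp

/-- Every geodesic is a reparametrized projected line. -/
theorem exists_timeChange_of_geodesic (hJ : J.OrdConnected) (hn : J.Nontrivial)
    (h0 : (0 : ℝ) ∈ J) {μ : ℝ → TopForm n M} (h : O.IsAlphaGeodesic α J μ) {f ξ : M → ℝ}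
    (hf : f = Phi lam α (μ 0)) (hξ : ξ = fnVelocity (fun t => Phi lam α (μ t)) J 0) :
    ξ ∈ O.sphereTangent lam α f ∧ ∃ τ : ℝ → ℝ, O.SolvesTimeChange lam α f ξ J τ ∧
      ∀ t ∈ J, μ t = PhiInv lam α (O.projLine lam α f ξ (τ t)) := by
  have hu := hJ.uniqueDiffOn hn
  obtain ⟨hprob, hc⟩ := (isAlphaGeodesic_iff_central hl hm hα hp hJ hn).1 h
  obtain ⟨horth, τ, hτ0, hI, hτ, hline⟩ := hc.exists_line (param_ne_zero hα hp) hJ hn h0 hf hξ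
  have hfS : f ∈ O.sphere lam α := hf ▸ Phi_mem_sphere hl hm hα hp (hprob 0 h0)
  have hξs : ContMDiff (𝓡 n) 𝓘(ℝ, ℝ) ∞ ξ := hξ ▸ (hc.1.fnVelocity hu).contMDiff h0
  refine ⟨⟨hξs, ?_⟩, τ, (solvesTimeChange_iff hm hα hp hJ hn h0 hfS hξs).2 ⟨hI, hτ0, hτ⟩,
    fun t ht => ?_⟩
  · rw [param_sub_one hα hp, hm (fun x => f x ^ (p - 1) * ξ x)
      ((hfS.1.rpow_const_of_pos hfS.2.1 _).continuous.mul hξs.continuous), horth]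
  · rw [projLine_eq hm hp hfS.1 hξs (hI ht), ← funext (hline t ht)]
    exact (PhiInv_Phi hl hα hp ((mem_prob_iff hl hm).1 (hprob t ht)).2.1).symm

/-- The straight segment between two points, run through at the right speed. -/
theorem exists_timeChange_segment {μ₀ μ₁ : TopForm n M} (h₀ : μ₀ ∈ O.prob) (h₁ : μ₁ ∈ O.prob)
    {f ξ : M → ℝ} (hf : f = Phi lam α μ₀) (hξ : ξ = Phi lam α μ₁ - f) :
    ∃ T : ℝ, 0 < T ∧ ∃ τ : ℝ → ℝ, O.SolvesTimeChange lam α f ξ (Icc 0 T) τ ∧ τ T = 1 ∧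
      O.IsAlphaGeodesicFromTo α μ₀ μ₁
        (fun t => PhiInv lam α (O.projLine lam α f ξ (τ (T * t)))) := by
  have hp0 := param_ne_zero hα hp
  have hfS : f ∈ O.sphere lam α := hf ▸ Phi_mem_sphere hl hm hα hp h₀
  have hkS : Phi lam α μ₁ ∈ O.sphere lam α := Phi_mem_sphere hl hm hα hp h₁
  have hξs : ContMDiff (𝓡 n) 𝓘(ℝ, ℝ) ∞ ξ := hξ ▸ hkS.1.sub hfS.1
  have hfk : ∀ x, f x + 1 * ξ x = Phi lam α μ₁ x := fun x => by
    rw [hξ, Pi.sub_apply]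
    ring
  obtain ⟨K, τ, -, hK, hK0, hτ0, hτ, hsurj⟩ :=
    exists_timeChange (m := m) hp0 hfS.1 hξs hfS.2.1
  obtain ⟨T, hTK, hT1, hTpos⟩ := hsurj 1 fun x => by rw [hfk]; exact hkS.2.1 x
  have hT := hTpos one_pos
  have hsub : Icc 0 T ⊆ K := hK.out hK0 hTK
  have hn : (Icc 0 T).Nontrivial := ⟨0, left_mem_Icc.2 hT.le, T, right_mem_Icc.2 hT.le, hT.ne⟩
  have hscale : MapsTo (fun t => T * t) (Icc 0 1) (Icc 0 T) := fun t ht =>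
    ⟨mul_nonneg hT.le ht.1, mul_le_of_le_one_right hT.le ht.2⟩
  refine ⟨T, hT, τ, (solvesTimeChange_iff hm hα hp ordConnected_Icc hn (left_mem_Icc.2 hT.le) hfS
    hξs).2 ⟨fun t ht => (hτ t (hsub ht)).1, hτ0, fun t ht => (hτ t (hsub ht)).2.hasDerivWithinAt⟩,
    hT1, ?_, ?_, ?_⟩
  · refine isAlphaGeodesic_projLine hl hm hα hp (C := T * (|p| ^ 2)⁻¹) ordConnected_Icc
      ⟨0, left_mem_Icc.2 zero_le_one, 1, right_mem_Icc.2 zero_le_one, zero_ne_one⟩ hfS.1 hξs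
      (fun t ht => (hτ _ (hsub (hscale ht))).1) fun t ht => ?_
    have h1 : HasDerivAt (fun t => T * t) T t := by
      simpa using (hasDerivAt_id t).const_mul T
    refine (((hτ _ (hsub (hscale ht))).2.comp t h1).hasDerivWithinAt).congr_deriv ?_
    ring
  · beta_reduce
    rw [mul_zero, hτ0, projLine_of_mem_sphere hm hp hp0 hfS.1 hξs hfS (by simp), hf]
    exact PhiInv_Phi hl hα hp ((mem_prob_iff hl hm).1 h₀).2.1
  · beta_reduce
    rw [mul_one, hT1, projLine_of_mem_sphere hm hp hp0 hfS.1 hξs hkS hfk]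
    exact PhiInv_Phi hl hα hp ((mem_prob_iff hl hm).1 h₁).2.1

omit hα in
/-- The differential of `Φ_α` maps the velocity of a curve of forms to that of its image. -/
theorem fnVelocity_Phi (hJ : J.OrdConnected) (hn : J.Nontrivial) {μ : ℝ → TopForm n M}
    (h : O.IsAlphaGeodesic α J μ) {t : ℝ} (ht : t ∈ J) (x : M) :
    fnVelocity (fun t => Phi lam α (μ t)) J t x =
      |p| * p⁻¹ * TopForm.rn (μ t) lam x ^ (p⁻¹ - 1) *
        TopForm.rn (TopForm.velocity μ J t) lam x := by
  obtain ⟨h1, h2, -⟩ := (isAlphaGeodesic_iff (m := m) hl hm hJ hn).1 h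
  rw [velocity_eq_mulFn hl hm hJ hn h ht, TopForm.rn_mulFn (ne_zero_of_mem_dens hl.1)]
  simp only [Phi_eq hp]
  exact fnVelocity_rpow (hJ.uniqueDiffOn hn) h1 (fun t ht => (h2 t ht).1) _ _ ht x

theorem exists_geodesic_of_initial_power {μ₀ a : TopForm n M} (h₀ : μ₀ ∈ O.prob)
    (ha : a ∈ O.tangentProb) :
    ∃ ε : ℝ, 0 < ε ∧ ∃ μ : ℝ → TopForm n M, O.IsAlphaGeodesic α (Ioo (-ε) ε) μ ∧
      μ 0 = μ₀ ∧ TopForm.velocity μ (Ioo (-ε) ε) 0 = a := by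
  have hp0 := param_ne_zero hα hp
  have hp' := abs_pos.2 hp0
  obtain ⟨hus, hu0, hu1⟩ := (mem_prob_iff hl hm).1 h₀
  obtain ⟨hbs, hb0⟩ := (mem_tangentProb_iff hl hm).1 ha
  set f := Phi lam α μ₀ with hf
  set ξ : M → ℝ := fun x => |p| * p⁻¹ * TopForm.rn μ₀ lam x ^ (p⁻¹ - 1) * TopForm.rn a lam x
    with hξ
  have hfS : f ∈ O.sphere lam α := Phi_mem_sphere hl hm hα hp h₀
  have hξs : ContMDiff (𝓡 n) 𝓘(ℝ, ℝ) ∞ ξ :=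
    (contMDiff_const.mul (hus.rpow_const_of_pos hu0 _)).mul hbs
  obtain ⟨-, hfpos, hfp⟩ := (mem_sphere_iff hm hp).1 hfS
  have horth : ∫ x, f x ^ (p - 1) * ξ x ∂m = 0 := by
    have h1 : ∀ x, f x ^ (p - 1) * ξ x = |p| ^ (p - 1) * (|p| * p⁻¹) * TopForm.rn a lam x :=
      fun x => by
        have h2 : TopForm.rn μ₀ lam x ^ (p⁻¹ * (p - 1)) * TopForm.rn μ₀ lam x ^ (p⁻¹ - 1) = 1 := by
          rw [← Real.rpow_add (hu0 x), show p⁻¹ * (p - 1) + (p⁻¹ - 1) = 0 by field_simp; ring,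
            Real.rpow_zero]
        rw [hf, Phi_eq hp, hξ]
        beta_reduce
        rw [Real.mul_rpow hp'.le (Real.rpow_nonneg (hu0 x).le _), ← Real.rpow_mul (hu0 x).le]
        linear_combination |p| ^ (p - 1) * (|p| * p⁻¹) * TopForm.rn a lam x * h2
    simp only [h1, integral_const_mul, hb0, mul_zero]
  obtain ⟨K, τ, hKo, -, hK0, hτ0, hτ, -⟩ := exists_timeChange (m := m) hp0 hfS.1 hξs hfpos
  obtain ⟨ε, hε, hball⟩ := Metric.isOpen_iff.1 hKo 0 hK0
  rw [Real.ball_eq_Ioo, zero_sub, zero_add] at hball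
  have h00 : (0 : ℝ) ∈ Ioo (-ε) ε := ⟨by linarith, hε⟩
  have hn : (Ioo (-ε) ε).Nontrivial := ⟨0, h00, ε / 2, ⟨by linarith, by linarith⟩, by linarith⟩
  have hJ : (Ioo (-ε) ε).OrdConnected := ordConnected_Ioo
  have hgeo := isAlphaGeodesic_projLine hl hm hα hp hJ hn hfS.1 hξs
    (fun t ht => (hτ t (hball ht)).1) (fun t ht => (hτ t (hball ht)).2.hasDerivWithinAt)
  have hstart : PhiInv lam α (O.projLine lam α f ξ (τ 0)) = μ₀ := by
    rw [hτ0, projLine_of_mem_sphere hm hp hp0 hfS.1 hξs hfS (by simp)]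
    exact PhiInv_Phi hl hα hp hu0
  refine ⟨ε, hε, _, hgeo, hstart, ?_⟩
  -- both sides have the same image under the differential of `Φ_α`
  have hvel : ∀ x, ξ x = |p| * p⁻¹ * TopForm.rn μ₀ lam x ^ (p⁻¹ - 1) * TopForm.rn
      (TopForm.velocity (fun t => PhiInv lam α (O.projLine lam α f ξ (τ t))) (Ioo (-ε) ε) 0)
      lam x := fun x => by
    have h1 := fnVelocity_Phi hl hm hp hJ hn hgeo h00 x
    rw [hstart] at h1
    rw [← h1]
    have hc := isCentralGeodesic_line (m := m) hp0 hJ hn hfS.1 hξs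
      (fun t ht => (hτ t (hball ht)).1) (fun t ht => (hτ t (hball ht)).2.hasDerivWithinAt)
    have h2 : ∀ t ∈ Ioo (-ε) ε, Phi lam α (PhiInv lam α (O.projLine lam α f ξ (τ t))) =
        fun x => |p| * ((f x + τ t * ξ x) / linePow m p f ξ (τ t) ^ p⁻¹) := fun t ht => by
      rw [projLine_eq hm hp hfS.1 hξs (hτ t (hball ht)).1]
      exact Phi_PhiInv hl hα hp (hc.2.1 t ht).1
    have h3 : fnVelocity (fun t => Phi lam α (PhiInv lam α (O.projLine lam α f ξ (τ t))))
        (Ioo (-ε) ε) 0 x = fnVelocity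
          (fun t x => |p| * ((f x + τ t * ξ x) / linePow m p f ξ (τ t) ^ p⁻¹)) (Ioo (-ε) ε) 0 x :=
      derivWithin_congr (fun t ht => congrFun (h2 t ht) x) (congrFun (h2 0 h00) x)
    rw [h3, fnVelocity_line_zero hp0 (hJ.uniqueDiffOn hn) h00 hfS.1 hξs hfpos hfp horth hτ0
      (hτ 0 hK0).2.hasDerivWithinAt]
  have h0 := ne_zero_of_mem_dens hl.1
  rw [← TopForm.mulFn_rn h0 a, ← TopForm.mulFn_rn h0 (TopForm.velocity _ _ _)]
  congr 1
  funext x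
  have h4 : |p| * p⁻¹ * TopForm.rn μ₀ lam x ^ (p⁻¹ - 1) ≠ 0 :=
    mul_ne_zero (mul_ne_zero hp'.ne' (inv_ne_zero hp0)) (Real.rpow_pos_of_pos (hu0 x) _).ne'
  exact (mul_left_cancel₀ h4 (hvel x)).symm

omit [BorelSpace M] [IsProbabilityMeasure m] in
theorem eqOn_of_Phi_eqOn {μ ν : ℝ → TopForm n M} (hμ : ∀ t ∈ J, μ t ∈ O.prob)
    (hν : ∀ t ∈ J, ν t ∈ O.prob)
    (h : EqOn (fun t => Phi lam α (μ t)) (fun t => Phi lam α (ν t)) J) : EqOn μ ν J :=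
  fun t ht => (invOn_PhiInv hl hm hα hp).1.injOn (hμ t ht) (hν t ht) (h ht)

theorem eqOn_of_initial_power (hJ : J.OrdConnected) (hn : J.Nontrivial) (h0 : (0 : ℝ) ∈ J)
    {μ ν : ℝ → TopForm n M} (hμ : O.IsAlphaGeodesic α J μ) (hν : O.IsAlphaGeodesic α J ν)
    (h : μ 0 = ν 0) (h' : TopForm.velocity μ J 0 = TopForm.velocity ν J 0) : EqOn μ ν J := by
  obtain ⟨hμp, hμc⟩ := (isAlphaGeodesic_iff_central hl hm hα hp hJ hn).1 hμ
  obtain ⟨hνp, hνc⟩ := (isAlphaGeodesic_iff_central hl hm hα hp hJ hn).1 hν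
  refine eqOn_of_Phi_eqOn hl hm hα hp hμp hνp
    (hμc.eqOn_of_initial hνc (param_ne_zero hα hp) hJ hn h0 (congrArg _ h) ?_)
  funext x
  rw [fnVelocity_Phi hl hm hp hJ hn hμ h0, fnVelocity_Phi hl hm hp hJ hn hν h0, h, h']

theorem eqOn_of_boundary_power {μ ν : ℝ → TopForm n M} (hμ : O.IsAlphaGeodesic α (Icc 0 1) μ)
    (hν : O.IsAlphaGeodesic α (Icc 0 1) ν) (h : μ 0 = ν 0) (h' : μ 1 = ν 1) :
    EqOn μ ν (Icc 0 1) := by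
  have hn : (Icc (0 : ℝ) 1).Nontrivial :=
    ⟨0, left_mem_Icc.2 zero_le_one, 1, right_mem_Icc.2 zero_le_one, zero_ne_one⟩
  obtain ⟨hμp, hμc⟩ := (isAlphaGeodesic_iff_central hl hm hα hp ordConnected_Icc hn).1 hμ
  obtain ⟨hνp, hνc⟩ := (isAlphaGeodesic_iff_central hl hm hα hp ordConnected_Icc hn).1 hν
  exact eqOn_of_Phi_eqOn hl hm hα hp hμp hνp
    (hμc.eqOn_of_boundary hνc (param_ne_zero hα hp) (congrArg _ h) (congrArg _ h'))

end Power

/-! ### The exponential connection -/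

section Exponential

variable (hl : lam ∈ O.prob) (hm : ∀ g : M → ℝ, Continuous g → O.integralFn lam g = ∫ x, g x ∂m)

include hm in
omit [BorelSpace M] [IsProbabilityMeasure m] in
theorem mem_zeroMean_iff {h : M → ℝ} :
    h ∈ O.zeroMean lam ↔ ContMDiff (𝓡 n) 𝓘(ℝ, ℝ) ∞ h ∧ ∫ x, h x ∂m = 0 := by
  rw [zeroMean, mem_ofPred_eq]
  exact and_congr_right fun hs => by rw [hm h hs.continuous]

include hl hm

omit [BorelSpace M] [IsProbabilityMeasure m] in
theorem contMDiff_log_rn {μ : TopForm n M} (h : μ ∈ O.prob) :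
    ContMDiff (𝓡 n) 𝓘(ℝ, ℝ) ∞ fun x => Real.log (TopForm.rn μ lam x) := by
  obtain ⟨h1, h2, -⟩ := (mem_prob_iff hl hm).1 h
  exact fun x => (Real.contDiffAt_log.2 (h2 x).ne').comp_contMDiffAt (h1 x)

omit [BorelSpace M] [IsProbabilityMeasure m] in
theorem PhiOne_apply {μ : TopForm n M} (h : μ ∈ O.prob) (x : M) : O.PhiOne lam μ x =
    Real.log (TopForm.rn μ lam x) - ∫ z, Real.log (TopForm.rn μ lam z) ∂m := by
  rw [PhiOne, hm _ (contMDiff_log_rn hl hm h).continuous]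

theorem PhiOne_mem_zeroMean {μ : TopForm n M} (h : μ ∈ O.prob) :
    O.PhiOne lam μ ∈ O.zeroMean lam := by
  have hs := contMDiff_log_rn hl hm h
  rw [mem_zeroMean_iff hm, funext (PhiOne_apply hl hm h)]
  refine ⟨hs.sub contMDiff_const, ?_⟩
  rw [integral_sub (hs.continuous.integrable_of_compactSpace m) (integrable_const _)]
  simp

theorem rn_eq_expDensity {μ : TopForm n M} (h : μ ∈ O.prob) :
    TopForm.rn μ lam = expDensity m (O.PhiOne lam μ) := by
  obtain ⟨-, h2, h3⟩ := (mem_prob_iff hl hm).1 h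
  exact eq_expDensity h2 (PhiOne_mem_zeroMean hl hm h).1.continuous h3
    fun x => (PhiOne_apply hl hm h x).symm

theorem injOn_PhiOne : InjOn (O.PhiOne lam) O.prob := fun μ hμ ν hν h => by
  have h0 := ne_zero_of_mem_dens hl.1
  rw [← TopForm.mulFn_rn h0 μ, ← TopForm.mulFn_rn h0 ν, rn_eq_expDensity hl hm hμ,
    rn_eq_expDensity hl hm hν, h]

theorem expForm_mem_prob {k : M → ℝ} (hk : ContMDiff (𝓡 n) 𝓘(ℝ, ℝ) ∞ k) :
    TopForm.mulFn (expDensity m k) lam ∈ O.prob :=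
  (mulFn_mem_prob_iff hl hm).2 ⟨contMDiff_expDensity hk, fun _ => Real.exp_pos _,
    integral_expDensity hk.continuous⟩

theorem PhiOne_expForm {k : M → ℝ} (hk : k ∈ O.zeroMean lam) :
    O.PhiOne lam (TopForm.mulFn (expDensity m k) lam) = k := by
  obtain ⟨h1, h2⟩ := (mem_zeroMean_iff hm).1 hk
  funext x
  rw [PhiOne_apply hl hm (expForm_mem_prob hl hm h1),
    TopForm.rn_mulFn (ne_zero_of_mem_dens hl.1), log_expDensity h1.continuous h2]

theorem bijOn_PhiOne : BijOn (O.PhiOne lam) O.prob (O.zeroMean lam) :=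
  ⟨fun _ h => PhiOne_mem_zeroMean hl hm h, injOn_PhiOne hl hm, fun _ hk =>
    ⟨_, expForm_mem_prob hl hm hk.1, PhiOne_expForm hl hm hk⟩⟩

theorem isAlphaGeodesic_one_iff (hJ : J.OrdConnected) (hn : J.Nontrivial)
    {μ : ℝ → TopForm n M} : O.IsAlphaGeodesic 1 J μ ↔ (∀ t ∈ J, μ t ∈ O.prob) ∧
      ∃ g ∈ O.zeroMean lam, ∃ h ∈ O.zeroMean lam, ∀ t ∈ J, O.PhiOne lam (μ t) = g + t • h := by
  constructor
  · intro hμ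
    obtain ⟨g, h, hg, hh, hgh⟩ := ((isAlphaGeodesic_iff hl hm hJ hn).1 hμ).exists_affine hJ hn
    refine ⟨hμ.2.1, g, (mem_zeroMean_iff hm).2 hg, h, (mem_zeroMean_iff hm).2 hh,
      fun t ht => funext fun x => ?_⟩
    rw [PhiOne_apply hl hm (hμ.2.1 t ht), hgh t ht]
    rfl
  · rintro ⟨hμ, g, hg, h, hh, hgh⟩
    rw [isAlphaGeodesic_iff hl hm hJ hn]
    refine isDensityGeodesic_one_of_affine hJ hn
      (fun t ht => ((mem_prob_iff hl hm).1 (hμ t ht)).2) hg.1 hh.1 fun t ht x => ?_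
    rw [← PhiOne_apply hl hm (hμ t ht), hgh t ht]
    rfl

omit hl in
theorem add_smul_mem_zeroMean {g h : M → ℝ} (hg : g ∈ O.zeroMean lam) (hh : h ∈ O.zeroMean lam)
    (t : ℝ) : g + t • h ∈ O.zeroMean lam := by
  obtain ⟨h1, h2⟩ := (mem_zeroMean_iff hm).1 hg
  obtain ⟨h3, h4⟩ := (mem_zeroMean_iff hm).1 hh
  refine (mem_zeroMean_iff hm).2 ⟨h1.add (contMDiff_const.mul h3), ?_⟩
  have h5 : ∫ x, (g x + t * h x) ∂m = 0 := by
    rw [integral_add (h1.continuous.integrable_of_compactSpace m)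
      ((h3.continuous.const_mul t).integrable_of_compactSpace m), integral_const_mul, h2, h4]
    simp
  exact h5

/-- Exponential curves exist for all times. -/
theorem exists_expGeodesic {g h : M → ℝ} (hg : g ∈ O.zeroMean lam) (hh : h ∈ O.zeroMean lam) :
    ∃ μ : ℝ → TopForm n M, (∀ t, μ t ∈ O.prob) ∧ (∀ t, O.PhiOne lam (μ t) = g + t • h) ∧
      ∀ J : Set ℝ, J.OrdConnected → J.Nontrivial → O.IsAlphaGeodesic 1 J μ := by
  have h1 : ∀ t : ℝ, g + t • h ∈ O.zeroMean lam := add_smul_mem_zeroMean hm hg hh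
  have h2 := fun t => expForm_mem_prob hl hm (h1 t).1
  have h3 := fun t => PhiOne_expForm hl hm (h1 t)
  exact ⟨fun t => TopForm.mulFn (expDensity m (g + t • h)) lam, h2, h3, fun J hJ hn =>
    (isAlphaGeodesic_one_iff hl hm hJ hn).2 ⟨fun t _ => h2 t, g, hg, h, hh, fun t _ => h3 t⟩⟩

/-- The direction of an exponential geodesic, in terms of its velocity. -/
theorem direction_of_PhiOne (hJ : J.OrdConnected) (hn : J.Nontrivial) {μ : ℝ → TopForm n M}
    (hμ : O.IsAlphaGeodesic 1 J μ) {g h : M → ℝ}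
    (hgh : ∀ t ∈ J, O.PhiOne lam (μ t) = g + t • h) {t : ℝ} (ht : t ∈ J) (x : M) :
    TopForm.rn (TopForm.velocity μ J t) lam x / TopForm.rn (μ t) lam x -
      ∫ z, TopForm.rn (TopForm.velocity μ J t) lam z / TopForm.rn (μ t) lam z ∂m = h x := by
  obtain ⟨h1, h2, -⟩ := (isAlphaGeodesic_iff (m := m) hl hm hJ hn).1 hμ
  rw [velocity_eq_mulFn hl hm hJ hn hμ ht, TopForm.rn_mulFn (ne_zero_of_mem_dens hl.1)]
  refine velocity_div_sub_integral (g := g) hJ hn h1 (fun t ht => (h2 t ht).1)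
    (fun t ht x => ?_) ht x
  rw [← PhiOne_apply hl hm (hμ.2.1 t ht), hgh t ht]
  rfl

theorem exists_geodesic_of_initial_one {μ₀ a : TopForm n M} (h₀ : μ₀ ∈ O.prob)
    (ha : a ∈ O.tangentProb) :
    ∃ ε : ℝ, 0 < ε ∧ ∃ μ : ℝ → TopForm n M, O.IsAlphaGeodesic 1 (Ioo (-ε) ε) μ ∧
      μ 0 = μ₀ ∧ TopForm.velocity μ (Ioo (-ε) ε) 0 = a := by
  obtain ⟨hus, hu0, hu1⟩ := (mem_prob_iff hl hm).1 h₀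
  obtain ⟨hbs, hb0⟩ := (mem_tangentProb_iff hl hm).1 ha
  have hqs : ContMDiff (𝓡 n) 𝓘(ℝ, ℝ) ∞
      fun x => TopForm.rn a lam x / TopForm.rn μ₀ lam x := hbs.div₀ hus fun x => (hu0 x).ne'
  set h : M → ℝ := fun x => TopForm.rn a lam x / TopForm.rn μ₀ lam x -
    ∫ z, TopForm.rn a lam z / TopForm.rn μ₀ lam z ∂m with hh
  have hhz : h ∈ O.zeroMean lam := by
    refine (mem_zeroMean_iff hm).2 ⟨hqs.sub contMDiff_const, ?_⟩
    rw [hh, integral_sub (hqs.continuous.integrable_of_compactSpace m) (integrable_const _)]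
    simp
  obtain ⟨μ, hμp, hμ1, hμg⟩ := exists_expGeodesic hl hm (PhiOne_mem_zeroMean hl hm h₀) hhz
  have h00 : (0 : ℝ) ∈ Ioo (-1 : ℝ) 1 := by simp
  have hJ : (Ioo (-1 : ℝ) 1).OrdConnected := ordConnected_Ioo
  have hn : (Ioo (-1 : ℝ) 1).Nontrivial := ⟨0, h00, 1 / 2, by norm_num, by norm_num⟩
  have hgeo := hμg _ hJ hn
  have hstart : μ 0 = μ₀ := injOn_PhiOne hl hm (hμp 0) h₀ (by rw [hμ1]; simp)
  refine ⟨1, one_pos, μ, hgeo, hstart, ?_⟩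
  have hdir := direction_of_PhiOne hl hm hJ hn hgeo (fun t _ => hμ1 t) h00
  have hmass := integral_fnVelocity_rn hl hm hJ hn hgeo h00
  have hvel := velocity_eq_mulFn hl hm hJ hn hgeo h00
  have h0 := ne_zero_of_mem_dens hl.1
  rw [hstart] at hdir
  set w := TopForm.rn (TopForm.velocity μ (Ioo (-1 : ℝ) 1) 0) lam with hw
  have hmass' : ∫ x, w x ∂m = 0 := by
    rw [hw, hvel, TopForm.rn_mulFn h0, hmass]
  -- the velocity is determined up to a multiple of `μ₀`, which has nonzero mass
  obtain ⟨c, hc⟩ : ∃ c : ℝ, ∀ x, w x = TopForm.rn a lam x + c * TopForm.rn μ₀ lam x := by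
    refine ⟨(∫ z, w z / TopForm.rn μ₀ lam z ∂m) -
      ∫ z, TopForm.rn a lam z / TopForm.rn μ₀ lam z ∂m, fun x => ?_⟩
    have h1 := hdir x
    have h2 := (hu0 x).ne'
    rw [hh] at h1
    have h3 : w x / TopForm.rn μ₀ lam x = TopForm.rn a lam x / TopForm.rn μ₀ lam x +
        ((∫ z, w z / TopForm.rn μ₀ lam z ∂m) -
          ∫ z, TopForm.rn a lam z / TopForm.rn μ₀ lam z ∂m) := by
      linear_combination h1
    rw [div_eq_iff h2] at h3
    rw [h3, add_mul, div_mul_cancel₀ _ h2]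
  have hc0 : c = 0 := by
    simp only [hc] at hmass'
    rw [integral_add (hbs.continuous.integrable_of_compactSpace m)
      ((hus.continuous.const_mul c).integrable_of_compactSpace m), integral_const_mul, hb0, hu1]
      at hmass'
    linarith
  rw [← TopForm.mulFn_rn h0 a, ← TopForm.mulFn_rn h0 (TopForm.velocity _ _ _), ← hw]
  congr 1
  funext x
  rw [hc, hc0]
  ring

theorem eqOn_of_initial_one (hJ : J.OrdConnected) (hn : J.Nontrivial) (h0 : (0 : ℝ) ∈ J)
    {μ ν : ℝ → TopForm n M} (hμ : O.IsAlphaGeodesic 1 J μ) (hν : O.IsAlphaGeodesic 1 J ν)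
    (h : μ 0 = ν 0) (h' : TopForm.velocity μ J 0 = TopForm.velocity ν J 0) : EqOn μ ν J := by
  obtain ⟨hμp, g, -, k, -, hgk⟩ := (isAlphaGeodesic_one_iff hl hm hJ hn).1 hμ
  obtain ⟨hνp, g', -, k', -, hgk'⟩ := (isAlphaGeodesic_one_iff hl hm hJ hn).1 hν
  have hg : g = g' := by
    have h1 := hgk 0 h0
    have h2 := hgk' 0 h0
    rw [zero_smul, add_zero] at h1 h2
    rw [← h1, ← h2, h]
  have hk : k = k' := by
    funext x
    rw [← direction_of_PhiOne hl hm hJ hn hμ hgk h0 x, ← direction_of_PhiOne hl hm hJ hn hν hgk' h0 x,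
      h, h']
  exact fun t ht => injOn_PhiOne hl hm (hμp t ht) (hνp t ht) (by rw [hgk t ht, hgk' t ht, hg, hk])

theorem exists_geodesic_of_boundary_one {μ₀ μ₁ : TopForm n M} (h₀ : μ₀ ∈ O.prob)
    (h₁ : μ₁ ∈ O.prob) : ∃ μ : ℝ → TopForm n M, O.IsAlphaGeodesicFromTo 1 μ₀ μ₁ μ := by
  have hz : O.PhiOne lam μ₁ - O.PhiOne lam μ₀ ∈ O.zeroMean lam := by
    have := add_smul_mem_zeroMean hm (PhiOne_mem_zeroMean hl hm h₁)
      (PhiOne_mem_zeroMean hl hm h₀) (-1)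
    rwa [neg_one_smul, ← sub_eq_add_neg] at this
  obtain ⟨μ, hμp, hμ1, hμg⟩ := exists_expGeodesic hl hm (PhiOne_mem_zeroMean hl hm h₀) hz
  refine ⟨μ, hμg _ ordConnected_Icc
    ⟨0, left_mem_Icc.2 zero_le_one, 1, right_mem_Icc.2 zero_le_one, zero_ne_one⟩,
    injOn_PhiOne hl hm (hμp 0) h₀ (by rw [hμ1]; simp),
    injOn_PhiOne hl hm (hμp 1) h₁ (by rw [hμ1]; simp)⟩

theorem eqOn_of_boundary_one {μ ν : ℝ → TopForm n M} (hμ : O.IsAlphaGeodesic 1 (Icc 0 1) μ)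
    (hν : O.IsAlphaGeodesic 1 (Icc 0 1) ν) (h : μ 0 = ν 0) (h' : μ 1 = ν 1) :
    EqOn μ ν (Icc 0 1) := by
  have h0 : (0 : ℝ) ∈ Icc (0 : ℝ) 1 := left_mem_Icc.2 zero_le_one
  have h1 : (1 : ℝ) ∈ Icc (0 : ℝ) 1 := right_mem_Icc.2 zero_le_one
  have hn : (Icc (0 : ℝ) 1).Nontrivial := ⟨0, h0, 1, h1, zero_ne_one⟩
  obtain ⟨hμp, g, -, k, -, hgk⟩ := (isAlphaGeodesic_one_iff hl hm ordConnected_Icc hn).1 hμ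
  obtain ⟨hνp, g', -, k', -, hgk'⟩ := (isAlphaGeodesic_one_iff hl hm ordConnected_Icc hn).1 hν
  have hg : g = g' := by
    have e1 := hgk 0 h0
    have e2 := hgk' 0 h0
    rw [zero_smul, add_zero] at e1 e2
    rw [← e1, ← e2, h]
  have hk : k = k' := by
    have e1 := hgk 1 h1
    rw [h', hgk' 1 h1, hg, one_smul, one_smul] at e1
    exact (add_left_cancel e1).symm
  exact fun t ht => injOn_PhiOne hl hm (hμp t ht) (hνp t ht) (by rw [hgk t ht, hgk' t ht, hg, hk])

end Exponential

end OrientedAtlas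

/-! ### Geodesics of the `α`-connection -/

theorem mainTheorem5 {n : ℕ} {M : Type*} [TopologicalSpace M] [T2Space M] [CompactSpace M]
    [ChartedSpace (EuclideanSpace ℝ (Fin n)) M] [IsManifold (𝓡 n) ∞ M]
    (O : OrientedAtlas n M) (lam : TopForm n M) (hlam : lam ∈ O.prob) (α : ℝ) :
    -- for `α ≠ 1`: geodesics are the pullbacks of projected straight lines
    (α ≠ 1 →
      Set.BijOn (OrientedAtlas.Phi lam α) O.prob (O.sphere lam α) ∧
      Set.InvOn (OrientedAtlas.PhiInv lam α) (OrientedAtlas.Phi lam α) O.prob (O.sphere lam α) ∧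
      (∀ J : Set ℝ, J.OrdConnected → J.Nontrivial → ∀ μ : ℝ → TopForm n M,
        (O.IsAlphaGeodesic α J μ ↔
          (∀ t ∈ J, μ t ∈ O.prob) ∧
            O.IsSphereGeodesic lam α J (fun t => OrientedAtlas.Phi lam α (μ t)))) ∧
      (∀ J : Set ℝ, J.OrdConnected → J.Nontrivial → 0 ∈ J →
        ∀ f ∈ O.sphere lam α, ∀ ξ : M → ℝ, ContMDiff (𝓡 n) 𝓘(ℝ, ℝ) ∞ ξ →
        ∀ τ : ℝ → ℝ, O.SolvesTimeChange lam α f ξ J τ →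
          O.IsAlphaGeodesic α J
            (fun t => OrientedAtlas.PhiInv lam α (O.projLine lam α f ξ (τ t)))) ∧
      (∀ J : Set ℝ, J.OrdConnected → J.Nontrivial → 0 ∈ J →
        ∀ μ : ℝ → TopForm n M, O.IsAlphaGeodesic α J μ →
        ∀ f ξ : M → ℝ, f = OrientedAtlas.Phi lam α (μ 0) →
          ξ = fnVelocity (fun t => OrientedAtlas.Phi lam α (μ t)) J 0 →
          ξ ∈ O.sphereTangent lam α f ∧
          ∃ τ : ℝ → ℝ, O.SolvesTimeChange lam α f ξ J τ ∧
            ∀ t ∈ J, μ t = OrientedAtlas.PhiInv lam α (O.projLine lam α f ξ (τ t))) ∧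
      (∀ μ₀ ∈ O.prob, ∀ μ₁ ∈ O.prob, ∀ f ξ : M → ℝ,
        f = OrientedAtlas.Phi lam α μ₀ → ξ = OrientedAtlas.Phi lam α μ₁ - f →
        ∃ T : ℝ, 0 < T ∧ ∃ τ : ℝ → ℝ, O.SolvesTimeChange lam α f ξ (Set.Icc 0 T) τ ∧ τ T = 1 ∧
          O.IsAlphaGeodesicFromTo α μ₀ μ₁
            (fun t => OrientedAtlas.PhiInv lam α (O.projLine lam α f ξ (τ (T * t)))))) ∧
    -- for `α = 1`: geodesics are the pullbacks of straight lines in the zero-average functions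
    (α = 1 →
      Set.BijOn (O.PhiOne lam) O.prob (O.zeroMean lam) ∧
      ∀ J : Set ℝ, J.OrdConnected → J.Nontrivial → ∀ μ : ℝ → TopForm n M,
        (O.IsAlphaGeodesic α J μ ↔
          (∀ t ∈ J, μ t ∈ O.prob) ∧
            ∃ g ∈ O.zeroMean lam, ∃ h ∈ O.zeroMean lam,
              ∀ t ∈ J, O.PhiOne lam (μ t) = g + t • h)) ∧
    -- for every `α`: the initial value problem is solvable, uniquely on every interval
    (∀ μ₀ ∈ O.prob, ∀ a ∈ O.tangentProb,
      (∃ ε : ℝ, 0 < ε ∧ ∃ μ : ℝ → TopForm n M, O.IsAlphaGeodesic α (Set.Ioo (-ε) ε) μ ∧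
        μ 0 = μ₀ ∧ TopForm.velocity μ (Set.Ioo (-ε) ε) 0 = a) ∧
      ∀ J : Set ℝ, J.OrdConnected → J.Nontrivial → 0 ∈ J → ∀ μ ν : ℝ → TopForm n M,
        O.IsAlphaGeodesic α J μ → O.IsAlphaGeodesic α J ν →
        μ 0 = μ₀ → TopForm.velocity μ J 0 = a → ν 0 = μ₀ → TopForm.velocity ν J 0 = a →
        Set.EqOn μ ν J) ∧
    -- for every `α`: unique geodesic convexity
    (∀ μ₀ ∈ O.prob, ∀ μ₁ ∈ O.prob,
      (∃ μ : ℝ → TopForm n M, O.IsAlphaGeodesicFromTo α μ₀ μ₁ μ) ∧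
      ∀ μ ν : ℝ → TopForm n M, O.IsAlphaGeodesicFromTo α μ₀ μ₁ μ →
        O.IsAlphaGeodesicFromTo α μ₀ μ₁ ν → Set.EqOn μ ν (Set.Icc 0 1)) := by
  let _ : MeasurableSpace M := borel M
  have : BorelSpace M := ⟨rfl⟩
  obtain ⟨m, hmp, hm⟩ := O.exists_probabilityMeasure hlam
  refine ⟨fun hα => ?_, fun hα => ?_, fun μ₀ h₀ a ha => ⟨?_, ?_⟩, fun μ₀ h₀ μ₁ h₁ => ⟨?_, ?_⟩⟩
  · have hinv := OrientedAtlas.invOn_PhiInv hlam hm hα rfl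
    refine ⟨hinv.bijOn (fun _ h => OrientedAtlas.Phi_mem_sphere hlam hm hα rfl h)
      (fun _ h => OrientedAtlas.PhiInv_mem_prob hlam hm hα rfl h), hinv, ?_, ?_, ?_, ?_⟩
    · intro J hJ hn μ
      rw [OrientedAtlas.isAlphaGeodesic_iff_central hlam hm hα rfl hJ hn,
        OrientedAtlas.isSphereGeodesic_iff hm hα rfl hJ hn]
    · intro J hJ hn h0 f hf ξ hξ τ hτ
      obtain ⟨hI, -, h1⟩ := (OrientedAtlas.solvesTimeChange_iff hm hα rfl hJ hn h0 hf hξ).1 hτ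
      exact OrientedAtlas.isAlphaGeodesic_projLine hlam hm hα rfl hJ hn hf.1 hξ hI h1
    · intro J hJ hn h0 μ hμ f ξ hf hξ
      exact OrientedAtlas.exists_timeChange_of_geodesic hlam hm hα rfl hJ hn h0 hμ hf hξ
    · intro μ₀ h₀ μ₁ h₁ f ξ hf hξ
      exact OrientedAtlas.exists_timeChange_segment hlam hm hα rfl h₀ h₁ hf hξ
  · subst hα
    exact ⟨OrientedAtlas.bijOn_PhiOne hlam hm, fun J hJ hn μ =>
      OrientedAtlas.isAlphaGeodesic_one_iff hlam hm hJ hn⟩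
  · rcases eq_or_ne α 1 with rfl | hα
    · exact OrientedAtlas.exists_geodesic_of_initial_one hlam hm h₀ ha
    · exact OrientedAtlas.exists_geodesic_of_initial_power hlam hm hα rfl h₀ ha
  · intro J hJ hn h0 μ ν hμ hν e1 e2 e3 e4
    rcases eq_or_ne α 1 with rfl | hα
    · exact OrientedAtlas.eqOn_of_initial_one hlam hm hJ hn h0 hμ hν (e1.trans e3.symm)
        (e2.trans e4.symm)
    · exact OrientedAtlas.eqOn_of_initial_power hlam hm hα rfl hJ hn h0 hμ hν (e1.trans e3.symm)
        (e2.trans e4.symm)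
  · rcases eq_or_ne α 1 with rfl | hα
    · exact OrientedAtlas.exists_geodesic_of_boundary_one hlam hm h₀ h₁
    · obtain ⟨T, -, τ, -, -, h⟩ :=
        OrientedAtlas.exists_timeChange_segment hlam hm hα rfl h₀ h₁ rfl rfl
      exact ⟨_, h⟩
  · rintro μ ν ⟨hμ, e1, e2⟩ ⟨hν, e3, e4⟩
    rcases eq_or_ne α 1 with rfl | hα
    · exact OrientedAtlas.eqOn_of_boundary_one hlam hm hμ hν (e1.trans e3.symm) (e2.trans e4.symm)
    · exact OrientedAtlas.eqOn_of_boundary_power hlam hm hα rfl hμ hν (e1.trans e3.symm)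
        (e2.trans e4.symm)
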